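/- **Setting.** Let $\alpha\in(0,2)$, $\beta\in[-1,1]$, $\sigma>0$, and let $(\varepsilon_t)_{t\in\mathbb Z}$ be i.i.d. with the stable law $\mathcal S(\alpha,\beta,\sigma,0)$, i.e. $\mathbb E[e^{iu\varepsilon_t}]=\exp\{-\sigma^\alpha|u|^\alpha(1-i\beta\,\mathrm{sign}(u)\,w(\alpha,u))\}$, where $w(\alpha,u)=\tan(\pi\alpha/2)$ if $\alpha\neq1$ and $w(1,u)=-\frac2\pi\ln|u|$. Let $(d_k)_{k\in\mathbb Z}$ be real, not identically zero, such that - if $\alpha\ne1$ or $(\alpha,\beta)=(1,0)$: $\sum_k|d_k|^s<\infty$ for some $s\in(0,\alpha)\cap[0,1]$; - if $\alpha=1$ and $\beta\neq0$: $\sum_k|d_k|<\infty$ and $\sum_k|d_k|\,\big|\ln|d_k|\big|<\infty$ (with $0\ln 0=0$). Then $X_t=\sum_{k\in\mathbb Z}d_k\varepsilon_{t+k}$ converges almost surely for every $t$. For $m\ge0$, $h\ge1$ put $\boldsymbol X_t=(X_{t-m},\dots,X_t,X_{t+1},\dots,X_{t+h})$ and $\boldsymbol d_k=(d_{k+m},\dots,d_k,d_{k-1},\dots,d_{k-h})$,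 let $\|\cdot\|_e$ be the Euclidean norm, and call a seminorm $\|\cdot\|$ on $\mathbb R^{m+h+1}$ *admissible* if $\|(x_{-m},\dots,x_h)\|=0\iff x_{-m}=\dots=x_0=0$. **Representability.** Let $\|\cdot\|$ be a seminorm on $\mathbb R^d$ and $C=\{\boldsymbol s:\|\boldsymbol s\|=1\}$. A non-symmetric random vector $\boldsymbol X$ has the spectral representation $(\Gamma,\boldsymbol\mu)$ on $C$ if $\Gamma$ is a Borel measure on $C$ and $\boldsymbol\mu\in\mathbb R^d$, where for all $\boldsymbol u$ the function $|\langle\boldsymbol u,\boldsymbol s\rangle|^\alpha$ (if $\alpha\neq1$), resp. $|\langle\boldsymbol u,\boldsymbol s\rangle|\,\big|\ln|\langle\boldsymbol u,\boldsymbol s\rangle|\big|$ (if $\alpha=1$), is $\Gamma$-integrable, and $$\mathbb E[e^{i\langle \boldsymbol u,\boldsymbol X\rangle}]=\exp\Big\{-\int_C|\langle\boldsymbol u,\boldsymbol s\rangle|^\alpha\big(1-i\,\mathrm{sign}(\langle\boldsymbol u,\boldsymbol s\rangle)w(\alpha,\langle\boldsymbol u,\boldsymbol s\rangle)\big)\Gamma(d\boldsymbol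 s)+i\langle\boldsymbol u,\boldsymbol\mu\rangle\Big\}\quad\text{for all }\boldsymbol u.$$ For $\boldsymbol X$ symmetric ($\boldsymbol X\overset d=-\boldsymbol X$) it is required instead that $\Gamma$ is a symmetric Borel measure on $C$, $|\langle\boldsymbol u,\boldsymbol s\rangle|^\alpha$ is $\Gamma$-integrable and $\mathbb E[e^{i\langle \boldsymbol u,\boldsymbol X\rangle}]=\exp\{-\int_C|\langle\boldsymbol u,\boldsymbol s\rangle|^\alpha\Gamma(d\boldsymbol s)\}$ for all $\boldsymbol u$, and $\boldsymbol\mu=\boldsymbol 0$. $\boldsymbol X$ is *representable on $C$* if it has such a representation. The process $(X_t)$ is *$(m,h)$-past-representable* if $\boldsymbol X_t$ is representable on the unit cylinder of some admissible seminorm on $\mathbb R^{m+h+1}$; it is *past-representable* if this holds for some $m\ge0$, $h\ge1$. **Proposition.** Let $m_0\in\{0,1,2,\dots\}\cup\{+\infty\}$ be the supremum of $\{m\ge1:\exists k\in\mathbb Z,\ d_{k+m}=\dots=d_{k+1}=0,\ d_k\neq0\}$, and $m_0=0$ if this set is empty. (i)(a) If $\alpha\neq1$ or $(\alpha,\beta)=(1,0)$,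 then $(X_t)$ is past-representable if and only if $m_0<+\infty$; and for $m\ge0$, $h\ge1$ it is $(m,h)$-past-representable if and only if $m_0<+\infty$ and $m\ge m_0$. (i)(b) If $\alpha=1$ and $\beta\ne0$, fix for each $(m,h)$ an admissible seminorm $\|\cdot\|$ on $\mathbb R^{m+h+1}$ (the statement holds for every choice). Then $(X_t)$ is past-representable if and only if $m_0<+\infty$ and there are $m\ge m_0$, $h\ge1$ such that $$\sum_{k\in\mathbb Z}\|\boldsymbol d_k\|_e\,\Big|\ln\big(\|\boldsymbol d_k\|/\|\boldsymbol d_k\|_e\big)\Big|<+\infty\qquad\text{or}\qquad \boldsymbol X_t\text{ is symmetric}$$ (terms with $\boldsymbol d_k=\boldsymbol 0$ vanish). More precisely, for $m\ge0$, $h\ge1$, $(X_t)$ is $(m,h)$-past-representable if and only if $m\ge m_0$ and one of these two conditions holds for $(m,h)$. (ii) Let $m\ge0$, $h\ge1$, let $(X_t)$ be $(m,h)$-past-representable and let $\|\cdot\|$ be any admissible seminorm on $\mathbb R^{m+h+1}$. Then $\boldsymbol X_t$ has exactly one spectral representation $(\Gamma^{\|\cdot\|},\boldsymbol\mu^{\|\cdot\|})$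 on the unit cylinder of $\|\cdot\|$, namely $$\Gamma^{\|\cdot\|}=\sigma^\alpha\sum_{\vartheta\in\{-1,1\}}\sum_{k\in\mathbb Z}\frac{1+\vartheta\beta}2\,\|\boldsymbol d_k\|^\alpha\,\delta_{\vartheta\boldsymbol d_k/\|\boldsymbol d_k\|},\qquad \boldsymbol\mu^{\|\cdot\|}=-\mathbf 1_{\{\alpha=1\}}\frac2\pi\beta\sigma\sum_{k\in\mathbb Z}\boldsymbol d_k\ln\|\boldsymbol d_k\|,$$ where terms with $\boldsymbol d_k=\boldsymbol0$ vanish. If $\alpha=1$, $\beta\ne0$ and $\boldsymbol X_t$ is not symmetric, the last series converges absolutely; if $\boldsymbol X_t$ is symmetric, then $\boldsymbol\mu^{\|\cdot\|}=\boldsymbol0$ (whether or not that series converges, and its sum is $\boldsymbol 0$ when it converges absolutely). -/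

import Mathlib

open MeasureTheory ProbabilityTheory

noncomputable section

/-- The function `w(α, s)`: `tan (π α / 2)` if `α ≠ 1`, and `-(2/π) ln |s|` if `α = 1`. -/
def stableW (α s : ℝ) : ℝ :=
  if α = 1 then -(2 / Real.pi) * Real.log |s| else Real.tan (Real.pi * α / 2)

/-- The kernel `|x|^α (1 - i sign(x) w(α, x))` of stable characteristic exponents. -/
def stableKernel (α x : ℝ) : ℂ :=
  ((|x| ^ α : ℝ) : ℂ) * (1 - Complex.I * ((Real.sign x * stableW α x : ℝ) : ℂ))

/-- `ν` is the univariate stable law `S(α, β, σ, μ)`: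
`E[exp(iuX)] = exp(-σ^α |u|^α (1 - iβ sign(u) w(α,u)) + iuμ)`. -/
def IsStableLaw (α β σ μ : ℝ) (ν : Measure ℝ) : Prop :=
  ∀ u : ℝ, charFun ν u =
    Complex.exp (-((σ ^ α * |u| ^ α : ℝ) : ℂ) *
        (1 - Complex.I * ((β * Real.sign u * stableW α u : ℝ) : ℂ)) +
      Complex.I * ((u * μ : ℝ) : ℂ))

/-- A measure on a Euclidean space is symmetric if it is invariant under `x ↦ -x`. -/
def IsSymmMeasure {d : ℕ} (ν : Measure (EuclideanSpace ℝ (Fin d))) : Prop :=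
  ν.map (fun x => -x) = ν

/-- The pair `(Γ, μ)` is a spectral representation, on the unit cylinder `{s | p s = 1}` of the
seminorm `p`, of a random vector with law `ν`. If `ν` is symmetric, the measure `Γ` is required to
be symmetric and there is no shift vector, which is encoded as `μ = 0`. -/
def IsSpectralRepr {d : ℕ} (α : ℝ) (ν : Measure (EuclideanSpace ℝ (Fin d)))
    (p : Seminorm ℝ (EuclideanSpace ℝ (Fin d)))
    (Γ : Measure (EuclideanSpace ℝ (Fin d))) (μ : EuclideanSpace ℝ (Fin d)) : Prop :=
  -- `Γ` is a Borel measure carried by the unit cylinder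
  Γ {s | p s ≠ 1} = 0 ∧
  -- asymmetric case
  (¬ IsSymmMeasure ν →
    (∀ u, (α ≠ 1 → Integrable (fun s => |inner ℝ u s| ^ α) Γ) ∧
      (α = 1 → Integrable (fun s => |inner ℝ u s| * |Real.log (|inner ℝ u s|)|) Γ)) ∧
    (∀ u, charFun ν u =
      Complex.exp (-(∫ s, stableKernel α (inner ℝ u s) ∂Γ) +
        Complex.I * ((inner ℝ u μ : ℝ) : ℂ)))) ∧
  -- symmetric case
  (IsSymmMeasure ν →
    IsSymmMeasure Γ ∧ μ = 0 ∧
    (∀ u, Integrable (fun s => |inner ℝ u s| ^ α) Γ) ∧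
    (∀ u, charFun ν u =
      Complex.exp (-((∫ s, |inner ℝ u s| ^ α ∂Γ : ℝ) : ℂ))))

/-- The law `ν` is representable on the unit cylinder of the seminorm `p`. -/
def IsRepresentable {d : ℕ} (α : ℝ) (ν : Measure (EuclideanSpace ℝ (Fin d)))
    (p : Seminorm ℝ (EuclideanSpace ℝ (Fin d))) : Prop :=
  ∃ Γ μ, IsSpectralRepr α ν p Γ μ

/-- The seminorms on `ℝ^{m+h+1}`, with coordinates `(x_{-m}, …, x_0, x_1, …, x_h)`, that vanish
exactly where the first `m+1` coordinates `x_{-m}, …, x_0` vanish. The coordinate `x_{i-m}` has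
index `i`. -/
def IsPastSeminorm (m h : ℕ) (p : Seminorm ℝ (EuclideanSpace ℝ (Fin (m + h + 1)))) : Prop :=
  ∀ x, p x = 0 ↔ ∀ i : Fin (m + h + 1), (i : ℕ) ≤ m → x i = 0

/-- The path `(X_{t-m}, …, X_t, X_{t+1}, …, X_{t+h})` of a process. -/
def pathVec {Ω : Type*} (X : ℤ → Ω → ℝ) (t : ℤ) (m h : ℕ) (ω : Ω) :
    EuclideanSpace ℝ (Fin (m + h + 1)) :=
  WithLp.toLp 2 fun i => X (t - (m : ℤ) + ((i : ℕ) : ℤ)) ω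

/-- The law of the path `(X_{t-m}, …, X_t, X_{t+1}, …, X_{t+h})`. -/
def pathLaw {Ω : Type*} [MeasurableSpace Ω] (P : Measure Ω) (X : ℤ → Ω → ℝ) (t : ℤ) (m h : ℕ) :
    Measure (EuclideanSpace ℝ (Fin (m + h + 1))) :=
  P.map (pathVec X t m h)

/-- `(m,h)`-past-representability of a (stationary) `α`-stable process. -/
def IsPastRepresentableAt {Ω : Type*} [MeasurableSpace Ω] (α : ℝ) (P : Measure Ω)
    (X : ℤ → Ω → ℝ) (m h : ℕ) : Prop :=
  ∃ p : Seminorm ℝ (EuclideanSpace ℝ (Fin (m + h + 1))),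
    IsPastSeminorm m h p ∧ ∀ t : ℤ, IsRepresentable α (pathLaw P X t m h) p

/-- Past-representability: `(m,h)`-past-representability for some `m ≥ 0`, `h ≥ 1`. -/
def IsPastRepresentable {Ω : Type*} [MeasurableSpace Ω] (α : ℝ) (P : Measure Ω)
    (X : ℤ → Ω → ℝ) : Prop :=
  ∃ m h : ℕ, 1 ≤ h ∧ IsPastRepresentableAt α P X m h

/-- The paths of length `m+h+1` of the process have a symmetric law. -/
def HasSymmPaths {Ω : Type*} [MeasurableSpace Ω] (P : Measure Ω)
    (X : ℤ → Ω → ℝ) (m h : ℕ) : Prop :=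
  ∀ t : ℤ, IsSymmMeasure (pathLaw P X t m h)

/-- The moving average `X_t = ∑_{k ∈ ℤ} d_k ε_{t+k}`. -/
def movingAverage {Ω : Type*} (d : ℤ → ℝ) (ε : ℤ → Ω → ℝ) (t : ℤ) (ω : Ω) : ℝ :=
  ∑' k : ℤ, d k * ε (t + k) ω

/-- The vector `(d_{k+m}, …, d_k, d_{k-1}, …, d_{k-h})`. -/
def coefVec (d : ℤ → ℝ) (m h : ℕ) (k : ℤ) : EuclideanSpace ℝ (Fin (m + h + 1)) :=
  WithLp.toLp 2 fun i => d (k + (m : ℤ) - ((i : ℕ) : ℤ))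

/-- The supremum (`0` for the empty set) of the `m ≥ 1` for which some nonzero `d_k` is followed by
`d_{k+1} = … = d_{k+m} = 0`. -/
def maxGap (d : ℤ → ℝ) : ℕ∞ :=
  ⨆ m ∈ {m : ℕ | 1 ≤ m ∧ ∃ k : ℤ, (∀ j : ℕ, 1 ≤ j → j ≤ m → d (k + (j : ℤ)) = 0) ∧ d k ≠ 0},
    (m : ℕ∞)

/-- The condition `∑_k ‖d_k‖_e |ln (p(d_k) / ‖d_k‖_e)| < ∞` on the coefficient vectors. It is only
used when `p(d_k) = 0` implies `d_k = 0`; the terms with `d_k = 0` vanish. -/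
def LogSummable (d : ℤ → ℝ) (m h : ℕ)
    (p : Seminorm ℝ (EuclideanSpace ℝ (Fin (m + h + 1)))) : Prop :=
  Summable fun k : ℤ =>
    ‖coefVec d m h k‖ * |Real.log (p (coefVec d m h k) / ‖coefVec d m h k‖)|

/-- The measure `σ^α ∑_{ϑ = ±1} ∑_k w_ϑ p(d_k)^α δ_{ϑ d_k / p(d_k)}`, `w_ϑ = (1 + ϑβ)/2`. The terms
with `d_k = 0` vanish. -/
def maSpectralMeasure (α β σ : ℝ) (d : ℤ → ℝ) (m h : ℕ)
    (p : Seminorm ℝ (EuclideanSpace ℝ (Fin (m + h + 1)))) :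
    Measure (EuclideanSpace ℝ (Fin (m + h + 1))) :=
  Measure.sum fun k : ℤ =>
    ENNReal.ofReal (σ ^ α * ((1 + β) / 2) * p (coefVec d m h k) ^ α) •
        Measure.dirac ((p (coefVec d m h k))⁻¹ • coefVec d m h k) +
    ENNReal.ofReal (σ ^ α * ((1 - β) / 2) * p (coefVec d m h k) ^ α) •
        Measure.dirac (-((p (coefVec d m h k))⁻¹ • coefVec d m h k))

/-- The vectors `ln(p(d_k)) d_k`, which are the terms of the shift vector for `α = 1`. -/
def maShiftTerm (d : ℤ → ℝ) (m h : ℕ)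
    (p : Seminorm ℝ (EuclideanSpace ℝ (Fin (m + h + 1)))) (k : ℤ) :
    EuclideanSpace ℝ (Fin (m + h + 1)) :=
  Real.log (p (coefVec d m h k)) • coefVec d m h k

/-- The vector `-1_{α = 1} (2/π) β σ ∑_k d_k ln p(d_k)`. -/
def maShift (α β σ : ℝ) (d : ℤ → ℝ) (m h : ℕ)
    (p : Seminorm ℝ (EuclideanSpace ℝ (Fin (m + h + 1)))) :
    EuclideanSpace ℝ (Fin (m + h + 1)) :=
  if α = 1 then (-(2 / Real.pi * β * σ)) • ∑' k : ℤ, maShiftTerm d m h p k else 0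

end

open MeasureTheory ProbabilityTheory

noncomputable section

/-! By independence and almost sure convergence, the path has characteristic function exp(-∫ K(⟨u,
s⟩) M(ds)), where K is the stable kernel and M = `coefMeasure` puts the masses σ^α (1 ± β)/2 at the
vectors ± d_k (`charFun_pathLaw`). M lives on no particular cylinder, but K is homogeneous of degree
α up to a logarithmic defect at α = 1, so s may be replaced by s/p(s) at the price of a weight
p(s)^α. This is `cylinderMeasure`; nothing is lost as long as p vanishes at no nonzero atom. For α =
1 the kernel contains x ln|x|, and rescaling leaves a linear term, the shift -(2/π) ∫ ln p(s) s
M(ds), which requires ‖s‖ |ln p(s)| to be integrable (`exponent_cylinderMeasure`). A nonzero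
coefficient vector with zero past exists exactly when some nonzero coefficient is followed by more
than m zeros (`forall_coefVec_iff`).

Conversely, any representation Γ on a cylinder can be projected to the Euclidean sphere, where
spectral measures are unique (`spectralMeasure_unique`). Hence Γ and M have the same spherical
image. Since Γ is carried by {p = 1}, this image does not charge {p = 0}, and projecting back to the
cylinder recovers Γ from M (`HasStableExponent.eq_cylinderMeasure`). For α = 1 and a non-symmetric
law, the integrability required of Γ gives back the logarithmic condition. For a symmetric law only
|⟨u, s⟩|^α matters, no logarithm appears, and the condition is void.

Uniqueness on the sphere is proved by Gaussian smoothing. For a standard Gaussian U and a unit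
vector s, ⟨U, s⟩ is standard normal whatever s is, so averaging ∫ g(⟨a + U, s⟩) Γ(ds) gives ∫ G(⟨a,
s⟩) Γ(ds) with a single entire function G. Replacing a by xa and comparing powers of x determines ∫
⟨a, s⟩^n Γ(ds) wherever the n-th Taylor coefficient of G is nonzero
(`IsHomogeneousLike.moments_eq`). Euler's relation z g' = α g + κ z becomes G'' + x G' = α G + κ x,
a two-step recurrence that shows which coefficients survive: all of them for (x⁺)^α with α ≠ 1, the
even ones when α = 1, and the odd ones from degree three on for x ln|x|. The first moments then
follow from the third ones because ‖s‖ = 1.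

Almost sure convergence of the series rests on the tail bound P(|ε| > r) = O(r^{-α}), read off from
the characteristic function near 0. -/

/-! ### Gaussian smoothing of homogeneous functions -/

/-- Continuous functions of subquadratic growth, smooth off the origin, for which
`z g'(z) = α g(z) + κ z`. -/
structure IsHomogeneousLike (α κ : ℝ) (g : ℝ → ℝ) : Prop where
  continuous : Continuous g
  map_zero : g 0 = 0
  bound : ∃ C, ∀ z, |g z| ≤ C * (1 + z ^ 2)
  deriv : ∀ z, z ≠ 0 → ∃ g', HasDerivAt g g' z ∧ z * g' = α * g z + κ * z

lemma one_add_sq_le_exp_abs (z : ℝ) : 1 + z ^ 2 ≤ 2 * Real.exp |z| := by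
  have h := Real.quadratic_le_exp_of_nonneg (abs_nonneg z)
  have := abs_nonneg z
  rw [← sq_abs]; nlinarith

lemma integrable_exp_mul_abs_gaussian (t : ℝ) :
    Integrable (fun z : ℝ => Real.exp (t * |z|)) (gaussianReal 0 1) :=
  integrable_exp_mul_abs (X := fun z : ℝ => z) (integrable_exp_mul_gaussianReal t)
    (integrable_exp_mul_gaussianReal (-t))

section Moments

variable {g : ℝ → ℝ} {C : ℝ}

lemma abs_mul_exp_le (hb : ∀ z, |g z| ≤ C * (1 + z ^ 2)) (x z : ℝ) :
    |g z| * Real.exp (|x * z|) ≤ 2 * |C| * Real.exp ((1 + |x|) * |z|) := by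
  have h1 := (hb z).trans (mul_le_mul_of_nonneg_right (le_abs_self C) (by positivity))
  have h2 := one_add_sq_le_exp_abs z
  have h3 : |g z| ≤ 2 * |C| * Real.exp |z| := by nlinarith [abs_nonneg C]
  rw [add_mul, one_mul, Real.exp_add, ← abs_mul, ← mul_assoc]
  gcongr

lemma integrable_mul_exp_abs (hg : Continuous g) (hb : ∀ z, |g z| ≤ C * (1 + z ^ 2)) (x : ℝ) :
    Integrable (fun z => |g z| * Real.exp (|x * z|)) (gaussianReal 0 1) := by
  refine ((integrable_exp_mul_abs_gaussian (1 + |x|)).const_mul (2 * |C|)).mono'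
    (by fun_prop) (ae_of_all _ fun z => ?_)
  rw [Real.norm_of_nonneg (by positivity)]
  exact abs_mul_exp_le hb x z

/-- The density of N(x, 1) relative to N(0, 1) is exp(xz - x²/2). This separates the smoothing into
an explicit factor and a moment generating function. -/
lemma integral_shift_gaussian (g : ℝ → ℝ) (hg : Continuous g) (x : ℝ) :
    ∫ z, g (x + z) ∂(gaussianReal 0 1) =
      Real.exp (-x ^ 2 / 2) * ∫ z, g z * Real.exp (x * z) ∂(gaussianReal 0 1) := by
  have h1 : ∫ z, g (x + z) ∂(gaussianReal 0 1) = ∫ z, g z ∂(gaussianReal x 1) := by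
    have := gaussianReal_map_const_add (μ := 0) (v := 1) x
    rw [zero_add] at this
    rw [← this, integral_map (by fun_prop) hg.aestronglyMeasurable]
  rw [h1, integral_gaussianReal_eq_integral_smul one_ne_zero,
    integral_gaussianReal_eq_integral_smul one_ne_zero, ← integral_const_mul]
  refine integral_congr_ae (ae_of_all _ fun z => ?_)
  simp only [gaussianPDFReal, smul_eq_mul, NNReal.coe_one]
  have : Real.exp (-(z - x) ^ 2 / (2 * 1)) =
      Real.exp (-x ^ 2 / 2) * (Real.exp (-(z - 0) ^ 2 / (2 * 1)) * Real.exp (x * z)) := by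
    rw [← Real.exp_add, ← Real.exp_add]; congr 1; ring
  rw [this]; ring

lemma integrable_pow_mul (hg : Continuous g) (hb : ∀ z, |g z| ≤ C * (1 + z ^ 2)) (n : ℕ) :
    Integrable (fun z => z ^ n * g z) (gaussianReal 0 1) := by
  refine ((integrable_mul_exp_abs hg hb 1).const_mul (n.factorial : ℝ)).mono'
    (by fun_prop) (ae_of_all _ fun z => ?_)
  have := Real.pow_div_factorial_le_exp |z| (abs_nonneg z) n
  rw [div_le_iff₀ (by positivity)] at this
  rw [norm_mul, norm_pow, Real.norm_eq_abs, Real.norm_eq_abs, one_mul]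
  nlinarith [abs_nonneg (g z)]

/-- Termwise integration of the exponential series; the partial sums of the absolute values are
dominated by |g(z)| exp|xz|, which is integrable because g grows at most quadratically. -/
lemma hasSum_gaussian_exp (hg : Continuous g) (hb : ∀ z, |g z| ≤ C * (1 + z ^ 2)) (x : ℝ) :
    HasSum (fun n : ℕ => (∫ z, z ^ n * g z ∂(gaussianReal 0 1)) / n.factorial * x ^ n)
      (∫ z, g z * Real.exp (x * z) ∂(gaussianReal 0 1)) := by
  set F : ℕ → ℝ → ℝ := fun n z => g z * ((x * z) ^ n / n.factorial) with hF
  have hint : ∀ n, Integrable (F n) (gaussianReal 0 1) := fun n => by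
    refine ((integrable_pow_mul hg hb n).const_mul (x ^ n / n.factorial)).congr
      (ae_of_all _ fun z => ?_)
    simp only [hF, mul_pow]; ring
  have hs : ∀ z, HasSum (fun n => ‖F n z‖) (|g z| * Real.exp (|x * z|)) := fun z => by
    have := (NormedSpace.expSeries_div_hasSum_exp (𝔸 := ℝ) |x * z|).mul_left |g z|
    rw [← Real.exp_eq_exp_ℝ] at this
    convert! this using 2 with n
    simp [hF, abs_mul]
  have key := hasSum_integral_of_summable_integral_norm hint (by
    refine summable_of_sum_range_le (c := ∫ z, |g z| * Real.exp (|x * z|) ∂(gaussianReal 0 1))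
      (fun n => integral_nonneg fun z => norm_nonneg _) fun n => ?_
    rw [← integral_finsetSum _ fun i _ => (hint i).norm]
    exact integral_mono (integrable_finsetSum _ fun i _ => (hint i).norm)
      (integrable_mul_exp_abs hg hb x) fun z =>
        sum_le_hasSum _ (fun i _ => norm_nonneg _) (hs z))
  convert! key using 1
  · ext n
    simp only [hF]
    rw [← integral_div, ← integral_mul_const]
    refine integral_congr_ae (ae_of_all _ fun z => ?_)
    simp only [mul_pow]; ring
  · refine integral_congr_ae (ae_of_all _ fun z => ?_)
    have := (NormedSpace.expSeries_div_hasSum_exp (𝔸 := ℝ) (x * z)).mul_left (g z)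
    rw [← Real.exp_eq_exp_ℝ] at this
    exact this.tsum_eq.symm

end Moments

/-- The power series of `exp (-x ^ 2 / 2)`. -/
def gaussSeries : PowerSeries ℝ :=
  PowerSeries.mk fun n => if Even n then (-1 / 2 : ℝ) ^ (n / 2) / (n / 2).factorial else 0

lemma hasSum_gaussSeries (x : ℝ) :
    HasSum (fun n => PowerSeries.coeff n gaussSeries * x ^ n) (Real.exp (-x ^ 2 / 2)) := by
  rw [← add_zero (Real.exp _)]
  refine HasSum.even_add_odd ?_ ?_
  · have := NormedSpace.expSeries_div_hasSum_exp (𝔸 := ℝ) (-x ^ 2 / 2)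
    rw [← Real.exp_eq_exp_ℝ] at this
    convert! this using 2 with n
    simp only [gaussSeries, PowerSeries.coeff_mk, even_two_mul, if_true,
      Nat.mul_div_cancel_left n two_pos]
    rw [show -x ^ 2 / 2 = (-1 / 2) * x ^ 2 by ring, mul_pow, ← pow_mul]; ring
  · convert! hasSum_zero using 2 with n
    simp [gaussSeries]

lemma derivative_gaussSeries :
    PowerSeries.derivative ℝ gaussSeries = -(PowerSeries.X * gaussSeries) := by
  ext n
  rw [PowerSeries.coeff_derivative, map_neg]
  cases n with
  | zero => simp [gaussSeries]
  | succ n =>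
    rw [PowerSeries.coeff_succ_X_mul]
    simp only [gaussSeries, PowerSeries.coeff_mk]
    by_cases h : Even n
    · obtain ⟨k, rfl⟩ := h
      have h1 : (k + k + 1 + 1) / 2 = k + 1 := by omega
      have h2 : (k + k) / 2 = k := by omega
      have h3 : Even (k + k + 1 + 1) := ⟨k + 1, by ring⟩
      rw [if_pos h3, if_pos ⟨k, rfl⟩, h1, h2, Nat.factorial_succ]
      push_cast
      have : (k.factorial : ℝ) ≠ 0 := by positivity
      have : (k : ℝ) + 1 ≠ 0 := by positivity
      field_simp
      ring
    · rw [if_neg (by rw [Nat.even_add_one, Nat.even_add_one]; simpa using h), if_neg h]; simp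

/-- The exponential generating series of the Gaussian moments `∫ zⁿ g(z)`. -/
def momentSeries (g : ℝ → ℝ) : PowerSeries ℝ :=
  PowerSeries.mk fun n => (∫ z, z ^ n * g z ∂(gaussianReal 0 1)) / n.factorial

/-- The power series of the Gaussian smoothing `x ↦ ∫ g(x + z)` of `g`. -/
def smoothSeries (g : ℝ → ℝ) : PowerSeries ℝ := gaussSeries * momentSeries g

/-- Cauchy product of the two absolutely convergent series from `integral_shift_gaussian`; the
smoothing is thus entire. -/
lemma hasSum_smoothSeries {g : ℝ → ℝ} {C : ℝ} (hg : Continuous g)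
    (hb : ∀ z, |g z| ≤ C * (1 + z ^ 2)) (x : ℝ) :
    HasSum (fun n => PowerSeries.coeff n (smoothSeries g) * x ^ n)
      (∫ z, g (x + z) ∂(gaussianReal 0 1)) := by
  have h1 := hasSum_gaussSeries x
  have h2 := hasSum_gaussian_exp hg hb x
  have e : ∀ n, PowerSeries.coeff n (smoothSeries g) * x ^ n =
      ∑ kl ∈ Finset.HasAntidiagonal.antidiagonal n, (PowerSeries.coeff kl.1 gaussSeries * x ^ kl.1) *
        ((∫ z, z ^ kl.2 * g z ∂(gaussianReal 0 1)) / kl.2.factorial * x ^ kl.2) := fun n => by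
    rw [smoothSeries, PowerSeries.coeff_mul, Finset.sum_mul]
    refine Finset.sum_congr rfl fun kl hkl => ?_
    rw [Finset.HasAntidiagonal.mem_antidiagonal] at hkl
    rw [momentSeries, PowerSeries.coeff_mk, ← hkl, pow_add]; ring
  have hs := (summable_norm_sum_mul_antidiagonal_of_summable_norm h1.summable.norm
    h2.summable.norm).of_norm
  rw [integral_shift_gaussian g hg, ← h1.tsum_eq, ← h2.tsum_eq,
    tsum_mul_tsum_eq_tsum_sum_antidiagonal_of_summable_norm h1.summable.norm h2.summable.norm]
  simp_rw [e]
  exact hs.hasSum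

lemma coeff_eq_zero_of_hasSum_zero {b : ℕ → ℝ} (h : ∀ x : ℝ, HasSum (fun n => b n * x ^ n) 0)
    (n : ℕ) : b n = 0 := by
  have hp : HasFPowerSeriesAt (0 : ℝ → ℝ) (FormalMultilinearSeries.ofScalars ℝ b) 0 := by
    rw [hasFPowerSeriesAt_iff]
    refine Filter.Eventually.of_forall fun z => ?_
    simpa [FormalMultilinearSeries.coeff_ofScalars, mul_comm] using h z
  have := hp.eq_zero
  rw [← FormalMultilinearSeries.coeff_ofScalars (𝕜 := ℝ) (p := b), this]; rfl

lemma coeff_unique {b c : ℕ → ℝ} {f : ℝ → ℝ} (hb : ∀ x : ℝ, HasSum (fun n => b n * x ^ n) (f x))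
    (hc : ∀ x : ℝ, HasSum (fun n => c n * x ^ n) (f x)) (n : ℕ) : b n = c n := by
  refine sub_eq_zero.1 (coeff_eq_zero_of_hasSum_zero (b := fun n => b n - c n) (fun x => ?_) n)
  simpa [sub_mul] using (hb x).sub (hc x)

/-- The Gaussian is centred, so smoothing fixes the identity. This identifies the inhomogeneous term
κ z after smoothing. -/
lemma smoothSeries_id : smoothSeries (fun z => z) = PowerSeries.X := by
  ext n
  have hb : ∀ z : ℝ, |z| ≤ 1 * (1 + z ^ 2) := fun z => by
    rw [← sq_abs]; nlinarith [sq_nonneg (|z| - 1), abs_nonneg z]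
  refine coeff_unique (f := fun x => x) (b := fun n => PowerSeries.coeff n (smoothSeries _))
    (c := fun n => PowerSeries.coeff n PowerSeries.X) (fun x => ?_) (fun x => ?_) n
  · convert hasSum_smoothSeries continuous_id' hb x using 1
    have h : Integrable (fun z : ℝ => z) (gaussianReal 0 1) :=
      (memLp_id_gaussianReal (μ := 0) (v := 1) 1).integrable (by simp)
    rw [integral_add (integrable_const _) h, integral_id_gaussianReal]
    simp
  · convert hasSum_single (f := fun n => PowerSeries.coeff n PowerSeries.X * x ^ n) 1
      (fun n hn => ?_) using 1
    · simp
    · simp [PowerSeries.coeff_X, hn]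

/-! ### The recurrence for the coefficients -/

namespace IsHomogeneousLike

variable {α κ : ℝ} {g : ℝ → ℝ}

/-- The factor z removes the possible singularity of g' at the origin: there the difference quotient
of z g(z) is g(t), which tends to g(0) = 0. Integration by parts can then run over the whole line.
-/
lemma hasDerivAt_mul_self (h : IsHomogeneousLike α κ g) (z : ℝ) :
    HasDerivAt (fun z => z * g z) ((1 + α) * g z + κ * z) z := by
  by_cases hz : z = 0
  · subst hz
    rw [h.map_zero, mul_zero, mul_zero, zero_add, hasDerivAt_iff_tendsto_slope_zero]
    have h1 : Filter.Tendsto g (nhdsWithin 0 {0}ᶜ) (nhds 0) := by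
      have := h.continuous.tendsto 0
      rw [h.map_zero] at this
      exact this.mono_left nhdsWithin_le_nhds
    refine h1.congr' ?_
    filter_upwards [self_mem_nhdsWithin] with t ht
    have ht : t ≠ 0 := ht
    simp [ht]
  · obtain ⟨g', hg', he⟩ := h.deriv z hz
    convert! (hasDerivAt_id z).mul hg' using 1
    simp only [id, one_mul, he]; ring

/-- Gaussian integration by parts: the derivative of φ(z) z^n · z g(z) has integral zero, and φ' =
-zφ produces the moment of order n + 2. -/
lemma moment_recurrence (h : IsHomogeneousLike α κ g) (n : ℕ) :
    ∫ z, z ^ (n + 2) * g z ∂(gaussianReal 0 1) =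
      (n + 1 + α) * ∫ z, z ^ n * g z ∂(gaussianReal 0 1) +
        κ * ∫ z, z ^ n * z ∂(gaussianReal 0 1) := by
  obtain ⟨C, hb⟩ := h.bound
  have hid : ∀ z : ℝ, |z| ≤ 1 * (1 + z ^ 2) := fun z => by
    rw [← sq_abs]; nlinarith [sq_nonneg (|z| - 1), abs_nonneg z]
  set φ : ℝ → ℝ := gaussianPDFReal 0 1 with hφ
  have hφ' : ∀ z, HasDerivAt φ (-z * φ z) z := fun z => by
    have : HasDerivAt (fun z : ℝ => -(z - 0) ^ 2 / (2 * ((1 : NNReal) : ℝ))) (-z) z := by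
      have := ((((hasDerivAt_id z).sub_const 0).pow 2).neg).div_const (2 * ((1 : NNReal) : ℝ))
      convert! this using 1
      simp; ring
    have h2 := (this.exp).const_mul (√(2 * Real.pi * ((1 : NNReal) : ℝ)))⁻¹
    convert! h2 using 1
    simp only [hφ, gaussianPDFReal]; ring
  have e : ∀ f : ℝ → ℝ, ∫ z, f z ∂(gaussianReal 0 1) = ∫ z, φ z * f z := fun f => by
    rw [integral_gaussianReal_eq_integral_smul one_ne_zero]; rfl
  have i : ∀ f : ℝ → ℝ, Integrable f (gaussianReal 0 1) → Integrable (fun z => φ z * f z) :=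
    fun f hf => by
      rw [gaussianReal_of_var_ne_zero _ one_ne_zero] at hf
      have := (integrable_withDensity_iff_integrable_smul' (measurable_gaussianPDF 0 1)
        (ae_of_all _ fun x => gaussianPDF_lt_top)).1 hf
      refine this.congr (ae_of_all _ fun z => ?_)
      simp [hφ, toReal_gaussianPDF]
  have i1 := i _ (integrable_pow_mul h.continuous hb n)
  have i2 := i _ (integrable_pow_mul h.continuous hb (n + 2))
  have i3 := i _ (integrable_pow_mul (g := fun z => z) continuous_id' hid n)
  have i4 := i _ (integrable_pow_mul h.continuous hb (n + 1))
  have hF : ∀ z, HasDerivAt (fun z => φ z * (z ^ (n + 1) * g z))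
      ((n + 1 + α) * (φ z * (z ^ n * g z)) + κ * (φ z * (z ^ n * z)) -
        φ z * (z ^ (n + 2) * g z)) z := fun z => by
    have h1 := (hφ' z).mul ((hasDerivAt_pow n z).mul (h.hasDerivAt_mul_self z))
    convert! h1 using 1
    · ext y; simp only [Pi.mul_apply]; ring
    · simp only [Pi.mul_apply]
      cases n with
      | zero => simp; ring
      | succ n => simp [pow_succ]; ring
  have i5 : Integrable fun z => (n + 1 + α) * (φ z * (z ^ n * g z)) + κ * (φ z * (z ^ n * z)) :=
    (i1.const_mul _).add (i3.const_mul _)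
  have := integral_eq_zero_of_hasDerivAt_of_integrable hF (i5.sub i2) i4
  rw [integral_sub i5 i2,
    integral_add (i1.const_mul _) (i3.const_mul _), integral_const_mul, integral_const_mul] at this
  rw [e, e, e]; linarith

lemma derivative_momentSeries (h : IsHomogeneousLike α κ g) :
    PowerSeries.derivative ℝ (PowerSeries.derivative ℝ (momentSeries g)) =
      PowerSeries.X * PowerSeries.derivative ℝ (momentSeries g) +
        (1 + α) • momentSeries g + κ • momentSeries (fun z => z) := by
  ext n
  have key := h.moment_recurrence n
  have hf : (n.factorial : ℝ) ≠ 0 := by positivity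
  have hf2 : (n : ℝ) + 1 ≠ 0 := by positivity
  have hf3 : (n : ℝ) + 1 + 1 ≠ 0 := by positivity
  have hX : PowerSeries.coeff n (PowerSeries.X * PowerSeries.derivative ℝ (momentSeries g)) =
      n * PowerSeries.coeff n (momentSeries g) := by
    cases n with
    | zero => simp
    | succ n => rw [PowerSeries.coeff_succ_X_mul, PowerSeries.coeff_derivative]; push_cast; ring
  rw [PowerSeries.coeff_derivative, PowerSeries.coeff_derivative, map_add, map_add, hX,
    PowerSeries.coeff_smul, PowerSeries.coeff_smul]
  simp only [momentSeries, PowerSeries.coeff_mk, smul_eq_mul]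
  rw [key, Nat.factorial_succ, Nat.factorial_succ]
  push_cast
  field_simp
  ring

/-- The smoothed form of Euler's relation: by Stein's identity the smoothing of z g'(z) is x G' +
G''. Here it is read off from the product rule for the two factors of `smoothSeries`. -/
lemma smoothSeries_ode (h : IsHomogeneousLike α κ g) :
    PowerSeries.derivative ℝ (PowerSeries.derivative ℝ (smoothSeries g)) +
      PowerSeries.X * PowerSeries.derivative ℝ (smoothSeries g) =
        α • smoothSeries g + κ • PowerSeries.X := by
  have hid : gaussSeries * momentSeries (fun z => z) = PowerSeries.X := smoothSeries_id
  simp only [smoothSeries, Derivation.leibniz, map_add, derivative_gaussSeries,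
    h.derivative_momentSeries, smul_eq_mul, map_neg, PowerSeries.derivative_X,
    PowerSeries.smul_eq_C_mul]
  simp only [map_one]
  linear_combination PowerSeries.C κ * hid

/-- The recurrence for the Taylor coefficients of the Gaussian smoothing of `g`. -/
lemma coeff_recurrence (h : IsHomogeneousLike α κ g) (n : ℕ) :
    (n + 1) * (n + 2) * PowerSeries.coeff (n + 2) (smoothSeries g) =
      (α - n) * PowerSeries.coeff n (smoothSeries g) + if n = 1 then κ else 0 := by
  have := congrArg (PowerSeries.coeff n) h.smoothSeries_ode
  have hX : PowerSeries.coeff n (PowerSeries.X * PowerSeries.derivative ℝ (smoothSeries g)) =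
      n * PowerSeries.coeff n (smoothSeries g) := by
    cases n with
    | zero => simp
    | succ n => rw [PowerSeries.coeff_succ_X_mul, PowerSeries.coeff_derivative]; push_cast; ring
  rw [map_add, map_add, hX, PowerSeries.coeff_smul, PowerSeries.coeff_smul,
    PowerSeries.coeff_derivative, PowerSeries.coeff_derivative, PowerSeries.coeff_X] at this
  push_cast at this
  split_ifs at this ⊢ <;> simp only [smul_eq_mul] at this <;> linarith

end IsHomogeneousLike

/-! ### Moments of measures on the unit sphere -/

lemma abs_inner_le_of_norm_one {E : Type*} [NormedAddCommGroup E]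
    [InnerProductSpace ℝ E] {s : E} (hs : ‖s‖ = 1) (a : E) : |inner ℝ a s| ≤ ‖a‖ := by
  simpa [hs] using abs_real_inner_le_norm a s

section Sphere

variable {E : Type*} [NormedAddCommGroup E] [InnerProductSpace ℝ E] [FiniteDimensional ℝ E]
  [MeasurableSpace E] [BorelSpace E]

/-- The rotation invariance on which the smoothing argument rests: the law of ⟨u, s⟩ does not depend
on the unit vector s. -/
lemma map_inner_stdGaussian {s : E} (hs : ‖s‖ = 1) :
    (stdGaussian E).map (fun u => inner ℝ u s) = gaussianReal 0 1 := by
  have h : (stdGaussian E).map (innerSL ℝ s) = gaussianReal 0 1 := by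
    have : IsProbabilityMeasure ((stdGaussian E).map (innerSL ℝ s)) :=
      Measure.isProbabilityMeasure_map (by fun_prop)
    refine Measure.ext_of_charFun (funext fun t => ?_)
    rw [charFun_map_eq_charFunDual_smul, charFunDual_stdGaussian, charFun_gaussianReal, norm_smul,
      innerSL_apply_norm, hs]
    congr 1
    have : ((|t| : ℝ) : ℂ) ^ 2 = (t : ℂ) ^ 2 := by norm_cast; exact sq_abs t
    simp [this]; ring
  rw [← h]
  congr 1
  ext u
  simp [real_inner_comm]

variable {α κ : ℝ} {g : ℝ → ℝ} {Γ Γ₁ Γ₂ : Measure E}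

lemma integrable_inner_pow [IsFiniteMeasure Γ] (hΓ : ∀ᵐ s ∂Γ, ‖s‖ = 1) (a : E) (n : ℕ) :
    Integrable (fun s => inner ℝ a s ^ n) Γ := by
  refine (integrable_const (‖a‖ ^ n)).mono' (by fun_prop) ?_
  filter_upwards [hΓ] with s hs
  rw [norm_pow]
  exact pow_le_pow_left₀ (norm_nonneg _) (abs_inner_le_of_norm_one hs a) n

lemma IsHomogeneousLike.integrable_inner (h : IsHomogeneousLike α κ g) [IsFiniteMeasure Γ]
    (hΓ : ∀ᵐ s ∂Γ, ‖s‖ = 1) (a : E) : Integrable (fun s => g (inner ℝ a s)) Γ := by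
  obtain ⟨C, hb⟩ := h.bound
  have := h.continuous
  refine (integrable_const (|C| * (1 + ‖a‖ ^ 2))).mono' (by fun_prop) ?_
  filter_upwards [hΓ] with s hs
  have := pow_le_pow_left₀ (abs_nonneg _) (abs_inner_le_of_norm_one hs a) 2
  rw [sq_abs] at this
  refine (hb _).trans (mul_le_mul (le_abs_self C) (by linarith) (by positivity) (abs_nonneg C))

/-- After exchanging the integrals, the inner one is the smoothing of g at ⟨a, s⟩ by
`map_inner_stdGaussian`. Its Taylor series can be integrated termwise, since |⟨a, s⟩| ≤ ‖a‖ on the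
sphere. -/
lemma IsHomogeneousLike.hasSum_moments (h : IsHomogeneousLike α κ g) [IsFiniteMeasure Γ]
    (hΓ : ∀ᵐ s ∂Γ, ‖s‖ = 1) (a : E) :
    HasSum (fun n => PowerSeries.coeff n (smoothSeries g) * ∫ s, inner ℝ a s ^ n ∂Γ)
      (∫ u, ∫ s, g (inner ℝ (a + u) s) ∂Γ ∂(stdGaussian E)) := by
  obtain ⟨C, hb⟩ := h.bound
  have hgc := h.continuous
  have hswap : ∫ u, ∫ s, g (inner ℝ (a + u) s) ∂Γ ∂(stdGaussian E) =
      ∫ s, ∫ z, g (inner ℝ a s + z) ∂(gaussianReal 0 1) ∂Γ := by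
    rw [integral_integral_swap]
    · refine integral_congr_ae ?_
      filter_upwards [hΓ] with s hs
      rw [← map_inner_stdGaussian hs, integral_map (by fun_prop) (by fun_prop)]
      simp [inner_add_left]
    · have h1 : Integrable (fun u : E => |C| * (1 + (2 * ‖a‖ ^ 2 + 2 * ‖u‖ ^ 2)))
          (stdGaussian E) := by
        have := (IsGaussian.memLp_id (stdGaussian E) 2 (by simp)).integrable_norm_pow (by simp)
        simp only [id] at this
        exact ((integrable_const _).add ((integrable_const _).add
          (this.const_mul 2))).const_mul _
      have h2 := h1.comp_fst Γ
      refine h2.mono' (by fun_prop) ?_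
      have : ∀ᵐ q ∂(stdGaussian E).prod Γ, ‖q.2‖ = 1 :=
        Measure.quasiMeasurePreserving_snd.ae hΓ
      filter_upwards [this] with q hq
      have h3 := pow_le_pow_left₀ (abs_nonneg _) (abs_inner_le_of_norm_one hq (a + q.1)) 2
      have h4 := pow_le_pow_left₀ (norm_nonneg _) (norm_add_le a q.1) 2
      rw [sq_abs] at h3
      refine (hb _).trans (mul_le_mul (le_abs_self C) ?_ (by positivity) (abs_nonneg C))
      nlinarith [sq_nonneg (‖a‖ - ‖q.1‖)]
  have hsum : ∀ x : ℝ, Summable fun n => |PowerSeries.coeff n (smoothSeries g)| * |x| ^ n :=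
    fun x => by
      simpa [abs_mul, abs_pow] using (hasSum_smoothSeries hgc hb x).summable.norm
  have key := hasSum_integral_of_summable_integral_norm (μ := Γ)
    (F := fun n s => PowerSeries.coeff n (smoothSeries g) * inner ℝ a s ^ n)
    (fun n => (integrable_inner_pow hΓ a n).const_mul _) (by
      refine Summable.of_nonneg_of_le (fun n => integral_nonneg fun s => norm_nonneg _)
        (fun n => ?_) ((hsum ‖a‖).mul_right (Γ.real Set.univ))
      have : ∫ s, |PowerSeries.coeff n (smoothSeries g)| * |‖a‖| ^ n ∂Γ =
          |PowerSeries.coeff n (smoothSeries g)| * |‖a‖| ^ n * Γ.real Set.univ := by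
        simp [mul_comm]
      rw [← this]
      refine integral_mono_ae ((integrable_inner_pow hΓ a n).const_mul _).norm
        (integrable_const _) ?_
      filter_upwards [hΓ] with s hs
      rw [norm_mul, norm_pow, Real.norm_eq_abs, Real.norm_eq_abs, abs_norm]
      gcongr
      exact abs_inner_le_of_norm_one hs a)
  rw [hswap]
  convert! key using 1
  · ext n
    rw [integral_const_mul]
  · refine integral_congr_ae (ae_of_all _ fun s => ?_)
    exact (hasSum_smoothSeries hgc hb _).tsum_eq.symm

/-- If the transforms `u ↦ ∫ g(⟨u, s⟩)` of two measures on the sphere differ by a linear form, then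
their moments agree wherever the smoothing of `g` has a nonzero Taylor coefficient. -/
lemma IsHomogeneousLike.moments_eq (h : IsHomogeneousLike α κ g)
    [IsFiniteMeasure Γ₁] [IsFiniteMeasure Γ₂]
    (h₁ : ∀ᵐ s ∂Γ₁, ‖s‖ = 1) (h₂ : ∀ᵐ s ∂Γ₂, ‖s‖ = 1) (v : E)
    (heq : ∀ u, ∫ s, g (inner ℝ u s) ∂Γ₁ = ∫ s, g (inner ℝ u s) ∂Γ₂ + inner ℝ u v)
    {n : ℕ} (hn : PowerSeries.coeff n (smoothSeries g) ≠ 0) (hv : n = 1 → v = 0) (a : E) :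
    ∫ s, inner ℝ a s ^ n ∂Γ₁ = ∫ s, inner ℝ a s ^ n ∂Γ₂ := by
  set c := fun n => PowerSeries.coeff n (smoothSeries g) with hc
  -- The Gaussian has mean zero, so smoothing leaves the linear discrepancy unchanged.
  have hlin : ∀ x : ℝ, ∫ u, ∫ s, g (inner ℝ (x • a + u) s) ∂Γ₁ ∂(stdGaussian E) =
      ∫ u, ∫ s, g (inner ℝ (x • a + u) s) ∂Γ₂ ∂(stdGaussian E) + x * inner ℝ a v := fun x => by
    obtain ⟨C, hb⟩ := h.bound
    have hgc := h.continuous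
    have i1 : Integrable (fun u => inner ℝ (x • a + u) v) (stdGaussian E) := by
      have := (IsGaussian.memLp_id (stdGaussian E) 1 (by simp)).integrable le_rfl
      simp only [inner_add_left]
      exact (integrable_const _).add (this.inner_const v)
    have i2 : Integrable (fun u => ∫ s, g (inner ℝ (x • a + u) s) ∂Γ₂) (stdGaussian E) := by
      have h1 : Integrable (fun u : E => |C| * (1 + (2 * ‖x • a‖ ^ 2 + 2 * ‖u‖ ^ 2)) *
          Γ₂.real Set.univ) (stdGaussian E) := by
        have := (IsGaussian.memLp_id (stdGaussian E) 2 (by simp)).integrable_norm_pow (by simp)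
        simp only [id] at this
        exact (((integrable_const _).add ((integrable_const _).add
          (this.const_mul 2))).const_mul _).mul_const _
      refine h1.mono' ?_ (ae_of_all _ fun u => ?_)
      · have : AEStronglyMeasurable (fun q : E × E => g (inner ℝ (x • a + q.1) q.2))
          ((stdGaussian E).prod Γ₂) := by fun_prop
        exact this.integral_prod_right'
      · refine norm_integral_le_of_norm_le_const ?_
        filter_upwards [h₂] with s hs
        have h3 := pow_le_pow_left₀ (abs_nonneg _) (abs_inner_le_of_norm_one hs (x • a + u)) 2
        have h4 := pow_le_pow_left₀ (norm_nonneg _) (norm_add_le (x • a) u) 2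
        rw [sq_abs] at h3
        refine (hb _).trans (mul_le_mul (le_abs_self C) ?_ (by positivity) (abs_nonneg C))
        nlinarith [sq_nonneg (‖x • a‖ - ‖u‖)]
    simp_rw [heq]
    rw [integral_add i2 i1]
    have hL := integral_strongDual_stdGaussian (innerSL ℝ v : StrongDual ℝ E)
    simp only [innerSL_apply_apply] at hL
    have hL' : ∫ u, inner ℝ u v ∂(stdGaussian E) = 0 := by
      rw [← hL]; simp only [real_inner_comm]
    have := (IsGaussian.memLp_id (stdGaussian E) 1 (by simp)).integrable le_rfl
    simp only [inner_add_left]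
    rw [integral_add (integrable_const _) (this.inner_const v), hL']
    simp [inner_smul_left]
  -- Evaluated at x • a, both sides are power series in x, and the vector v enters only in degree
  -- one.
  have hz : ∀ x : ℝ, HasSum (fun n => (c n * (∫ s, inner ℝ a s ^ n ∂Γ₁ - ∫ s, inner ℝ a s ^ n ∂Γ₂)
      - if n = 1 then inner ℝ a v else 0) * x ^ n) 0 := fun x => by
    have s1 := h.hasSum_moments h₁ (x • a)
    have s2 := h.hasSum_moments h₂ (x • a)
    have s3 : HasSum (fun n => (if n = 1 then inner ℝ a v else 0) * x ^ n) (x * inner ℝ a v) := by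
      convert hasSum_single (f := fun n => (if n = 1 then inner ℝ a v else 0) * x ^ n) 1
        (fun n hn => ?_) using 1
      · simp [mul_comm]
      · simp [hn]
    have := (s1.sub s2).sub s3
    rw [hlin x, add_sub_cancel_left, sub_self] at this
    convert! this using 2 with n
    simp only [inner_smul_left, mul_pow, conj_trivial, integral_const_mul, hc]
    ring
  have := coeff_eq_zero_of_hasSum_zero hz n
  have h0 : (if n = 1 then inner ℝ a v else 0) = (0 : ℝ) := by
    split_ifs with h1
    · rw [hv h1, inner_zero_right]
    · rfl
  rw [h0, sub_zero, mul_eq_zero, or_iff_right hn] at this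
  exact sub_eq_zero.1 this

lemma charFun_hasSum_moments [IsFiniteMeasure Γ] (hΓ : ∀ᵐ s ∂Γ, ‖s‖ = 1) (a : E) :
    HasSum (fun n : ℕ => Complex.I ^ n / n.factorial * ((∫ s, inner ℝ a s ^ n ∂Γ : ℝ) : ℂ))
      (charFun Γ a) := by
  have key := hasSum_integral_of_summable_integral_norm (μ := Γ)
    (F := fun (n : ℕ) s => Complex.I ^ n / n.factorial * ((inner ℝ a s ^ n : ℝ) : ℂ))
    (fun n => ((integrable_inner_pow hΓ a n).ofReal).const_mul _) (by
      refine Summable.of_nonneg_of_le (fun n => integral_nonneg fun s => norm_nonneg _)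
        (fun n => ?_) ((Real.summable_pow_div_factorial ‖a‖).mul_right (Γ.real Set.univ))
      have : ∫ s, ‖a‖ ^ n / n.factorial ∂Γ = ‖a‖ ^ n / n.factorial * Γ.real Set.univ := by
        simp [mul_comm]
      rw [← this]
      refine integral_mono_ae (((integrable_inner_pow hΓ a n).ofReal).const_mul _).norm
        (integrable_const _) ?_
      filter_upwards [hΓ] with s hs
      rw [norm_mul, norm_div, norm_pow, Complex.norm_I, one_pow, Complex.norm_real, norm_pow,
        Real.norm_eq_abs, Complex.norm_natCast, one_div_mul_eq_div]
      gcongr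
      exact abs_inner_le_of_norm_one hs a)
  convert! key using 1
  · ext n
    rw [integral_const_mul, integral_complex_ofReal]
  · rw [charFun_apply]
    refine integral_congr_ae (ae_of_all _ fun s => ?_)
    have := NormedSpace.expSeries_div_hasSum_exp (𝔸 := ℂ) (inner ℝ s a * Complex.I)
    rw [← Complex.exp_eq_exp_ℂ] at this
    refine this.tsum_eq.symm.trans ?_
    refine tsum_congr fun n => ?_
    rw [mul_pow, real_inner_comm]; push_cast; ring

/-- Measures on the sphere with the same moments agree. -/
lemma ext_of_moments [IsFiniteMeasure Γ₁] [IsFiniteMeasure Γ₂]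
    (h₁ : ∀ᵐ s ∂Γ₁, ‖s‖ = 1) (h₂ : ∀ᵐ s ∂Γ₂, ‖s‖ = 1)
    (h : ∀ (n : ℕ) (a : E), ∫ s, inner ℝ a s ^ n ∂Γ₁ = ∫ s, inner ℝ a s ^ n ∂Γ₂) : Γ₁ = Γ₂ := by
  refine Measure.ext_of_charFun (funext fun a => ?_)
  rw [← (charFun_hasSum_moments h₁ a).tsum_eq, ← (charFun_hasSum_moments h₂ a).tsum_eq]
  simp_rw [h]

end Sphere

/-! ### The two homogeneous functions of the stable exponents -/

/-- The function `x ↦ (x⁺)^α`. -/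
def posRpow (α x : ℝ) : ℝ := max x 0 ^ α

lemma rpow_le_one_add_sq {α x : ℝ} (h0 : 0 < α) (h2 : α < 2) (hx : 0 ≤ x) : x ^ α ≤ 1 + x ^ 2 := by
  rcases le_total x 1 with h | h
  · nlinarith [Real.rpow_le_one hx h h0.le, sq_nonneg x]
  · have := Real.rpow_le_rpow_of_exponent_le h h2.le
    rw [Real.rpow_two] at this; linarith

lemma posRpow_nonneg (α x : ℝ) : 0 ≤ posRpow α x := Real.rpow_nonneg (le_max_right _ _) _

lemma posRpow_of_nonneg {x : ℝ} (α : ℝ) (hx : 0 ≤ x) : posRpow α x = x ^ α := by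
  rw [posRpow, max_eq_left hx]

lemma posRpow_of_nonpos {α x : ℝ} (hα : 0 < α) (hx : x ≤ 0) : posRpow α x = 0 := by
  rw [posRpow, max_eq_right hx, Real.zero_rpow hα.ne']

lemma isHomogeneousLike_posRpow {α : ℝ} (h0 : 0 < α) (h2 : α < 2) :
    IsHomogeneousLike α 0 (posRpow α) where
  continuous := (continuous_id.max continuous_const).rpow_const fun _ => Or.inr h0.le
  map_zero := posRpow_of_nonpos h0 le_rfl
  bound := ⟨1, fun z => by
    rw [abs_of_nonneg (posRpow_nonneg _ _), one_mul]
    rcases le_total 0 z with h | h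
    · rw [posRpow_of_nonneg _ h]; exact rpow_le_one_add_sq h0 h2 h
    · rw [posRpow_of_nonpos h0 h]; positivity⟩
  deriv z hz := by
    rcases lt_or_gt_of_ne hz with h | h
    · refine ⟨0, ?_, by rw [posRpow_of_nonpos h0 h.le]; ring⟩
      refine (hasDerivAt_const z (0 : ℝ)).congr_of_eventuallyEq ?_
      filter_upwards [Iio_mem_nhds h] with y hy
      exact posRpow_of_nonpos h0 (le_of_lt hy)
    · refine ⟨α * z ^ (α - 1), ?_, ?_⟩
      · refine (Real.hasDerivAt_rpow_const (Or.inl hz)).congr_of_eventuallyEq ?_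
        filter_upwards [Ioi_mem_nhds h] with y hy
        exact posRpow_of_nonneg _ (le_of_lt hy)
      · rw [posRpow_of_nonneg _ h.le, Real.rpow_sub_one hz]; field_simp; ring

lemma abs_mul_log_le (z : ℝ) : |z * Real.log z| ≤ 1 + z ^ 2 := by
  rw [← Real.log_abs, abs_mul]
  rcases eq_or_ne z 0 with rfl | hz
  · simp
  have hz' : 0 < |z| := abs_pos.2 hz
  rw [← sq_abs z]
  rcases le_total |z| 1 with h | h
  · have := Real.abs_log_mul_self_lt |z| hz' h
    rw [abs_mul, abs_abs, mul_comm] at this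
    nlinarith
  · rw [abs_of_nonneg (Real.log_nonneg h)]
    nlinarith [Real.log_le_sub_one_of_pos hz']

lemma isHomogeneousLike_mul_log : IsHomogeneousLike 1 1 (fun x => x * Real.log x) where
  continuous := Real.continuous_mul_log
  map_zero := by simp
  bound := ⟨1, fun z => by rw [one_mul]; exact abs_mul_log_le z⟩
  deriv z hz := ⟨Real.log z + 1, Real.hasDerivAt_mul_log hz, by ring⟩

lemma integral_pow_mul_posRpow_pos {α : ℝ} (h0 : 0 < α) (h2 : α < 2) (n : ℕ) :
    0 < ∫ z, z ^ n * posRpow α z ∂(gaussianReal 0 1) := by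
  have h := isHomogeneousLike_posRpow h0 h2
  obtain ⟨C, hb⟩ := h.bound
  rw [integral_pos_iff_support_of_nonneg _ (integrable_pow_mul h.continuous hb n)]
  · have hsub : Set.Ioi (0 : ℝ) ⊆ Function.support fun z => z ^ n * posRpow α z := fun z hz => by
      have hz : 0 < z := hz
      rw [Function.mem_support, posRpow_of_nonneg _ hz.le]
      positivity
    refine lt_of_lt_of_le ?_ (measure_mono hsub)
    rw [pos_iff_ne_zero]
    intro h
    have := gaussianReal_absolutelyContinuous' 0 (v := 1) one_ne_zero h
    simp at this
  · intro z
    rcases le_total 0 z with h | h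
    · exact mul_nonneg (pow_nonneg h _) (posRpow_nonneg _ _)
    · simp [posRpow_of_nonpos h0 h]

/-- The coefficients of order 0 and 1 are Gaussian moments of a nonnegative nonzero function on the
half-line. With κ = 0 the recurrence multiplies by α - n, which for 0 < α < 2 can vanish only at n =
α = 1. -/
lemma coeff_smoothSeries_posRpow_ne_zero {α : ℝ} (h0 : 0 < α) (h2 : α < 2) (n : ℕ)
    (hn : Even n ∨ α ≠ 1) : PowerSeries.coeff n (smoothSeries (posRpow α)) ≠ 0 := by
  have h := isHomogeneousLike_posRpow h0 h2
  induction n using Nat.twoStepInduction with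
  | zero =>
    have := integral_pow_mul_posRpow_pos h0 h2 0
    rw [smoothSeries, PowerSeries.coeff_mul]
    simpa [gaussSeries, momentSeries] using this.ne'
  | one =>
    have := integral_pow_mul_posRpow_pos h0 h2 1
    rw [smoothSeries, PowerSeries.coeff_mul, Finset.Nat.antidiagonal_succ]
    simpa [gaussSeries, momentSeries] using this.ne'
  | more n ih _ =>
    have hr := h.coeff_recurrence n
    intro hz
    rw [hz, mul_zero, ite_self, add_zero, eq_comm, mul_eq_zero] at hr
    have hn' : Even n ∨ α ≠ 1 := hn.imp_left fun h => by simpa [Nat.even_add] using h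
    refine hr.elim (fun h => ?_) (ih hn')
    have hα : α = n := by linarith
    subst hα
    have a0 : 0 < n := by exact_mod_cast h0
    have a2 : n < 2 := by exact_mod_cast h2
    obtain rfl : n = 1 := by omega
    simp at hn'

/-- With α = κ = 1 the recurrence at n = 1 loses its homogeneous part, so the cubic coefficient is
1/6 irrespective of the linear one. From there on the factors 1 - n do not vanish. -/
lemma coeff_smoothSeries_mul_log_ne_zero (n : ℕ) :
    PowerSeries.coeff (2 * n + 3) (smoothSeries fun x => x * Real.log x) ≠ 0 := by
  have h := isHomogeneousLike_mul_log
  induction n with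
  | zero =>
    have := h.coeff_recurrence 1
    intro hz
    rw [show 2 * 0 + 3 = 1 + 2 by rfl] at hz
    rw [hz] at this
    norm_num at this
  | succ n ih =>
    have := h.coeff_recurrence (2 * n + 3)
    intro hz
    rw [show 2 * (n + 1) + 3 = 2 * n + 3 + 2 by ring] at hz
    rw [hz, if_neg (by omega), mul_zero, add_zero, eq_comm, mul_eq_zero, or_iff_left ih] at this
    push_cast at this
    linarith [(Nat.cast_nonneg n : (0 : ℝ) ≤ n)]

section Sphere

variable {E : Type*} [NormedAddCommGroup E] [InnerProductSpace ℝ E] [FiniteDimensional ℝ E]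
  [MeasurableSpace E] [BorelSpace E] {α : ℝ} {Γ Γ₁ Γ₂ : Measure E}

/-- A measure on the sphere is determined by `u ↦ ∫ (⟨u, s⟩⁺)^α` if `α ≠ 1`. -/
theorem ext_of_integral_posRpow [IsFiniteMeasure Γ₁] [IsFiniteMeasure Γ₂]
    (h₁ : ∀ᵐ s ∂Γ₁, ‖s‖ = 1) (h₂ : ∀ᵐ s ∂Γ₂, ‖s‖ = 1) (h0 : 0 < α) (h2 : α < 2) (hα : α ≠ 1)
    (h : ∀ u : E, ∫ s, posRpow α (inner ℝ u s) ∂Γ₁ = ∫ s, posRpow α (inner ℝ u s) ∂Γ₂) :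
    Γ₁ = Γ₂ :=
  ext_of_moments h₁ h₂ fun n a => (isHomogeneousLike_posRpow h0 h2).moments_eq h₁ h₂ 0
    (by simpa using h) (coeff_smoothSeries_posRpow_ne_zero h0 h2 n (Or.inr hα)) (fun _ => rfl) a

lemma abs_rpow_eq_posRpow (h0 : 0 < α) (x : ℝ) : |x| ^ α = posRpow α x + posRpow α (-x) := by
  rcases le_total 0 x with h | h
  · rw [abs_of_nonneg h, posRpow_of_nonneg _ h, posRpow_of_nonpos h0 (by linarith), add_zero]
  · rw [abs_of_nonpos h, posRpow_of_nonneg _ (by linarith : 0 ≤ -x), posRpow_of_nonpos h0 h,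
      zero_add]

lemma sign_mul_abs_rpow_eq_posRpow (h0 : 0 < α) (x : ℝ) :
    Real.sign x * |x| ^ α = posRpow α x - posRpow α (-x) := by
  rcases lt_trichotomy 0 x with h | rfl | h
  · rw [Real.sign_of_pos h, abs_of_nonneg h.le, posRpow_of_nonneg _ h.le,
      posRpow_of_nonpos h0 (by linarith)]; ring
  · simp
  · rw [Real.sign_of_neg h, abs_of_nonpos h.le, posRpow_of_nonneg _ (by linarith : 0 ≤ -x),
      posRpow_of_nonpos h0 h.le]; ring

lemma integrable_posRpow_inner [IsFiniteMeasure Γ] (hΓ : ∀ᵐ s ∂Γ, ‖s‖ = 1) (h0 : 0 < α)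
    (h2 : α < 2) (u : E) : Integrable (fun s => posRpow α (inner ℝ u s)) Γ :=
  (isHomogeneousLike_posRpow h0 h2).integrable_inner hΓ u

lemma integrable_posRpow_neg_inner [IsFiniteMeasure Γ] (hΓ : ∀ᵐ s ∂Γ, ‖s‖ = 1) (h0 : 0 < α)
    (h2 : α < 2) (u : E) : Integrable (fun s => posRpow α (-inner ℝ u s)) Γ := by
  simpa using (isHomogeneousLike_posRpow h0 h2).integrable_inner hΓ (-u)

lemma integrable_abs_inner_rpow [IsFiniteMeasure Γ] (hΓ : ∀ᵐ s ∂Γ, ‖s‖ = 1) (h0 : 0 < α)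
    (h2 : α < 2) (u : E) : Integrable (fun s => |inner ℝ u s| ^ α) Γ := by
  simp_rw [abs_rpow_eq_posRpow h0]
  exact (integrable_posRpow_inner hΓ h0 h2 u).add (integrable_posRpow_neg_inner hΓ h0 h2 u)

/-- The even moments of a measure on the sphere are determined by `u ↦ ∫ |⟨u, s⟩|^α`. -/
lemma even_moments_eq [IsFiniteMeasure Γ₁] [IsFiniteMeasure Γ₂]
    (h₁ : ∀ᵐ s ∂Γ₁, ‖s‖ = 1) (h₂ : ∀ᵐ s ∂Γ₂, ‖s‖ = 1) (h0 : 0 < α) (h2 : α < 2)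
    (h : ∀ u : E, ∫ s, |inner ℝ u s| ^ α ∂Γ₁ = ∫ s, |inner ℝ u s| ^ α ∂Γ₂) {n : ℕ} (hn : Even n)
    (a : E) : ∫ s, inner ℝ a s ^ n ∂Γ₁ = ∫ s, inner ℝ a s ^ n ∂Γ₂ := by
  have sph : ∀ Γ : Measure E, (∀ᵐ s ∂Γ, ‖s‖ = 1) → ∀ᵐ s ∂(Γ + Γ.map (fun s => -s)), ‖s‖ = 1 :=
    fun Γ hΓ => by
      rw [ae_add_measure_iff]
      refine ⟨hΓ, ?_⟩
      rw [ae_map_iff (by fun_prop) (measurableSet_eq_fun (by fun_prop) (by fun_prop))]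
      simpa using hΓ
  -- Adding the reflected measure turns the transform with kernel (x⁺)^α into the one with kernel
  -- |x|^α, and doubles the even moments.
  have hint : ∀ (Γ : Measure E) [IsFiniteMeasure Γ] (hΓ : ∀ᵐ s ∂Γ, ‖s‖ = 1) (u : E),
      ∫ s, posRpow α (inner ℝ u s) ∂(Γ + Γ.map (fun s => -s)) = ∫ s, |inner ℝ u s| ^ α ∂Γ := by
    intro Γ _ hΓ u
    have hc := (isHomogeneousLike_posRpow h0 h2).continuous
    have i := integrable_posRpow_inner (sph Γ hΓ) h0 h2 u
    rw [integrable_add_measure] at i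
    rw [integral_add_measure i.1 i.2, integral_map (by fun_prop) (by fun_prop)]
    simp_rw [inner_neg_right]
    rw [← integral_add i.1 (integrable_posRpow_neg_inner hΓ h0 h2 u)]
    simp_rw [abs_rpow_eq_posRpow h0]
  have hmom : ∀ (Γ : Measure E) [IsFiniteMeasure Γ] (hΓ : ∀ᵐ s ∂Γ, ‖s‖ = 1),
      ∫ s, inner ℝ a s ^ n ∂(Γ + Γ.map (fun s => -s)) = 2 * ∫ s, inner ℝ a s ^ n ∂Γ := by
    intro Γ _ hΓ
    have i := integrable_inner_pow (sph Γ hΓ) a n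
    rw [integrable_add_measure] at i
    rw [integral_add_measure i.1 i.2, integral_map (by fun_prop) (by fun_prop)]
    simp_rw [inner_neg_right, hn.neg_pow]
    ring
  have := (isHomogeneousLike_posRpow h0 h2).moments_eq (sph Γ₁ h₁) (sph Γ₂ h₂) 0
    (fun u => by rw [hint Γ₁ h₁, hint Γ₂ h₂, h, inner_zero_right, add_zero])
    (coeff_smoothSeries_posRpow_ne_zero h0 h2 n (Or.inl hn)) (fun _ => rfl) a
  rw [hmom Γ₁ h₁, hmom Γ₂ h₂] at this
  linarith

/-- A symmetric measure on the sphere is determined by `u ↦ ∫ |⟨u, s⟩|^α`. -/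
theorem ext_of_integral_abs_rpow [IsFiniteMeasure Γ₁] [IsFiniteMeasure Γ₂]
    (h₁ : ∀ᵐ s ∂Γ₁, ‖s‖ = 1) (h₂ : ∀ᵐ s ∂Γ₂, ‖s‖ = 1) (h0 : 0 < α) (h2 : α < 2)
    (hs₁ : Γ₁.map (fun s => -s) = Γ₁) (hs₂ : Γ₂.map (fun s => -s) = Γ₂)
    (h : ∀ u : E, ∫ s, |inner ℝ u s| ^ α ∂Γ₁ = ∫ s, |inner ℝ u s| ^ α ∂Γ₂) : Γ₁ = Γ₂ := by
  have odd : ∀ Γ : Measure E, Γ.map (fun s => -s) = Γ → ∀ (n : ℕ), Odd n → ∀ a : E,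
      ∫ s, inner ℝ a s ^ n ∂Γ = 0 := fun Γ hΓ n hn a => by
    have : ∫ s, inner ℝ a s ^ n ∂Γ = -∫ s, inner ℝ a s ^ n ∂Γ := by
      conv_lhs => rw [← hΓ, integral_map (by fun_prop) (by fun_prop)]
      simp_rw [inner_neg_right, hn.neg_pow, integral_neg]
    linarith
  refine ext_of_moments h₁ h₂ fun n a => ?_
  rcases Nat.even_or_odd n with hn | hn
  · exact even_moments_eq h₁ h₂ h0 h2 h hn a
  · rw [odd Γ₁ hs₁ n hn, odd Γ₂ hs₂ n hn]

/-- On the sphere, the moments of order three determine those of order one. -/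
lemma first_moment_eq [IsFiniteMeasure Γ₁] [IsFiniteMeasure Γ₂]
    (h₁ : ∀ᵐ s ∂Γ₁, ‖s‖ = 1) (h₂ : ∀ᵐ s ∂Γ₂, ‖s‖ = 1)
    (h : ∀ a : E, ∫ s, inner ℝ a s ^ 3 ∂Γ₁ = ∫ s, inner ℝ a s ^ 3 ∂Γ₂) (a : E) :
    ∫ s, inner ℝ a s ∂Γ₁ = ∫ s, inner ℝ a s ∂Γ₂ := by
  set b := stdOrthonormalBasis ℝ E
  -- With y = ⟨b_j, s⟩ and x = ⟨a, s⟩, polarization gives xy² = ((x + y)³ + (x - y)³ - 2x³)/6, and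
  -- the y² sum to ‖s‖² = 1.
  have key : ∀ (Γ : Measure E) [IsFiniteMeasure Γ] (hΓ : ∀ᵐ s ∂Γ, ‖s‖ = 1),
      ∫ s, inner ℝ a s ∂Γ = ∑ i, ((∫ s, inner ℝ (a + b i) s ^ 3 ∂Γ) / 6 +
        (∫ s, inner ℝ (a - b i) s ^ 3 ∂Γ) / 6 - (∫ s, inner ℝ a s ^ 3 ∂Γ) / 3) := by
    intro Γ _ hΓ
    have i := fun c => integrable_inner_pow hΓ c 3
    have e : ∀ j, (∫ s, inner ℝ (a + b j) s ^ 3 ∂Γ) / 6 + (∫ s, inner ℝ (a - b j) s ^ 3 ∂Γ) / 6 -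
        (∫ s, inner ℝ a s ^ 3 ∂Γ) / 3 = ∫ s, (inner ℝ (a + b j) s ^ 3 / 6 +
          inner ℝ (a - b j) s ^ 3 / 6 - inner ℝ a s ^ 3 / 3) ∂Γ := fun j => by
      have i' : Integrable (fun s => inner ℝ (a + b j) s ^ 3 / 6 + inner ℝ (a - b j) s ^ 3 / 6) Γ :=
        ((i _).div_const 6).add ((i _).div_const 6)
      rw [integral_sub i' ((i _).div_const 3), integral_add ((i _).div_const 6)
        ((i _).div_const 6), integral_div, integral_div, integral_div]
    simp_rw [e]
    have i' : ∀ j, Integrable (fun s => inner ℝ (a + b j) s ^ 3 / 6 +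
        inner ℝ (a - b j) s ^ 3 / 6 - inner ℝ a s ^ 3 / 3) Γ := fun j =>
      (((i _).div_const 6).add ((i _).div_const 6)).sub ((i _).div_const 3)
    rw [← integral_finsetSum _ fun j _ => i' j]
    refine integral_congr_ae ?_
    filter_upwards [hΓ] with s hs
    have hp := b.sum_sq_norm_inner_right s
    simp only [hs, one_pow, Real.norm_eq_abs, sq_abs] at hp
    calc inner ℝ a s = inner ℝ a s * ∑ j, inner ℝ (b j) s ^ 2 := by rw [hp, mul_one]
      _ = _ := by
        rw [Finset.mul_sum]
        refine Finset.sum_congr rfl fun j _ => ?_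
        rw [inner_add_left, inner_sub_left]; ring
  rw [key Γ₁ h₁, key Γ₂ h₂]
  simp_rw [h]

/-- The case `α = 1` of the uniqueness of spectral measures on the sphere. -/
theorem ext_of_integral_mul_log [IsFiniteMeasure Γ₁] [IsFiniteMeasure Γ₂]
    (h₁ : ∀ᵐ s ∂Γ₁, ‖s‖ = 1) (h₂ : ∀ᵐ s ∂Γ₂, ‖s‖ = 1) (v : E)
    (h : ∀ u : E, ∫ s, |inner ℝ u s| ^ (1 : ℝ) ∂Γ₁ = ∫ s, |inner ℝ u s| ^ (1 : ℝ) ∂Γ₂)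
    (hl : ∀ u : E, ∫ s, inner ℝ u s * Real.log (inner ℝ u s) ∂Γ₁ =
      ∫ s, inner ℝ u s * Real.log (inner ℝ u s) ∂Γ₂ + inner ℝ u v) : Γ₁ = Γ₂ := by
  have h3 : ∀ n (a : E), ∫ s, inner ℝ a s ^ (2 * n + 3) ∂Γ₁ = ∫ s, inner ℝ a s ^ (2 * n + 3) ∂Γ₂ :=
    fun n a => isHomogeneousLike_mul_log.moments_eq h₁ h₂ v hl
      (coeff_smoothSeries_mul_log_ne_zero n) (by omega) a
  refine ext_of_moments h₁ h₂ fun n a => ?_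
  -- The modulus kernel supplies the even moments and the logarithmic kernel the odd ones of degree
  -- at least three; degree one is reduced to degree three.
  rcases Nat.even_or_odd n with hn | ⟨k, rfl⟩
  · exact even_moments_eq h₁ h₂ one_pos one_lt_two h hn a
  · cases k with
    | zero => simpa using first_moment_eq h₁ h₂ (h3 0) a
    | succ k => exact h3 k a

end Sphere

/-! ### Uniqueness of the spectral measure on the sphere -/

/-- The odd function `|x|^α sign(x) w(α, x)`, the imaginary part of `-stableKernel α x`. -/
def oddKernel (α x : ℝ) : ℝ := |x| ^ α * (Real.sign x * stableW α x)

lemma stableKernel_eq (α x : ℝ) :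
    stableKernel α x = ((|x| ^ α : ℝ) : ℂ) - Complex.I * ((oddKernel α x : ℝ) : ℂ) := by
  rw [stableKernel, oddKernel]; push_cast; ring

lemma oddKernel_neg (α x : ℝ) : oddKernel α (-x) = -oddKernel α x := by
  rcases lt_trichotomy 0 x with h | rfl | h
  · rw [oddKernel, oddKernel, Real.sign_of_pos h, Real.sign_of_neg (by linarith)]; simp only [stableW, abs_neg]; ring
  · simp [oddKernel]
  · rw [oddKernel, oddKernel, Real.sign_of_neg h, Real.sign_of_pos (by linarith)]; simp only [stableW, abs_neg]; ring

lemma abs_mul_realSign (x : ℝ) : |x| * Real.sign x = x := by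
  rcases lt_trichotomy 0 x with h | rfl | h
  · rw [Real.sign_of_pos h, abs_of_pos h, mul_one]
  · simp
  · rw [Real.sign_of_neg h, abs_of_neg h]; ring

lemma oddKernel_one (x : ℝ) : oddKernel 1 x = -(2 / Real.pi) * (x * Real.log x) := by
  rw [oddKernel, stableW, if_pos rfl, Real.rpow_one, ← mul_assoc, abs_mul_realSign, Real.log_abs]; ring

lemma oddKernel_of_ne_one {α : ℝ} (h0 : 0 < α) (hα : α ≠ 1) (x : ℝ) :
    oddKernel α x = Real.tan (Real.pi * α / 2) * (posRpow α x - posRpow α (-x)) := by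
  rw [← sign_mul_abs_rpow_eq_posRpow h0, oddKernel, stableW, if_neg hα]; ring

lemma continuous_oddKernel {α : ℝ} (h0 : 0 < α) (h2 : α < 2) : Continuous (oddKernel α) := by
  by_cases hα : α = 1
  · subst hα
    simp_rw [funext oddKernel_one]
    exact Real.continuous_mul_log.const_mul _
  · rw [funext (oddKernel_of_ne_one h0 hα)]
    have := (isHomogeneousLike_posRpow h0 h2).continuous
    fun_prop

lemma continuous_stableKernel {α : ℝ} (h0 : 0 < α) (h2 : α < 2) : Continuous (stableKernel α) := by
  have h := continuous_oddKernel h0 h2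
  have h' : Continuous fun x : ℝ => |x| ^ α := continuous_abs.rpow_const fun _ => Or.inr h0.le
  simp_rw [funext (stableKernel_eq α)]
  fun_prop

/-- For α = 1 the logarithm breaks homogeneity by a term linear in x. This defect is the source of
every shift vector below. -/
lemma oddKernel_mul (α : ℝ) {c : ℝ} (hc : 0 < c) (x : ℝ) :
    oddKernel α (c * x) = c ^ α * oddKernel α x -
      if α = 1 then 2 / Real.pi * (c * Real.log c) * x else 0 := by
  split_ifs with hα
  · subst hα
    rw [oddKernel_one, oddKernel_one, Real.rpow_one]
    rcases eq_or_ne x 0 with rfl | hx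
    · simp
    · rw [Real.log_mul hc.ne' hx]; ring
  · have hs : Real.sign (c * x) = Real.sign x := by
      rcases lt_trichotomy 0 x with h | rfl | h
      · rw [Real.sign_of_pos h, Real.sign_of_pos (mul_pos hc h)]
      · simp
      · rw [Real.sign_of_neg h, Real.sign_of_neg (mul_neg_of_pos_of_neg hc h)]
    rw [oddKernel, oddKernel, hs, abs_mul, abs_of_pos hc, Real.mul_rpow hc.le (abs_nonneg x)]
    simp only [stableW, if_neg hα]
    ring

lemma integral_stableKernel {X : Type*} [MeasurableSpace X] {Γ : Measure X} {α : ℝ} {f : X → ℝ}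
    (h1 : Integrable (fun s => |f s| ^ α) Γ) (h2 : Integrable (fun s => oddKernel α (f s)) Γ) :
    ∫ s, stableKernel α (f s) ∂Γ =
      ((∫ s, |f s| ^ α ∂Γ : ℝ) : ℂ) - Complex.I * ((∫ s, oddKernel α (f s) ∂Γ : ℝ) : ℂ) := by
  simp_rw [stableKernel_eq]
  rw [integral_sub h1.ofReal (h2.ofReal.const_mul _), integral_const_mul, integral_complex_ofReal,
    integral_complex_ofReal]

/-- All values of f on the half-line are multiples of 2π. A nonzero one would force f² to take the
value π² in between, where the exponential equals -1. -/
lemma eq_zero_of_exp_eq_one {f : ℝ → ℝ} (hf : Continuous f) (h0 : f 0 = 0)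
    (h : ∀ t, 0 ≤ t → Complex.exp (Complex.I * f t) = 1) {t : ℝ} (ht : 0 ≤ t) : f t = 0 := by
  obtain ⟨n, hn⟩ := Complex.exp_eq_one_iff.1 (h t ht)
  have hn' : f t = n * (2 * Real.pi) := by
    have : Complex.I * (f t : ℂ) = Complex.I * ((n * (2 * Real.pi) : ℝ) : ℂ) := by
      rw [hn]; push_cast; ring
    exact_mod_cast mul_left_cancel₀ Complex.I_ne_zero this
  by_contra hne
  have hn0 : n ≠ 0 := fun h => hne (by rw [hn', h]; simp)
  have h1 : (1 : ℝ) ≤ (n : ℝ) ^ 2 := by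
    have := Int.one_le_abs hn0
    rw [← sq_abs]
    have : (1 : ℝ) ≤ |(n : ℝ)| := by exact_mod_cast this
    nlinarith
  have hpi := Real.pi_pos
  have hmem : Real.pi ^ 2 ∈ Set.Icc (f 0 ^ 2) (f t ^ 2) := by
    rw [h0, hn']
    exact ⟨by simpa using sq_nonneg Real.pi, by nlinarith [mul_le_mul_of_nonneg_right h1 (sq_nonneg Real.pi)]⟩
  obtain ⟨t', ht', he⟩ := intermediate_value_Icc ht (f := fun x => f x ^ 2)
    (by fun_prop) hmem
  have hcos := congrArg Complex.re (h t' ht'.1)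
  rw [mul_comm, Complex.exp_ofReal_mul_I_re] at hcos
  rcases sq_eq_sq_iff_eq_or_eq_neg.1 he with h | h <;> rw [h] at hcos <;> norm_num at hcos

section Sphere

variable {E : Type*} [NormedAddCommGroup E] [InnerProductSpace ℝ E] [FiniteDimensional ℝ E]
  [MeasurableSpace E] [BorelSpace E] {α : ℝ} {Γ Γ₁ Γ₂ : Measure E}

lemma integrable_oddKernel_inner [IsFiniteMeasure Γ] (hΓ : ∀ᵐ s ∂Γ, ‖s‖ = 1) (h0 : 0 < α)
    (h2 : α < 2) (u : E) : Integrable (fun s => oddKernel α (inner ℝ u s)) Γ := by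
  by_cases hα : α = 1
  · subst hα
    simp_rw [oddKernel_one]
    exact (isHomogeneousLike_mul_log.integrable_inner hΓ u).const_mul _
  · simp_rw [oddKernel_of_ne_one h0 hα]
    exact ((integrable_posRpow_inner hΓ h0 h2 u).sub
      (integrable_posRpow_neg_inner hΓ h0 h2 u)).const_mul _

lemma integrable_inner_of_sphere [IsFiniteMeasure Γ] (hΓ : ∀ᵐ s ∂Γ, ‖s‖ = 1) (u : E) :
    Integrable (fun s => inner ℝ u s) Γ := by
  simpa using integrable_inner_pow hΓ u 1

/-- The exponents of two spectral representations on the sphere agree. -/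
lemma exponent_eq [IsFiniteMeasure Γ₁] [IsFiniteMeasure Γ₂]
    (h₁ : ∀ᵐ s ∂Γ₁, ‖s‖ = 1) (h₂ : ∀ᵐ s ∂Γ₂, ‖s‖ = 1) (h0 : 0 < α) (h2 : α < 2) (v₁ v₂ : E)
    (h : ∀ u : E, Complex.exp (-(∫ s, stableKernel α (inner ℝ u s) ∂Γ₁) +
        Complex.I * ((inner ℝ u v₁ : ℝ) : ℂ)) =
      Complex.exp (-(∫ s, stableKernel α (inner ℝ u s) ∂Γ₂) +
        Complex.I * ((inner ℝ u v₂ : ℝ) : ℂ))) :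
    (∀ u : E, ∫ s, |inner ℝ u s| ^ α ∂Γ₁ = ∫ s, |inner ℝ u s| ^ α ∂Γ₂) ∧
    ∀ (u : E) (t : ℝ), 0 ≤ t →
      t ^ α * (∫ s, oddKernel α (inner ℝ u s) ∂Γ₁ - ∫ s, oddKernel α (inner ℝ u s) ∂Γ₂) -
        (if α = 1 then 2 / Real.pi * (t * Real.log t) *
          (∫ s, inner ℝ u s ∂Γ₁ - ∫ s, inner ℝ u s ∂Γ₂) else 0) + t * inner ℝ u (v₁ - v₂) = 0 := by
  have e : ∀ (Γ : Measure E) [IsFiniteMeasure Γ] (hΓ : ∀ᵐ s ∂Γ, ‖s‖ = 1) (v u : E),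
      -(∫ s, stableKernel α (inner ℝ u s) ∂Γ) + Complex.I * ((inner ℝ u v : ℝ) : ℂ) =
        ((-∫ s, |inner ℝ u s| ^ α ∂Γ : ℝ) : ℂ) +
          ((∫ s, oddKernel α (inner ℝ u s) ∂Γ + inner ℝ u v : ℝ) : ℂ) * Complex.I := by
    intro Γ _ hΓ v u
    rw [integral_stableKernel (integrable_abs_inner_rpow hΓ h0 h2 u)
      (integrable_oddKernel_inner hΓ h0 h2 u)]
    push_cast; ring
  have hre : ∀ u : E, ∫ s, |inner ℝ u s| ^ α ∂Γ₁ = ∫ s, |inner ℝ u s| ^ α ∂Γ₂ := fun u => by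
    have := congrArg norm (h u)
    rw [e Γ₁ h₁, e Γ₂ h₂, Complex.norm_exp, Complex.norm_exp, Real.exp_eq_exp] at this
    simpa using this
  refine ⟨hre, fun u t ht => ?_⟩
  set b := ∫ s, oddKernel α (inner ℝ u s) ∂Γ₁ - ∫ s, oddKernel α (inner ℝ u s) ∂Γ₂ with hb
  set c := ∫ s, inner ℝ u s ∂Γ₁ - ∫ s, inner ℝ u s ∂Γ₂ with hc
  -- At the points t • u the imaginary parts agree modulo 2π, and their difference is continuous in
  -- t and vanishes at t = 0; no branch of the logarithm is needed.
  refine eq_zero_of_exp_eq_one (f := fun t => t ^ α * b -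
    (if α = 1 then 2 / Real.pi * (t * Real.log t) * c else 0) + t * inner ℝ u (v₁ - v₂))
    ?_ ?_ ?_ ht
  · have h3 : Continuous fun t : ℝ => t ^ α := Real.continuous_rpow_const h0.le
    have h4 := Real.continuous_mul_log
    split_ifs <;> fun_prop
  · simp [Real.zero_rpow h0.ne']
  · intro t ht
    rcases ht.eq_or_lt with rfl | ht
    · simp [Real.zero_rpow h0.ne']
    have hsc : ∀ (Γ : Measure E) [IsFiniteMeasure Γ] (hΓ : ∀ᵐ s ∂Γ, ‖s‖ = 1),
        ∫ s, oddKernel α (inner ℝ (t • u) s) ∂Γ = t ^ α * (∫ s, oddKernel α (inner ℝ u s) ∂Γ) -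
          if α = 1 then 2 / Real.pi * (t * Real.log t) * (∫ s, inner ℝ u s ∂Γ) else 0 := by
      intro Γ _ hΓ
      simp_rw [real_inner_smul_left, oddKernel_mul α ht]
      split_ifs
      · rw [integral_sub ((integrable_oddKernel_inner hΓ h0 h2 u).const_mul _)
          ((integrable_inner_of_sphere hΓ u).const_mul _), integral_const_mul, integral_const_mul]
      · simp only [sub_zero]
        rw [integral_const_mul]
    have := h (t • u)
    rw [e Γ₁ h₁, e Γ₂ h₂, Complex.exp_add, Complex.exp_add, hre,
      mul_right_inj' (Complex.exp_ne_zero _), hsc Γ₁ h₁, hsc Γ₂ h₂, Complex.exp_eq_exp_iff_exists_int] at this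
    obtain ⟨n, hn⟩ := this
    rw [Complex.exp_eq_one_iff]
    refine ⟨n, ?_⟩
    rw [← sub_eq_iff_eq_add'] at hn
    rw [← hn, hb, hc, inner_sub_right, real_inner_smul_left, real_inner_smul_left]
    split_ifs <;> push_cast <;> ring

/-- Uniqueness of the spectral representation on the unit sphere. -/
theorem spectralMeasure_unique [IsFiniteMeasure Γ₁] [IsFiniteMeasure Γ₂]
    (h₁ : ∀ᵐ s ∂Γ₁, ‖s‖ = 1) (h₂ : ∀ᵐ s ∂Γ₂, ‖s‖ = 1) (h0 : 0 < α) (h2 : α < 2) (v₁ v₂ : E)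
    (h : ∀ u : E, Complex.exp (-(∫ s, stableKernel α (inner ℝ u s) ∂Γ₁) +
        Complex.I * ((inner ℝ u v₁ : ℝ) : ℂ)) =
      Complex.exp (-(∫ s, stableKernel α (inner ℝ u s) ∂Γ₂) +
        Complex.I * ((inner ℝ u v₂ : ℝ) : ℂ))) : Γ₁ = Γ₂ := by
  obtain ⟨hre, him⟩ := exponent_eq h₁ h₂ h0 h2 v₁ v₂ h
  by_cases hα : α = 1
  · subst hα
    -- The factor π/2 undoes the normalization -(2/π) x ln|x| of the odd kernel.
    refine ext_of_integral_mul_log h₁ h₂ ((Real.pi / 2) • (v₁ - v₂)) hre fun u => ?_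
    have := him u 1 zero_le_one
    simp only [oddKernel_one, integral_const_mul, Real.one_rpow, Real.log_one] at this
    rw [inner_smul_right]
    have hpi := Real.pi_ne_zero
    field_simp at this
    simp at this
    linarith
  · refine ext_of_integral_posRpow h₁ h₂ h0 h2 hα fun u => ?_
    -- The odd part scales like t^α and the shift like t. For α ≠ 1 the values t = 1 and t = 2
    -- separate them.
    have e1 := him u 1 zero_le_one
    have e2 := him u 2 zero_le_two
    rw [if_neg hα] at e1 e2
    rw [Real.one_rpow] at e1
    have hpow : (2 : ℝ) ^ α - 2 ≠ 0 := by
      rw [sub_ne_zero]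
      intro he
      have : (2 : ℝ) ^ α = 2 ^ (1 : ℝ) := by rw [he, Real.rpow_one]
      exact hα (Real.rpow_right_inj two_pos (by norm_num) |>.1 this)
    have hz : ((2 : ℝ) ^ α - 2) * (∫ s, oddKernel α (inner ℝ u s) ∂Γ₁ -
        ∫ s, oddKernel α (inner ℝ u s) ∂Γ₂) = 0 := by linarith
    rw [mul_eq_zero, or_iff_right hpow] at hz
    have htan : Real.tan (Real.pi * α / 2) ≠ 0 := by
      rw [Real.tan_eq_sin_div_cos]
      have hpi := Real.pi_pos
      refine div_ne_zero (Real.sin_pos_of_pos_of_lt_pi (by positivity) (by nlinarith)).ne' ?_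
      intro hc
      obtain ⟨k, hk⟩ := Real.cos_eq_zero_iff.1 hc
      have hk' : α = 2 * k + 1 := by
        have : Real.pi * α = Real.pi * (2 * k + 1) := by linarith
        exact mul_left_cancel₀ hpi.ne' this
      have k1 : (-1 : ℤ) < k := by
        have : (-1 : ℝ) < k := by linarith
        exact_mod_cast this
      have k2 : k < 1 := by
        have : (k : ℝ) < 1 := by linarith
        exact_mod_cast this
      obtain rfl : k = 0 := by omega
      simp at hk'; exact hα hk'
    -- The transforms of (x⁺)^α + (x⁻)^α and, since the tangent is nonzero, of (x⁺)^α - (x⁻)^α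
    -- agree, hence so do those of (x⁺)^α.
    have hr := hre u
    simp_rw [oddKernel_of_ne_one h0 hα, integral_const_mul] at hz
    simp_rw [abs_rpow_eq_posRpow h0] at hr
    have p₁ := integrable_posRpow_inner h₁ h0 h2 u
    have p₂ := integrable_posRpow_inner h₂ h0 h2 u
    have n₁ := integrable_posRpow_neg_inner h₁ h0 h2 u
    have n₂ := integrable_posRpow_neg_inner h₂ h0 h2 u
    rw [integral_add p₁ n₁, integral_add p₂ n₂] at hr
    rw [integral_sub p₁ n₁, integral_sub p₂ n₂, ← mul_sub, mul_eq_zero, or_iff_right htan] at hz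
    linarith

/-- After cancelling exp(A u), the factors left are the characteristic functions of the Dirac masses
at the two vectors. -/
lemma shift_unique (A : E → ℂ) (v₁ v₂ : E)
    (h : ∀ u : E, Complex.exp (A u + Complex.I * ((inner ℝ u v₁ : ℝ) : ℂ)) =
      Complex.exp (A u + Complex.I * ((inner ℝ u v₂ : ℝ) : ℂ))) : v₁ = v₂ := by
  have : Measure.dirac v₁ = Measure.dirac v₂ := by
    refine Measure.ext_of_charFun (funext fun u => ?_)
    have := h u
    rw [Complex.exp_add, Complex.exp_add, mul_right_inj' (Complex.exp_ne_zero _)] at this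
    rw [charFun_dirac, charFun_dirac, real_inner_comm, real_inner_comm u, mul_comm, this, mul_comm]
  exact dirac_eq_dirac_iff.1 this

end Sphere

/-! ### Transport of spectral measures between unit cylinders -/

section Seminorm

variable {E : Type*} [NormedAddCommGroup E] [InnerProductSpace ℝ E] [FiniteDimensional ℝ E]

lemma Seminorm.exists_le_mul_norm (p : Seminorm ℝ E) : ∃ C, 0 ≤ C ∧ ∀ x, p x ≤ C * ‖x‖ := by
  set b := stdOrthonormalBasis ℝ E
  refine ⟨∑ i, p (b i), Finset.sum_nonneg fun i _ => apply_nonneg _ _, fun x => ?_⟩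
  calc p x = p (∑ i, inner ℝ (b i) x • b i) := by rw [b.sum_repr']
    _ ≤ ∑ i, p (inner ℝ (b i) x • b i) := 
        Finset.le_sum_of_subadditive p (map_zero p).le (map_add_le_add p) _ _
    _ ≤ ∑ i, p (b i) * ‖x‖ := by
        refine Finset.sum_le_sum fun i _ => ?_
        rw [map_smul_eq_mul, mul_comm]
        refine mul_le_mul_of_nonneg_left ?_ (apply_nonneg _ _)
        simpa using abs_real_inner_le_norm (b i) x
    _ = _ := by rw [Finset.sum_mul]

lemma Seminorm.continuous_of_finiteDimensional (p : Seminorm ℝ E) : Continuous p := by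
  obtain ⟨C, hC, h⟩ := p.exists_le_mul_norm
  refine Seminorm.continuous_of_le (q := (NNReal.mk C hC) • normSeminorm ℝ E) ?_ fun x => ?_
  · change Continuous fun x => C * ‖x‖
    fun_prop
  · exact h x

end Seminorm

/-- The image of `p(s)^α Γ(ds)` under the radial projection `s ↦ s / p(s)` to the unit cylinder of
the seminorm `p`. -/
def cylinderMeasure {E : Type*} [NormedAddCommGroup E] [NormedSpace ℝ E] [MeasurableSpace E]
    (α : ℝ) (p : Seminorm ℝ E) (Γ : Measure E) : Measure E :=
  (Γ.withDensity fun s => ENNReal.ofReal (p s ^ α)).map fun s => (p s)⁻¹ • s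

lemma seminorm_radial {E : Type*} [NormedAddCommGroup E] [NormedSpace ℝ E] {p : Seminorm ℝ E}
    {s : E} (h : p s ≠ 0) : p ((p s)⁻¹ • s) = 1 := by
  rw [map_smul_eq_mul, norm_inv, Real.norm_of_nonneg (apply_nonneg p s), inv_mul_cancel₀ h]

section Cylinder

variable {E : Type*} [NormedAddCommGroup E] [InnerProductSpace ℝ E] [FiniteDimensional ℝ E]
  [MeasurableSpace E] [BorelSpace E] {α : ℝ} {p : Seminorm ℝ E} {Γ : Measure E}

@[fun_prop]
lemma Seminorm.measurable_of_finiteDimensional (p : Seminorm ℝ E) : Measurable p :=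
  p.continuous_of_finiteDimensional.measurable

lemma measurable_radial (p : Seminorm ℝ E) : Measurable fun s => (p s)⁻¹ • s :=
  p.measurable_of_finiteDimensional.inv.smul measurable_id

lemma measurable_density (α : ℝ) (p : Seminorm ℝ E) :
    Measurable fun s => ENNReal.ofReal (p s ^ α) :=
  (p.measurable_of_finiteDimensional.pow_const α).ennreal_ofReal

lemma lintegral_cylinderMeasure {f : E → ENNReal} (hf : Measurable f) :
    ∫⁻ s, f s ∂(cylinderMeasure α p Γ) =
      ∫⁻ s, ENNReal.ofReal (p s ^ α) * f ((p s)⁻¹ • s) ∂Γ := by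
  rw [cylinderMeasure, lintegral_map hf (measurable_radial p)]
  exact lintegral_withDensity_eq_lintegral_mul _ (measurable_density α p)
    (hf.comp (measurable_radial p))

lemma measurable_density_mul_radial {f : E → ENNReal} (hf : Measurable f) :
    Measurable fun s => ENNReal.ofReal (p s ^ α) * f ((p s)⁻¹ • s) :=
  (measurable_density α p).mul (hf.comp (measurable_radial p))

lemma integrable_cylinderMeasure {F : Type*} [NormedAddCommGroup F] [NormedSpace ℝ F]
    [SecondCountableTopology F] [MeasurableSpace F] [BorelSpace F] {f : E → F}
    (hf : Measurable f) :
    Integrable f (cylinderMeasure α p Γ) ↔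
      Integrable (fun s => (p s ^ α) • f ((p s)⁻¹ • s)) Γ := by
  rw [cylinderMeasure, integrable_map_measure hf.aestronglyMeasurable
    (measurable_radial p).aemeasurable, integrable_withDensity_iff_integrable_smul'
    (measurable_density α p) (by simp)]
  simp_rw [ENNReal.toReal_ofReal (Real.rpow_nonneg (apply_nonneg p _) α)]
  rfl

lemma integral_cylinderMeasure {F : Type*} [NormedAddCommGroup F] [NormedSpace ℝ F]
    [SecondCountableTopology F] [MeasurableSpace F] [BorelSpace F] {f : E → F}
    (hf : Measurable f) :
    ∫ s, f s ∂(cylinderMeasure α p Γ) = ∫ s, (p s ^ α) • f ((p s)⁻¹ • s) ∂Γ := by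
  rw [cylinderMeasure, integral_map (measurable_radial p).aemeasurable hf.aestronglyMeasurable,
    integral_withDensity_eq_integral_toReal_smul (measurable_density α p) (by simp)]
  simp_rw [ENNReal.toReal_ofReal (Real.rpow_nonneg (apply_nonneg p _) α)]

lemma ae_cylinderMeasure_iff (hα : 0 < α) {P : E → Prop} (hP : MeasurableSet {s | P s}) :
    (∀ᵐ s ∂(cylinderMeasure α p Γ), P s) ↔ ∀ᵐ s ∂Γ, p s ≠ 0 → P ((p s)⁻¹ • s) := by
  rw [cylinderMeasure, ae_map_iff (measurable_radial p).aemeasurable hP,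
    ae_withDensity_iff (measurable_density α p)]
  refine Filter.eventually_congr (ae_of_all _ fun s => ?_)
  rw [Ne, ENNReal.ofReal_eq_zero, not_le]
  refine imp_congr_left ⟨fun h h0 => ?_, fun h => ?_⟩
  · rw [h0, Real.zero_rpow hα.ne'] at h; exact h.false
  · exact Real.rpow_pos_of_pos (lt_of_le_of_ne (apply_nonneg p s) (Ne.symm h)) α

lemma ae_cylinderMeasure (hα : 0 < α) : ∀ᵐ s ∂(cylinderMeasure α p Γ), p s = 1 := by
  rw [ae_cylinderMeasure_iff hα
    (measurableSet_eq_fun p.measurable_of_finiteDimensional measurable_const)]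
  exact ae_of_all _ fun s h => seminorm_radial h

lemma cylinderMeasure_self (h : ∀ᵐ s ∂Γ, p s = 1) : cylinderMeasure α p Γ = Γ := by
  refine Measure.ext_of_lintegral _ fun f hf => ?_
  rw [lintegral_cylinderMeasure hf]
  refine lintegral_congr_ae ?_
  filter_upwards [h] with s hs
  simp [hs]

/-- Radial projection to the cylinder factors through the sphere, and the weights multiply
correctly: ‖s‖^α p(s/‖s‖)^α = p(s)^α. A cylinder measure is therefore a function of the spherical
one. -/
lemma cylinderMeasure_norm (hα : 0 < α) :
    cylinderMeasure α p (cylinderMeasure α (normSeminorm ℝ E) Γ) = cylinderMeasure α p Γ := by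
  refine Measure.ext_of_lintegral _ fun f hf => ?_
  rw [lintegral_cylinderMeasure hf, lintegral_cylinderMeasure hf, lintegral_cylinderMeasure
    (measurable_density_mul_radial hf)]
  refine lintegral_congr fun s => ?_
  rcases eq_or_ne s 0 with rfl | hs
  · simp [Real.zero_rpow hα.ne']
  have hn : 0 < ‖s‖ := norm_pos_iff.2 hs
  rw [coe_normSeminorm, map_smul_eq_mul, norm_inv, norm_norm, ← mul_assoc,
    ← ENNReal.ofReal_mul (by positivity),
    Real.mul_rpow (by positivity) (apply_nonneg p s), ← mul_assoc, ← Real.mul_rpow (by positivity)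
    (by positivity), mul_inv_cancel₀ hn.ne', Real.one_rpow, one_mul]
  congr 2
  rw [smul_smul, mul_inv, inv_inv, mul_comm ‖s‖, mul_assoc, mul_inv_cancel₀ hn.ne', mul_one]

lemma cylinderMeasure_map_neg :
    (cylinderMeasure α p Γ).map (fun s => -s) = cylinderMeasure α p (Γ.map fun s => -s) := by
  refine Measure.ext_of_lintegral _ fun f hf => ?_
  have hf' : Measurable fun s => f (-s) := hf.comp measurable_neg
  rw [lintegral_map hf measurable_neg, lintegral_cylinderMeasure hf', lintegral_cylinderMeasure hf,
    lintegral_map (measurable_density_mul_radial hf) measurable_neg]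
  simp [map_neg_eq_map]

end Cylinder

/-! ### Integrability -/

/-- With r = x/y ≤ K one has x ln x = y · r ln r + x ln y, and r |ln r| ≤ 1 + r². This compares the
logarithmic integrability of ‖s‖ with that of the scalar products. -/
lemma mul_abs_log_le {x y K : ℝ} (hx : 0 ≤ x) (hy : 0 ≤ y) (h : x ≤ K * y) :
    x * |Real.log x| ≤ (1 + K ^ 2) * y + K * (y * |Real.log y|) := by
  rcases hy.eq_or_lt with rfl | hy
  · obtain rfl : x = 0 := by linarith
    simp
  rcases hx.eq_or_lt with rfl | hx
  · have : 0 ≤ K := nonneg_of_mul_nonneg_left (by simpa using h) hy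
    simp only [zero_mul]
    positivity
  have hr : 0 < x / y := by positivity
  have hrK : x / y ≤ K := (div_le_iff₀ hy).2 h
  have h1 := abs_mul_log_le (x / y)
  rw [abs_mul, abs_of_pos hr] at h1
  have h2 : x / y * |Real.log (x / y)| ≤ 1 + K ^ 2 := h1.trans (by gcongr)
  have h3 : Real.log x = Real.log (x / y) + Real.log y := by
    rw [← Real.log_mul hr.ne' hy.ne', div_mul_cancel₀ _ hy.ne']
  calc x * |Real.log x| ≤ x * (|Real.log (x / y)| + |Real.log y|) := by
        rw [h3]; gcongr; exact abs_add_le _ _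
    _ = x / y * |Real.log (x / y)| * y + x * |Real.log y| := by field_simp
    _ ≤ (1 + K ^ 2) * y + K * y * |Real.log y| := by gcongr
    _ = _ := by ring

lemma abs_mul_log (x : ℝ) : |x * Real.log x| = |x| * |Real.log (|x|)| := by
  rw [abs_mul, Real.log_abs]

lemma exists_norm_le_inner {ι E : Type*} [Fintype ι] [NormedAddCommGroup E]
    [InnerProductSpace ℝ E] (b : OrthonormalBasis ι ℝ E) (s : E) (hs : s ≠ 0) :
    ∃ i, ‖s‖ ≤ Fintype.card ι * |inner ℝ (b i) s| := by
  have h1 : ‖s‖ ≤ ∑ i, |inner ℝ (b i) s| := by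
    calc ‖s‖ = ‖∑ i, inner ℝ (b i) s • b i‖ := by rw [b.sum_repr']
      _ ≤ ∑ i, ‖inner ℝ (b i) s • b i‖ := norm_sum_le _ _
      _ = _ := by simp [norm_smul]
  by_contra! hc
  have hn := norm_pos_iff.2 hs
  rcases isEmpty_or_nonempty ι with h | h
  · simp at h1; exact hs h1
  have h2 := Finset.sum_lt_sum_of_nonempty Finset.univ_nonempty fun i _ => hc i
  rw [← Finset.mul_sum] at h2
  simp only [Finset.sum_const, Finset.card_univ, nsmul_eq_mul] at h2
  have := lt_of_mul_lt_mul_left h2 (Nat.cast_nonneg _)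
  linarith

section Integrability

variable {E : Type*} [NormedAddCommGroup E] [InnerProductSpace ℝ E] [FiniteDimensional ℝ E]
  [MeasurableSpace E] [BorelSpace E] {α : ℝ} {p : Seminorm ℝ E} {Γ : Measure E}

/-- The integrability conditions that make the stable exponent of `Γ` converge. -/
structure IsStableExponent (α : ℝ) (Γ : Measure E) : Prop where
  rpow : Integrable (fun s => ‖s‖ ^ α) Γ
  log : α = 1 → Integrable (fun s => ‖s‖ * |Real.log ‖s‖|) Γ

lemma integrable_norm_rpow_of_inner (h0 : 0 < α)
    (h : ∀ u : E, Integrable (fun s => |inner ℝ u s| ^ α) Γ) :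
    Integrable (fun s => ‖s‖ ^ α) Γ := by
  set b := stdOrthonormalBasis ℝ E
  set N : ℝ := (Fintype.card (Fin (Module.finrank ℝ E)) : ℝ)
  refine (integrable_finsetSum Finset.univ fun i _ => (h (b i)).const_mul (N ^ α)).mono'
    (measurable_norm.pow_const α).aestronglyMeasurable (ae_of_all _ fun s => ?_)
  rw [Real.norm_of_nonneg (by positivity)]
  rcases eq_or_ne s 0 with rfl | hs
  · simp [Real.zero_rpow h0.ne']
  obtain ⟨i, hi⟩ := exists_norm_le_inner b s hs
  refine le_trans ?_ (Finset.single_le_sum (f := fun i => N ^ α * |inner ℝ (b i) s| ^ α)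
    (fun i _ => by positivity) (Finset.mem_univ i))
  rw [← Real.mul_rpow (by positivity) (by positivity)]
  exact Real.rpow_le_rpow (norm_nonneg _) hi h0.le

lemma IsStableExponent.of_inner (h0 : 0 < α)
    (h : ∀ u : E, Integrable (fun s => |inner ℝ u s| ^ α) Γ)
    (hl : α = 1 → ∀ u : E, Integrable (fun s => |inner ℝ u s| * |Real.log (|inner ℝ u s|)|) Γ) :
    IsStableExponent α Γ := by
  refine ⟨integrable_norm_rpow_of_inner h0 h, fun hα => ?_⟩
  set b := stdOrthonormalBasis ℝ E
  set N : ℝ := (Fintype.card (Fin (Module.finrank ℝ E)) : ℝ)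
  subst hα
  simp only [Real.rpow_one] at h
  refine (integrable_finsetSum Finset.univ fun i _ => ((h (b i)).const_mul (1 + N ^ 2)).add
    ((hl rfl (b i)).const_mul N)).mono' (by fun_prop) (ae_of_all _ fun s => ?_)
  rw [Real.norm_of_nonneg (by positivity)]
  rcases eq_or_ne s 0 with rfl | hs
  · simp
  obtain ⟨i, hi⟩ := exists_norm_le_inner b s hs
  refine le_trans ?_ (Finset.single_le_sum (f := fun i => (1 + N ^ 2) * |inner ℝ (b i) s| +
    N * (|inner ℝ (b i) s| * |Real.log (|inner ℝ (b i) s|)|)) (fun i _ => by positivity)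
    (Finset.mem_univ i))
  exact mul_abs_log_le (norm_nonneg _) (abs_nonneg _) hi

/-- The integrand |f| |ln|f|| says nothing about |f| near |f| = 1. But ln 2 is the difference of
ln|2f| and ln|f|, so the two hypotheses together control |f|. -/
lemma integrable_abs_of_mul_log {X : Type*} [MeasurableSpace X] {Γ : Measure X} {f : X → ℝ}
    (hf : Measurable f) (h1 : Integrable (fun s => |f s| * |Real.log (|f s|)|) Γ)
    (h2 : Integrable (fun s => |2 * f s| * |Real.log (|2 * f s|)|) Γ) :
    Integrable (fun s => |f s|) Γ := by
  refine ((h2.add h1).const_mul (Real.log 2)⁻¹).mono' (by fun_prop) (ae_of_all _ fun s => ?_)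
  have hl := Real.log_pos one_lt_two
  rw [Real.norm_of_nonneg (abs_nonneg _), le_inv_mul_iff₀ hl, Pi.add_apply]
  rcases eq_or_ne (f s) 0 with h | h
  · simp [h]
  have ha := abs_pos.2 h
  rw [abs_mul, abs_two, Real.log_mul two_ne_zero ha.ne']
  have h3 : Real.log 2 ≤ |Real.log 2 + Real.log (|f s|)| + |Real.log (|f s|)| := by
    have := abs_sub (Real.log 2 + Real.log |f s|) (Real.log |f s|)
    rw [add_sub_cancel_right] at this
    exact (le_abs_self _).trans this
  nlinarith [abs_nonneg (Real.log 2 + Real.log |f s|)]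

namespace IsStableExponent

variable (h : IsStableExponent α Γ)
include h

lemma integrable_abs_rpow (h0 : 0 < α) (u : E) : Integrable (fun s => |inner ℝ u s| ^ α) Γ := by
  have hm : Measurable fun s : E => |inner ℝ u s| := by fun_prop
  refine (h.rpow.const_mul (‖u‖ ^ α)).mono' (hm.pow_const α).aestronglyMeasurable
    (ae_of_all _ fun s => ?_)
  rw [Real.norm_of_nonneg (by positivity), ← Real.mul_rpow (by positivity) (by positivity)]
  exact Real.rpow_le_rpow (abs_nonneg _) (abs_real_inner_le_norm u s) h0.le

lemma integrable_mul_log (hα : α = 1) (u : E) :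
    Integrable (fun s => |inner ℝ u s| * |Real.log (|inner ℝ u s|)|) Γ := by
  have h1 := h.rpow
  have h2 := h.log hα
  subst hα
  simp only [Real.rpow_one] at h1
  refine ((h1.const_mul (1 + ‖u‖ ^ 2)).add (h2.const_mul ‖u‖)).mono' (by fun_prop)
    (ae_of_all _ fun s => ?_)
  rw [Real.norm_of_nonneg (by positivity)]
  exact mul_abs_log_le (abs_nonneg _) (norm_nonneg _) (abs_real_inner_le_norm u s)

lemma integrable_oddKernel (h0 : 0 < α) (h2 : α < 2) (u : E) :
    Integrable (fun s => oddKernel α (inner ℝ u s)) Γ := by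
  have hm : AEStronglyMeasurable (fun s : E => oddKernel α (inner ℝ u s)) Γ := by
    have := continuous_oddKernel h0 h2
    fun_prop
  by_cases hα : α = 1
  · refine ((h.integrable_mul_log hα u).const_mul (2 / Real.pi)).mono' hm
      (ae_of_all _ fun s => ?_)
    subst hα
    rw [oddKernel_one, norm_mul, norm_neg, Real.norm_of_nonneg (by positivity), Real.norm_eq_abs,
      abs_mul_log]
  · refine ((h.integrable_abs_rpow h0 u).const_mul |Real.tan (Real.pi * α / 2)|).mono' hm
      (ae_of_all _ fun s => ?_)
    rw [oddKernel_of_ne_one h0 hα, norm_mul, Real.norm_eq_abs, Real.norm_eq_abs,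
      abs_rpow_eq_posRpow h0]
    gcongr
    have a := posRpow_nonneg α (inner ℝ u s)
    have b := posRpow_nonneg α (-inner ℝ u s)
    rw [abs_le]; constructor <;> linarith

end IsStableExponent

end Integrability

/-! ### Spectral representations on unit cylinders -/

/-- The shift vector produced by moving the spectral measure `Γ` to the unit cylinder of `p`. -/
def cylinderShift {E : Type*} [NormedAddCommGroup E] [NormedSpace ℝ E] [MeasurableSpace E]
    (α : ℝ) (p : Seminorm ℝ E) (Γ : Measure E) : E :=
  if α = 1 then -(2 / Real.pi) • ∫ s, Real.log (p s) • s ∂Γ else 0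

lemma abs_inner_radial_rpow {E : Type*} [NormedAddCommGroup E] [InnerProductSpace ℝ E] {α : ℝ}
    {p : Seminorm ℝ E} {s : E} (hs : p s = 0 → s = 0) (h0 : 0 < α) (u : E) :
    p s ^ α * |inner ℝ u ((p s)⁻¹ • s)| ^ α = |inner ℝ u s| ^ α := by
  rcases eq_or_ne (p s) 0 with h | h
  · simp [hs h, Real.zero_rpow h0.ne']
  have hp := apply_nonneg p s
  rw [real_inner_smul_right, abs_mul, ← Real.mul_rpow hp (by positivity), ← mul_assoc, abs_inv,
    abs_of_nonneg hp, mul_inv_cancel₀ h, one_mul]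

lemma oddKernel_radial {E : Type*} [NormedAddCommGroup E] [InnerProductSpace ℝ E] {α : ℝ}
    {p : Seminorm ℝ E} {s : E} (hs : p s = 0 → s = 0) (h0 : 0 < α) (u : E) :
    p s ^ α * oddKernel α (inner ℝ u ((p s)⁻¹ • s)) = oddKernel α (inner ℝ u s) +
      if α = 1 then 2 / Real.pi * inner ℝ u (Real.log (p s) • s) else 0 := by
  rcases eq_or_ne (p s) 0 with h | h
  · simp [hs h, Real.zero_rpow h0.ne', oddKernel]
  have hp : 0 < p s := lt_of_le_of_ne (apply_nonneg p s) h.symm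
  rw [real_inner_smul_right, oddKernel_mul α (inv_pos.2 hp), mul_sub, ← mul_assoc,
    ← Real.mul_rpow hp.le (by positivity), mul_inv_cancel₀ h, Real.one_rpow, one_mul,
    real_inner_smul_right]
  split_ifs with hα
  · subst hα
    rw [Real.rpow_one, Real.log_inv]
    field_simp
    ring
  · simp

lemma isFiniteMeasure_cylinderMeasure_norm {E : Type*} [NormedAddCommGroup E] [InnerProductSpace ℝ E]
    [MeasurableSpace E] [OpensMeasurableSpace E] {α : ℝ} {Γ : Measure E} (h : Integrable (fun s => ‖s‖ ^ α) Γ) :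
    IsFiniteMeasure (cylinderMeasure α (normSeminorm ℝ E) Γ) := by
  have := isFiniteMeasure_withDensity_ofReal h.hasFiniteIntegral
  simp only [cylinderMeasure, coe_normSeminorm]
  infer_instance

section Change

variable {E : Type*} [NormedAddCommGroup E] [InnerProductSpace ℝ E] [FiniteDimensional ℝ E]
  [MeasurableSpace E] [BorelSpace E] {α : ℝ} {p : Seminorm ℝ E} {Γ : Measure E}

lemma integrable_abs_rpow_cylinderMeasure (h0 : 0 < α) (hN : ∀ᵐ s ∂Γ, p s = 0 → s = 0) (u : E) :
    Integrable (fun s => |inner ℝ u s| ^ α) (cylinderMeasure α p Γ) ↔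
      Integrable (fun s => |inner ℝ u s| ^ α) Γ := by
  rw [integrable_cylinderMeasure ((by fun_prop : Measurable fun s : E => |inner ℝ u s|).pow_const α)]
  refine integrable_congr ?_
  filter_upwards [hN] with s hs
  exact abs_inner_radial_rpow hs h0 u

lemma integral_abs_rpow_cylinderMeasure (h0 : 0 < α) (hN : ∀ᵐ s ∂Γ, p s = 0 → s = 0) (u : E) :
    ∫ s, |inner ℝ u s| ^ α ∂(cylinderMeasure α p Γ) = ∫ s, |inner ℝ u s| ^ α ∂Γ := by
  rw [integral_cylinderMeasure ((by fun_prop : Measurable fun s : E => |inner ℝ u s|).pow_const α)]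
  refine integral_congr_ae ?_
  filter_upwards [hN] with s hs
  exact abs_inner_radial_rpow hs h0 u

/-- Transporting to a cylinder preserves the integrability conditions, provided `ln p` is
integrable if `α = 1`. -/
lemma IsStableExponent.cylinderMeasure (h : IsStableExponent α Γ) (h0 : 0 < α)
    (hN : ∀ᵐ s ∂Γ, p s = 0 → s = 0)
    (hl : α = 1 → Integrable (fun s => ‖s‖ * |Real.log (p s)|) Γ) :
    IsStableExponent α (cylinderMeasure α p Γ) := by
  refine .of_inner h0 (fun u => (integrable_abs_rpow_cylinderMeasure h0 hN u).2
    (h.integrable_abs_rpow h0 u)) fun hα u => ?_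
  have i1 := h.integrable_mul_log hα u
  have i2 := hl hα
  subst hα
  rw [integrable_cylinderMeasure (by fun_prop)]
  refine (i1.add (i2.const_mul ‖u‖)).mono' ?_ ?_
  · have := measurable_radial p
    have := p.measurable_of_finiteDimensional
    fun_prop
  filter_upwards [hN] with s hs
  have e := abs_inner_radial_rpow hs one_pos u
  simp only [Real.rpow_one] at e
  rw [Real.rpow_one, smul_eq_mul, ← mul_assoc, e, Pi.add_apply, norm_mul, Real.norm_eq_abs,
    Real.norm_eq_abs, abs_abs, abs_abs]
  -- The logarithm of the product splits only when both factors are nonzero; on the hyperplane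
  -- orthogonal to u the left side is zero.
  rcases eq_or_ne (inner ℝ u s) 0 with h' | h'
  · simp only [h', abs_zero, zero_mul, zero_add]; positivity
  have hp : p s ≠ 0 := fun h => h' (by rw [hs h, inner_zero_right])
  rw [real_inner_smul_right, abs_mul, Real.log_mul (by simpa using hp) (by simpa using h'),
    abs_inv, abs_of_nonneg (apply_nonneg p s), Real.log_inv]
  calc |inner ℝ u s| * |-Real.log (p s) + Real.log (|inner ℝ u s|)|
      ≤ |inner ℝ u s| * (|Real.log (p s)| + |Real.log (|inner ℝ u s|)|) := by
        gcongr
        simpa using abs_add_le (-Real.log (p s)) (Real.log |inner ℝ u s|)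
    _ ≤ _ := by
        rw [mul_add, add_comm, ← mul_assoc]
        gcongr
        exact abs_real_inner_le_norm u s

lemma integrable_log_smul (hl : Integrable (fun s => ‖s‖ * |Real.log (p s)|) Γ) :
    Integrable (fun s => Real.log (p s) • s) Γ := by
  refine hl.mono' ?_ (ae_of_all _ fun s => ?_)
  · have := p.measurable_of_finiteDimensional
    fun_prop
  · rw [norm_smul, Real.norm_eq_abs, mul_comm]

/-- The stable exponent of `Γ` in terms of its transport to a cylinder. -/
lemma exponent_cylinderMeasure (h : IsStableExponent α Γ) (h0 : 0 < α) (h2 : α < 2)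
    (hN : ∀ᵐ s ∂Γ, p s = 0 → s = 0)
    (hl : α = 1 → Integrable (fun s => ‖s‖ * |Real.log (p s)|) Γ) (u : E) :
    -(∫ s, stableKernel α (inner ℝ u s) ∂Γ) =
      -(∫ s, stableKernel α (inner ℝ u s) ∂(cylinderMeasure α p Γ)) +
        Complex.I * ((inner ℝ u (cylinderShift α p Γ) : ℝ) : ℂ) := by
  have h' := h.cylinderMeasure h0 hN hl
  have hm : Measurable fun s : E => oddKernel α (inner ℝ u s) :=
    ((continuous_oddKernel h0 h2).measurable).comp (by fun_prop)
  have key : ∫ s, oddKernel α (inner ℝ u s) ∂(cylinderMeasure α p Γ) =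
      ∫ s, oddKernel α (inner ℝ u s) ∂Γ - inner ℝ u (cylinderShift α p Γ) := by
    rw [integral_cylinderMeasure hm, cylinderShift]
    have : ∫ s, p s ^ α • oddKernel α (inner ℝ u ((p s)⁻¹ • s)) ∂Γ =
        ∫ s, (oddKernel α (inner ℝ u s) +
          if α = 1 then 2 / Real.pi * inner ℝ u (Real.log (p s) • s) else 0) ∂Γ := by
      refine integral_congr_ae ?_
      filter_upwards [hN] with s hs
      exact oddKernel_radial hs h0 u
    rw [this]
    split_ifs with hα
    · have i := integrable_log_smul (hl hα)
      rw [integral_add (h.integrable_oddKernel h0 h2 u) ((i.const_inner u).const_mul _),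
        integral_const_mul, integral_inner i, inner_smul_right]
      ring
    · simp
  rw [integral_stableKernel (h.integrable_abs_rpow h0 u) (h.integrable_oddKernel h0 h2 u),
    integral_stableKernel (h'.integrable_abs_rpow h0 u) (h'.integrable_oddKernel h0 h2 u), key,
    integral_abs_rpow_cylinderMeasure h0 hN]
  push_cast; ring

lemma ae_cylinderMeasure_norm (h0 : 0 < α) :
    ∀ᵐ s ∂(cylinderMeasure α (normSeminorm ℝ E) Γ), ‖s‖ = 1 := by
  simpa using ae_cylinderMeasure (p := normSeminorm ℝ E) (Γ := Γ) h0

lemma exponent_norm (h : IsStableExponent α Γ) (h0 : 0 < α) (h2 : α < 2) (u : E) :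
    -(∫ s, stableKernel α (inner ℝ u s) ∂Γ) =
      -(∫ s, stableKernel α (inner ℝ u s) ∂(cylinderMeasure α (normSeminorm ℝ E) Γ)) +
        Complex.I * ((inner ℝ u (cylinderShift α (normSeminorm ℝ E) Γ) : ℝ) : ℂ) :=
  exponent_cylinderMeasure h h0 h2 (ae_of_all _ fun s hs => by simpa using hs)
    (by simpa using h.log) u

lemma measurableSet_ne_zero (p : Seminorm ℝ E) : MeasurableSet {s | p s ≠ 0} :=
  (measurableSet_eq_fun p.measurable_of_finiteDimensional measurable_const).compl

/-- If the spherical transport of `M` is carried by `{p ≠ 0}`, then so is `M` off the origin. -/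
lemma ae_seminorm_ne_zero_of_cylinderMeasure (h0 : 0 < α)
    (h : ∀ᵐ s ∂(cylinderMeasure α (normSeminorm ℝ E) Γ), p s ≠ 0) :
    ∀ᵐ s ∂Γ, p s = 0 → s = 0 := by
  rw [ae_cylinderMeasure_iff h0 (measurableSet_ne_zero p)] at h
  filter_upwards [h] with s hs hp
  by_contra hne
  refine hs (by simpa using hne) ?_
  rw [map_smul_eq_mul, hp, mul_zero]

lemma cylinderMeasure_norm_ae_ne_zero (h0 : 0 < α) (h : ∀ᵐ s ∂Γ, p s = 1) :
    ∀ᵐ s ∂(cylinderMeasure α (normSeminorm ℝ E) Γ), p s ≠ 0 := by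
  rw [ae_cylinderMeasure_iff h0 (measurableSet_ne_zero p)]
  filter_upwards [h] with s hs hn
  rw [map_smul_eq_mul, hs, mul_one]
  simpa using hn

/-- If the transport of `Γ` satisfies the integrability conditions, then `ln p` is integrable. -/
lemma IsStableExponent.integrable_log (h : IsStableExponent 1 Γ)
    (hN : ∀ᵐ s ∂Γ, p s = 0 → s = 0) (h' : IsStableExponent 1 (_root_.cylinderMeasure 1 p Γ)) :
    Integrable (fun s => ‖s‖ * |Real.log (p s)|) Γ := by
  have i := h'.log rfl
  rw [integrable_cylinderMeasure (by fun_prop)] at i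
  refine (i.add (h.log rfl)).mono' ?_ ?_
  · have := p.measurable_of_finiteDimensional
    fun_prop
  filter_upwards [hN] with s hs
  rw [Real.norm_of_nonneg (by positivity), Pi.add_apply, Real.rpow_one, smul_eq_mul, norm_smul]
  rcases eq_or_ne (p s) 0 with h | h
  · simp [hs h]
  have hp := apply_nonneg p s
  have hs0 : ‖s‖ ≠ 0 := by
    rw [norm_ne_zero_iff]; rintro rfl; simp at h
  rw [norm_inv, Real.norm_of_nonneg hp, ← mul_assoc, ← mul_assoc, mul_inv_cancel₀ h, one_mul,
    Real.log_mul (inv_ne_zero h) hs0, Real.log_inv, ← mul_add]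
  gcongr
  have := abs_sub (Real.log ‖s‖) (-Real.log (p s) + Real.log ‖s‖)
  rw [show Real.log ‖s‖ - (-Real.log (p s) + Real.log ‖s‖) = Real.log (p s) by ring] at this
  linarith

lemma integral_stableKernel_of_symm (h : IsStableExponent α Γ) (h0 : 0 < α) (h2 : α < 2)
    (hs : Γ.map (fun s => -s) = Γ) (u : E) :
    ∫ s, stableKernel α (inner ℝ u s) ∂Γ = ((∫ s, |inner ℝ u s| ^ α ∂Γ : ℝ) : ℂ) := by
  have hm : Measurable fun s : E => oddKernel α (inner ℝ u s) :=
    ((continuous_oddKernel h0 h2).measurable).comp (by fun_prop)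
  have : ∫ s, oddKernel α (inner ℝ u s) ∂Γ = -∫ s, oddKernel α (inner ℝ u s) ∂Γ := by
    conv_lhs => rw [← hs, integral_map (by fun_prop) hm.aestronglyMeasurable]
    simp_rw [inner_neg_right, oddKernel_neg, integral_neg]
  have h0' : ∫ s, oddKernel α (inner ℝ u s) ∂Γ = 0 := by linarith
  rw [integral_stableKernel (h.integrable_abs_rpow h0 u) (h.integrable_oddKernel h0 h2 u), h0']
  simp

end Change

/-! ### Spectral representations of a law with a given stable exponent -/

section Representation

variable {d : ℕ} {α : ℝ} {ν : Measure (EuclideanSpace ℝ (Fin d))}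
  {M Γ : Measure (EuclideanSpace ℝ (Fin d))} {p : Seminorm ℝ (EuclideanSpace ℝ (Fin d))}
  {μ : EuclideanSpace ℝ (Fin d)}

/-- `ν` is the strictly stable law with exponent `∫ stableKernel α ⟨u, s⟩ M(ds)`. -/
structure HasStableExponent (α : ℝ) (ν M : Measure (EuclideanSpace ℝ (Fin d))) : Prop where
  pos : 0 < α
  lt_two : α < 2
  exponent : IsStableExponent α M
  charFun_eq : ∀ u, charFun ν u = Complex.exp (-(∫ s, stableKernel α (inner ℝ u s) ∂M))

namespace HasStableExponent

variable (h : HasStableExponent α ν M)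
include h

lemma norm_charFun (u : EuclideanSpace ℝ (Fin d)) :
    ‖charFun ν u‖ = Real.exp (-∫ s, |inner ℝ u s| ^ α ∂M) := by
  rw [h.charFun_eq, Complex.norm_exp, integral_stableKernel (h.exponent.integrable_abs_rpow h.pos u)
    (h.exponent.integrable_oddKernel h.pos h.lt_two u)]
  simp

lemma charFun_eq_norm (u : EuclideanSpace ℝ (Fin d)) : charFun ν u = Complex.exp
    (-(∫ s, stableKernel α (inner ℝ u s) ∂(cylinderMeasure α (normSeminorm ℝ _) M)) +
      Complex.I * ((inner ℝ u (cylinderShift α (normSeminorm ℝ _) M) : ℝ) : ℂ)) := by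
  rw [h.charFun_eq, exponent_norm h.exponent h.pos h.lt_two]

/-- On the Euclidean sphere the logarithmic condition is part of `IsStableExponent`, so both
measures can always be transported there. The resulting shifts are absorbed into the linear term and
`spectralMeasure_unique` applies. -/
lemma cylinderMeasure_norm_eq (hΓ : IsStableExponent α Γ)
    (hc : ∀ u, charFun ν u = Complex.exp (-(∫ s, stableKernel α (inner ℝ u s) ∂Γ) +
        Complex.I * ((inner ℝ u μ : ℝ) : ℂ))) :
    cylinderMeasure α (normSeminorm ℝ _) Γ = cylinderMeasure α (normSeminorm ℝ _) M := by
  have := isFiniteMeasure_cylinderMeasure_norm hΓ.rpow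
  have := isFiniteMeasure_cylinderMeasure_norm h.exponent.rpow
  refine spectralMeasure_unique (ae_cylinderMeasure_norm h.pos) (ae_cylinderMeasure_norm h.pos)
    h.pos h.lt_two (cylinderShift α (normSeminorm ℝ _) Γ + μ)
    (cylinderShift α (normSeminorm ℝ _) M) fun u => ?_
  rw [← h.charFun_eq_norm, hc u, exponent_norm hΓ h.pos h.lt_two, inner_add_right]
  congr 1
  push_cast; ring

/-- Replacing u by -u in the characteristic function reflects the spherical measure and the shift; a
symmetric law thus has two representations on the sphere, which must coincide. -/
lemma symm_norm (hν : IsSymmMeasure ν) :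
    (cylinderMeasure α (normSeminorm ℝ _) M).map (fun s => -s) =
      cylinderMeasure α (normSeminorm ℝ _) M := by
  set S := cylinderMeasure α (normSeminorm ℝ _) M
  have : IsFiniteMeasure S := isFiniteMeasure_cylinderMeasure_norm h.exponent.rpow
  have hS : ∀ᵐ s ∂S, ‖s‖ = 1 := ae_cylinderMeasure_norm h.pos
  have hneg : ∀ u, charFun ν (-u) = charFun ν u := fun u => by
    conv_rhs => rw [← hν, charFun_apply, integral_map (by fun_prop) (by fun_prop)]
    rw [charFun_apply]
    simp
  refine spectralMeasure_unique ?_ hS h.pos h.lt_two (-cylinderShift α (normSeminorm ℝ _) M)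
    (cylinderShift α (normSeminorm ℝ _) M) fun u => ?_
  · rw [ae_map_iff (by fun_prop) (measurableSet_eq_fun (by fun_prop) (by fun_prop))]
    simpa using hS
  · have hk := continuous_stableKernel h.pos h.lt_two
    rw [← h.charFun_eq_norm, ← hneg, h.charFun_eq_norm, integral_map (by fun_prop) (by fun_prop)]
    simp [S]

/-- Symmetry is inherited from the spherical measure, so no integrability of ln p is required. -/
lemma symm (hν : IsSymmMeasure ν) (p : Seminorm ℝ (EuclideanSpace ℝ (Fin d))) :
    IsSymmMeasure (cylinderMeasure α p M) := by
  rw [IsSymmMeasure, ← cylinderMeasure_norm h.pos, cylinderMeasure_map_neg, h.symm_norm hν]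

/-- A symmetric stable law has no shift. -/
lemma shift_eq_zero_of_symm (hν : IsSymmMeasure ν) (hN : ∀ᵐ s ∂M, p s = 0 → s = 0)
    (hl : α = 1 → Integrable (fun s => ‖s‖ * |Real.log (p s)|) M) :
    cylinderShift α p M = 0 := by
  have he := h.exponent.cylinderMeasure h.pos hN hl
  have hc : ∀ u, charFun ν u = Complex.exp
      (-((∫ s, |inner ℝ u s| ^ α ∂(cylinderMeasure α p M) : ℝ) : ℂ) +
        Complex.I * ((inner ℝ u (cylinderShift α p M) : ℝ) : ℂ)) := fun u => by
    rw [h.charFun_eq, exponent_cylinderMeasure h.exponent h.pos h.lt_two hN hl,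
      integral_stableKernel_of_symm he h.pos h.lt_two (h.symm hν p)]
  have hneg : ∀ u, charFun ν (-u) = charFun ν u := fun u => by
    conv_rhs => rw [← hν, charFun_apply, integral_map (by fun_prop) (by fun_prop)]
    rw [charFun_apply]
    simp
  have : cylinderShift α p M = -cylinderShift α p M := shift_unique
    (fun u => -((∫ s, |inner ℝ u s| ^ α ∂(cylinderMeasure α p M) : ℝ) : ℂ)) _ _ fun u => by
      rw [← hc u, ← hneg, hc]
      simp
  have h2 : (2 : ℝ) • cylinderShift α p M = 0 := by
    rw [two_smul]
    nth_rewrite 1 [this]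
    exact neg_add_cancel _
  exact (smul_eq_zero.1 h2).resolve_left two_ne_zero

/-- Passing through the sphere, where the shift exists and vanishes, leaves only integrals of |⟨u,
s⟩|^α, and these transport to any cylinder without a logarithmic condition. This is why symmetry is
an alternative to the summability condition. -/
lemma charFun_eq_of_symm (hν : IsSymmMeasure ν) (hN : ∀ᵐ s ∂M, p s = 0 → s = 0)
    (u : EuclideanSpace ℝ (Fin d)) : charFun ν u =
      Complex.exp (-((∫ s, |inner ℝ u s| ^ α ∂(cylinderMeasure α p M) : ℝ) : ℂ)) := by
  have hN' : ∀ᵐ s ∂M, normSeminorm ℝ (EuclideanSpace ℝ (Fin d)) s = 0 → s = 0 :=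
    ae_of_all _ fun s hs => by simpa using hs
  have hl' : α = 1 → Integrable (fun s => ‖s‖ * |Real.log (normSeminorm ℝ _ s)|) M := by
    simpa using h.exponent.log
  rw [h.charFun_eq_norm, h.shift_eq_zero_of_symm hν hN' hl',
    integral_stableKernel_of_symm (h.exponent.cylinderMeasure h.pos hN' hl') h.pos h.lt_two
      (h.symm hν _), integral_abs_rpow_cylinderMeasure h.pos hN,
    integral_abs_rpow_cylinderMeasure h.pos hN']
  simp

lemma isSpectralRepr_of_symm (hν : IsSymmMeasure ν) (hN : ∀ᵐ s ∂M, p s = 0 → s = 0) :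
    IsSpectralRepr α ν p (cylinderMeasure α p M) 0 := by
  refine ⟨ae_iff.1 (ae_cylinderMeasure h.pos), fun hn => absurd hν hn, fun _ =>
    ⟨h.symm hν p, rfl, fun u => ?_, h.charFun_eq_of_symm hν hN⟩⟩
  exact (integrable_abs_rpow_cylinderMeasure h.pos hN u).2 (h.exponent.integrable_abs_rpow h.pos u)

lemma isSpectralRepr_of_not_symm (hν : ¬ IsSymmMeasure ν) (hN : ∀ᵐ s ∂M, p s = 0 → s = 0)
    (hl : α = 1 → Integrable (fun s => ‖s‖ * |Real.log (p s)|) M) :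
    IsSpectralRepr α ν p (cylinderMeasure α p M) (cylinderShift α p M) := by
  have he := h.exponent.cylinderMeasure h.pos hN hl
  refine ⟨ae_iff.1 (ae_cylinderMeasure h.pos), fun _ => ⟨fun u => ⟨fun _ =>
    he.integrable_abs_rpow h.pos u, fun hα => he.integrable_mul_log hα u⟩, fun u => ?_⟩,
    fun hs => absurd hs hν⟩
  rw [h.charFun_eq, exponent_cylinderMeasure h.exponent h.pos h.lt_two hN hl]

/-- Projecting Γ to the sphere and back to the cylinder returns Γ, since p = 1 there. The spherical
image of Γ does not charge {p = 0}, and it is also the spherical image of M. -/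
lemma eq_cylinderMeasure (hp : ∀ᵐ s ∂Γ, p s = 1)
    (he : cylinderMeasure α (normSeminorm ℝ _) Γ = cylinderMeasure α (normSeminorm ℝ _) M) :
    Γ = cylinderMeasure α p M ∧ ∀ᵐ s ∂M, p s = 0 → s = 0 := by
  constructor
  · rw [← cylinderMeasure_norm h.pos, ← he, cylinderMeasure_norm h.pos, cylinderMeasure_self hp]
  · refine ae_seminorm_ne_zero_of_cylinderMeasure h.pos ?_
    rw [← he]
    exact cylinderMeasure_norm_ae_ne_zero h.pos hp

lemma of_isSpectralRepr_symm (hν : IsSymmMeasure ν) (hr : IsSpectralRepr α ν p Γ μ) :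
    Γ = cylinderMeasure α p M ∧ μ = 0 ∧ ∀ᵐ s ∂M, p s = 0 → s = 0 := by
  obtain ⟨hp, -, hr⟩ := hr
  obtain ⟨hs, hμ, hi, hc⟩ := hr hν
  have hp' : ∀ᵐ s ∂Γ, p s = 1 := ae_iff.2 hp
  have hn : ∀ᵐ s ∂Γ, normSeminorm ℝ (EuclideanSpace ℝ (Fin d)) s = 0 → s = 0 :=
    ae_of_all _ fun s hs => by simpa using hs
  have hnM : ∀ᵐ s ∂M, normSeminorm ℝ (EuclideanSpace ℝ (Fin d)) s = 0 → s = 0 :=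
    ae_of_all _ fun s hs => by simpa using hs
  have hfin : Integrable (fun s => ‖s‖ ^ α) Γ := integrable_norm_rpow_of_inner h.pos hi
  have := isFiniteMeasure_cylinderMeasure_norm hfin
  have := isFiniteMeasure_cylinderMeasure_norm h.exponent.rpow
  have he : cylinderMeasure α (normSeminorm ℝ _) Γ = cylinderMeasure α (normSeminorm ℝ _) M := by
    refine ext_of_integral_abs_rpow (ae_cylinderMeasure_norm h.pos) (ae_cylinderMeasure_norm h.pos)
      h.pos h.lt_two ?_ (h.symm_norm hν) fun u => ?_
    · rw [cylinderMeasure_map_neg, hs]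
    · rw [integral_abs_rpow_cylinderMeasure h.pos hn, integral_abs_rpow_cylinderMeasure h.pos hnM]
      have := h.norm_charFun u
      rw [hc u, Complex.norm_exp] at this
      simpa using this
  exact ⟨(h.eq_cylinderMeasure hp' he).1, hμ, (h.eq_cylinderMeasure hp' he).2⟩

lemma of_isSpectralRepr_not_symm (hν : ¬ IsSymmMeasure ν) (hr : IsSpectralRepr α ν p Γ μ) :
    Γ = cylinderMeasure α p M ∧ (∀ᵐ s ∂M, p s = 0 → s = 0) ∧
      (α = 1 → Integrable (fun s => ‖s‖ * |Real.log (p s)|) M) ∧ μ = cylinderShift α p M := by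
  obtain ⟨hp, hr, -⟩ := hr
  obtain ⟨hi, hc⟩ := hr hν
  have hp' : ∀ᵐ s ∂Γ, p s = 1 := ae_iff.2 hp
  have hΓ : IsStableExponent α Γ := by
    refine .of_inner h.pos (fun u => ?_) fun hα u => (hi u).2 hα
    by_cases hα : α = 1
    · have h1 := (hi u).2 hα
      -- For α = 1 only |x| |ln|x|| is assumed integrable; the direction 2u provides the second
      -- logarithm from which the integrability of |x| is recovered.
      have h2 := (hi ((2 : ℝ) • u)).2 hα
      simp only [real_inner_smul_left] at h2
      subst hα
      simp only [Real.rpow_one]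
      exact integrable_abs_of_mul_log (by fun_prop) h1 h2
    · exact (hi u).1 hα
  obtain ⟨rfl, hN⟩ := h.eq_cylinderMeasure hp' (h.cylinderMeasure_norm_eq hΓ hc)
  have hl : α = 1 → Integrable (fun s => ‖s‖ * |Real.log (p s)|) M := by
    rintro rfl
    exact h.exponent.integrable_log hN hΓ
  refine ⟨rfl, hN, hl, shift_unique
    (fun u => -(∫ s, stableKernel α (inner ℝ u s) ∂(cylinderMeasure α p M))) _ _ fun u => ?_⟩
  rw [← hc u, h.charFun_eq, exponent_cylinderMeasure h.exponent h.pos h.lt_two hN hl]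

end HasStableExponent

end Representation

/-! ### Weighted sums of Dirac masses -/

/-- The measure `∑ₖ (w₁ δ_{Dₖ} + w₂ δ_{-Dₖ})`. -/
def atomMeasure {E : Type*} [NormedAddCommGroup E] [MeasurableSpace E] (w₁ w₂ : ℝ) (D : ℤ → E) :
    Measure E :=
  Measure.sum fun k =>
    ENNReal.ofReal w₁ • Measure.dirac (D k) + ENNReal.ofReal w₂ • Measure.dirac (-D k)

section Atoms

variable {E : Type*} [NormedAddCommGroup E] [MeasurableSpace E] {F : Type*}
  [NormedAddCommGroup F] {w₁ w₂ : ℝ} {D : ℤ → E} {f : E → F}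

lemma integrable_atomMeasure [BorelSpace E] (h₁ : 0 ≤ w₁) (h₂ : 0 ≤ w₂) :
    Integrable f (atomMeasure w₁ w₂ D) ↔
      Summable fun k => w₁ * ‖f (D k)‖ + w₂ * ‖f (-D k)‖ := by
  rw [atomMeasure, integrable_sum_measure_iff]
  have i : ∀ k, Integrable f (ENNReal.ofReal w₁ • Measure.dirac (D k) +
      ENNReal.ofReal w₂ • Measure.dirac (-D k)) := fun k =>
    ((integrable_dirac (by simp)).smul_measure (by simp)).add_measure
      ((integrable_dirac (by simp)).smul_measure (by simp))
  rw [and_iff_right i]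
  refine summable_congr fun k => ?_
  have i' := integrable_add_measure.1 (i k).norm
  rw [integral_add_measure i'.1 i'.2, integral_smul_measure, integral_smul_measure, integral_dirac,
    integral_dirac, ENNReal.toReal_ofReal h₁, ENNReal.toReal_ofReal h₂]
  rfl

lemma integrable_atomMeasure_of_even [BorelSpace E] (h₁ : 0 ≤ w₁) (h₂ : 0 ≤ w₂) (h : 0 < w₁ + w₂)
    (hf : ∀ s, ‖f (-s)‖ = ‖f s‖) :
    Integrable f (atomMeasure w₁ w₂ D) ↔ Summable fun k => ‖f (D k)‖ := by
  rw [integrable_atomMeasure h₁ h₂]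
  simp_rw [hf, ← add_mul]
  exact summable_mul_left_iff h.ne'

lemma hasSum_integral_atomMeasure [BorelSpace E] [NormedSpace ℝ F] [CompleteSpace F]
    (h₁ : 0 ≤ w₁) (h₂ : 0 ≤ w₂)
    (hf : Integrable f (atomMeasure w₁ w₂ D)) :
    HasSum (fun k => w₁ • f (D k) + w₂ • f (-D k)) (∫ s, f s ∂(atomMeasure w₁ w₂ D)) := by
  have := hasSum_integral_measure hf
  convert! this using 2 with k
  have i : Integrable f (ENNReal.ofReal w₁ • Measure.dirac (D k) +
      ENNReal.ofReal w₂ • Measure.dirac (-D k)) :=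
    ((integrable_dirac (by simp)).smul_measure (by simp)).add_measure
      ((integrable_dirac (by simp)).smul_measure (by simp))
  have i' := integrable_add_measure.1 i
  rw [integral_add_measure i'.1 i'.2, integral_smul_measure, integral_smul_measure, integral_dirac,
    integral_dirac, ENNReal.toReal_ofReal h₁, ENNReal.toReal_ofReal h₂]

lemma lintegral_atomMeasure {g : E → ENNReal} (hg : Measurable g) :
    ∫⁻ s, g s ∂(atomMeasure w₁ w₂ D) =
      ∑' k, (ENNReal.ofReal w₁ * g (D k) + ENNReal.ofReal w₂ * g (-D k)) := by
  simp [atomMeasure, lintegral_sum_measure, lintegral_dirac' _ hg]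

/-- One of the weights may vanish, as happens for β = ± 1; for a symmetric property the remaining
atom is enough. -/
lemma ae_atomMeasure_iff (h : 0 < w₁ + w₂) {P : E → Prop}
    (hP : MeasurableSet {s | P s}) (hn : ∀ s, P (-s) ↔ P s) :
    (∀ᵐ s ∂(atomMeasure w₁ w₂ D), P s) ↔ ∀ k, P (D k) := by
  have hm : MeasurableSet {a | ¬P a} := hP.compl
  rw [ae_iff, atomMeasure, Measure.sum_apply _ hm, ENNReal.tsum_eq_zero]
  refine forall_congr' fun k => ?_
  simp only [Measure.coe_add, Measure.coe_smul, Pi.add_apply, Pi.smul_apply, smul_eq_mul,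
    Measure.dirac_apply' _ hm, add_eq_zero, mul_eq_zero, ENNReal.ofReal_eq_zero,
    Set.indicator_apply_eq_zero, Set.mem_ofPred_eq, hn, Pi.one_apply, one_ne_zero, imp_false, not_not]
  constructor
  · rintro ⟨h3 | h3, h4 | h4⟩ <;> first | exact h3 | exact h4 | linarith
  · exact fun h => ⟨Or.inr h, Or.inr h⟩

end Atoms

/-! ### The measure of the coefficient vectors and the gap condition -/

section Coefficients

variable {α β σ : ℝ} {d : ℤ → ℝ} {m h : ℕ}
  {p : Seminorm ℝ (EuclideanSpace ℝ (Fin (m + h + 1)))}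

/-- The measure `σ^α ∑ₖ ((1 + β)/2 δ_{dₖ} + (1 - β)/2 δ_{-dₖ})` on the coefficient vectors. -/
def coefMeasure (α β σ : ℝ) (d : ℤ → ℝ) (m h : ℕ) :
    Measure (EuclideanSpace ℝ (Fin (m + h + 1))) :=
  atomMeasure (σ ^ α * ((1 + β) / 2)) (σ ^ α * ((1 - β) / 2)) (coefVec d m h)

lemma weight_nonneg (hβ : β ∈ Set.Icc (-1 : ℝ) 1) (hσ : 0 < σ) :
    0 ≤ σ ^ α * ((1 + β) / 2) ∧ 0 ≤ σ ^ α * ((1 - β) / 2) ∧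
      0 < σ ^ α * ((1 + β) / 2) + σ ^ α * ((1 - β) / 2) := by
  have h1 : 0 < σ ^ α := Real.rpow_pos_of_pos hσ α
  refine ⟨mul_nonneg h1.le (by linarith [hβ.1]), mul_nonneg h1.le (by linarith [hβ.2]), ?_⟩
  rw [← mul_add]
  ring_nf; exact h1

lemma cylinderMeasure_coefMeasure (hβ : β ∈ Set.Icc (-1 : ℝ) 1) (hσ : 0 < σ) :
    cylinderMeasure α p (coefMeasure α β σ d m h) = maSpectralMeasure α β σ d m h p := by
  obtain ⟨w1, w2, -⟩ := weight_nonneg (α := α) hβ hσ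
  refine Measure.ext_of_lintegral _ fun f hf => ?_
  rw [lintegral_cylinderMeasure hf, coefMeasure, lintegral_atomMeasure
    (measurable_density_mul_radial hf), maSpectralMeasure, lintegral_sum_measure]
  refine tsum_congr fun k => ?_
  rw [lintegral_add_measure, lintegral_smul_measure, lintegral_smul_measure, lintegral_dirac' _ hf,
    lintegral_dirac' _ hf, map_neg_eq_map, smul_neg, ENNReal.ofReal_mul w1, ENNReal.ofReal_mul w2,
    ← mul_assoc, ← mul_assoc]
  rfl

lemma exists_norm_coefVec_le (k : ℤ) : ∃ i : Fin (m + h + 1),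
    ‖coefVec d m h k‖ ≤ (m + h + 1 : ℕ) * |d (k + (m : ℤ) - ((i : ℕ) : ℤ))| := by
  rcases eq_or_ne (coefVec d m h k) 0 with h0 | h0
  · exact ⟨0, by rw [h0, norm_zero]; positivity⟩
  obtain ⟨i, hi⟩ := exists_norm_le_inner (EuclideanSpace.basisFun (Fin (m + h + 1)) ℝ) _ h0
  refine ⟨i, ?_⟩
  rw [Fintype.card_fin, EuclideanSpace.basisFun_inner] at hi
  exact hi

lemma summable_shift {f : ℤ → ℝ} (hf : Summable f) (m : ℕ) (i : ℕ) :
    Summable fun k : ℤ => f (k + (m : ℤ) - (i : ℤ)) := by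
  have := (Equiv.addRight ((m : ℤ) - (i : ℤ))).summable_iff.2 hf
  simpa [Function.comp_def, add_sub_assoc] using this

lemma isStableExponent_coefMeasure (h0 : 0 < α) (hβ : β ∈ Set.Icc (-1 : ℝ) 1) (hσ : 0 < σ)
    (hd : Summable fun k => |d k| ^ α)
    (hd1 : α = 1 → Summable fun k => |d k| * |Real.log (|d k|)|) :
    IsStableExponent α (coefMeasure α β σ d m h) := by
  obtain ⟨w1, w2, w3⟩ := weight_nonneg (α := α) hβ hσ
  set N : ℝ := ((m + h + 1 : ℕ) : ℝ)
  refine ⟨?_, fun hα => ?_⟩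
  · rw [coefMeasure, integrable_atomMeasure_of_even w1 w2 w3 (by simp)]
    refine Summable.of_nonneg_of_le (fun _ => norm_nonneg _) (fun k => ?_)
      (summable_sum (s := Finset.univ) fun (i : Fin (m + h + 1)) _ =>
        (summable_shift hd m i).mul_left (N ^ α))
    rw [Real.norm_of_nonneg (by positivity)]
    obtain ⟨i, hi⟩ := exists_norm_coefVec_le (d := d) (m := m) (h := h) k
    refine le_trans ?_ (Finset.single_le_sum (f := fun i : Fin (m + h + 1) =>
      N ^ α * |d (k + (m : ℤ) - ((i : ℕ) : ℤ))| ^ α) (fun i _ => by positivity)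
      (Finset.mem_univ i))
    rw [← Real.mul_rpow (by positivity) (by positivity)]
    exact Real.rpow_le_rpow (norm_nonneg _) hi h0.le
  · have hl := hd1 hα
    subst hα
    simp only [Real.rpow_one] at hd
    rw [coefMeasure, integrable_atomMeasure_of_even w1 w2 w3 (by simp)]
    refine Summable.of_nonneg_of_le (fun _ => norm_nonneg _) (fun k => ?_)
      (summable_sum (s := Finset.univ) fun (i : Fin (m + h + 1)) _ =>
        ((summable_shift hd m i).mul_left (1 + N ^ 2)).add ((summable_shift hl m i).mul_left N))
    rw [Real.norm_of_nonneg (by positivity)]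
    obtain ⟨i, hi⟩ := exists_norm_coefVec_le (d := d) (m := m) (h := h) k
    refine le_trans ?_ (Finset.single_le_sum (f := fun i : Fin (m + h + 1) =>
      (1 + N ^ 2) * |d (k + (m : ℤ) - ((i : ℕ) : ℤ))| + N * (|d (k + (m : ℤ) - ((i : ℕ) : ℤ))| *
        |Real.log (|d (k + (m : ℤ) - ((i : ℕ) : ℤ))|)|)) (fun i _ => by positivity)
      (Finset.mem_univ i))
    exact mul_abs_log_le (norm_nonneg _) (abs_nonneg _) hi

lemma integrable_log_coefMeasure_iff (hβ : β ∈ Set.Icc (-1 : ℝ) 1) (hσ : 0 < σ) :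
    Integrable (fun s => ‖s‖ * |Real.log (p s)|) (coefMeasure α β σ d m h) ↔
      Summable (maShiftTerm d m h p) := by
  obtain ⟨w1, w2, w3⟩ := weight_nonneg (α := α) hβ hσ
  rw [coefMeasure, integrable_atomMeasure_of_even w1 w2 w3 (by simp [map_neg_eq_map]),
    ← summable_norm_iff (f := maShiftTerm d m h p)]
  refine summable_congr fun k => ?_
  simp [maShiftTerm, norm_smul, mul_comm]

lemma cylinderShift_coefMeasure (hβ : β ∈ Set.Icc (-1 : ℝ) 1) (hσ : 0 < σ)
    (hs : α = 1 → Summable (maShiftTerm d m h p)) :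
    cylinderShift α p (coefMeasure α β σ d m h) = maShift α β σ d m h p := by
  obtain ⟨w1, w2, -⟩ := weight_nonneg (α := α) hβ hσ
  rw [cylinderShift, maShift]
  split_ifs with hα
  · have i := integrable_log_smul ((integrable_log_coefMeasure_iff (α := α) hβ hσ).2 (hs hα))
    rw [coefMeasure] at i ⊢
    rw [← (hasSum_integral_atomMeasure w1 w2 i).tsum_eq]
    -- The integrand is odd, so the atoms at ± d_k contribute with opposite signs, leaving the
    -- weight σ((1 + β) - (1 - β))/2 = βσ.
    have : ∀ k, (σ ^ α * ((1 + β) / 2)) • Real.log (p (coefVec d m h k)) • coefVec d m h k +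
        (σ ^ α * ((1 - β) / 2)) • Real.log (p (-coefVec d m h k)) • (-coefVec d m h k) =
        (β * σ) • maShiftTerm d m h p k := fun k => by
      subst hα
      rw [map_neg_eq_map, maShiftTerm, smul_neg, smul_neg, ← sub_eq_add_neg, ← sub_smul,
        Real.rpow_one]
      congr 1; ring
    simp_rw [this]
    rw [(hs hα).tsum_const_smul, smul_smul]
    congr 1; ring
  · rfl

/-- The two conditions differ by the series with terms ‖d_k‖ ln ‖d_k‖, which converges absolutely by
`hl`. -/
lemma logSummable_iff (hl : Summable fun k => ‖coefVec d m h k‖ * |Real.log ‖coefVec d m h k‖|)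
    (hN : ∀ k, p (coefVec d m h k) = 0 → coefVec d m h k = 0) :
    LogSummable d m h p ↔ Summable (maShiftTerm d m h p) := by
  rw [← summable_norm_iff (f := maShiftTerm d m h p), LogSummable]
  have e : ∀ k, ‖coefVec d m h k‖ * Real.log (p (coefVec d m h k) / ‖coefVec d m h k‖) =
      ‖coefVec d m h k‖ * Real.log (p (coefVec d m h k)) -
        ‖coefVec d m h k‖ * Real.log ‖coefVec d m h k‖ := fun k => by
    rcases eq_or_ne (coefVec d m h k) 0 with h0 | h0
    · simp [h0]
    · rw [Real.log_div (fun h => h0 (hN k h)) (norm_ne_zero_iff.2 h0)]; ring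
  have hl' : Summable fun k => ‖coefVec d m h k‖ * Real.log ‖coefVec d m h k‖ := by
    rw [← summable_norm_iff]
    simpa using hl
  have e1 : (fun k => ‖coefVec d m h k‖ * |Real.log (p (coefVec d m h k) / ‖coefVec d m h k‖)|) =
      fun k => ‖‖coefVec d m h k‖ * Real.log (p (coefVec d m h k) / ‖coefVec d m h k‖)‖ := by
    ext k; simp
  have e2 : (fun k => ‖maShiftTerm d m h p k‖) =
      fun k => ‖‖coefVec d m h k‖ * Real.log (p (coefVec d m h k))‖ := by
    ext k; simp [maShiftTerm, norm_smul, mul_comm]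
  rw [e1, e2, summable_norm_iff, summable_norm_iff]
  simp_rw [e]
  exact ⟨fun h => by simpa using h.add hl', fun h => h.sub hl'⟩

lemma coefVec_apply (k : ℤ) (i : Fin (m + h + 1)) :
    coefVec d m h k i = d (k + (m : ℤ) - ((i : ℕ) : ℤ)) := rfl

/-- Every nonzero coefficient vector has a nonzero past if and only if `m` is at least the largest
gap of `d`. -/
lemma forall_coefVec_iff (hp : IsPastSeminorm m h p) (hh : 1 ≤ h) :
    (∀ k, p (coefVec d m h k) = 0 → coefVec d m h k = 0) ↔ maxGap d ≤ m := by
  constructor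
  · intro hN
    refine iSup₂_le fun n hn => ?_
    obtain ⟨-, k, hz, hk⟩ := hn
    rw [Nat.cast_le]
    by_contra! hmn
    -- The vector at index k + 1 has past entries d_{k+1}, …, d_{k+1+m}, all inside the gap, while
    -- its first future entry, at position m + 1, is d_k ≠ 0; this entry exists because h ≥ 1.
    have h0 := hN (k + 1) ((hp _).2 fun i hi => by
      rw [coefVec_apply]
      have := hz (1 + m - i) (by omega) (by omega)
      rwa [show k + ((1 + m - i : ℕ) : ℤ) = k + 1 + m - i by omega] at this)
    have := congrArg (fun v => v.ofLp (⟨m + 1, by omega⟩ : Fin (m + h + 1))) h0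
    simp only [coefVec_apply] at this
    push_cast at this
    rw [show k + 1 + (m : ℤ) - (m + 1) = k by ring] at this
    exact hk this
  · intro hgap k hk
    rw [hp] at hk
    by_contra hne
    have hex : ∃ j : ℕ, d (k - j) ≠ 0 := by
      by_contra! hall
      refine hne ?_
      ext i
      by_cases hi : (i : ℕ) ≤ m
      · exact hk i hi
      · rw [coefVec_apply]
        have := hall (i - m)
        rw [show k - ((i - m : ℕ) : ℤ) = k + m - i by omega] at this
        simpa using this
    classical
    -- The nearest nonzero coefficient to the left of k is d_{k-j}.
    set j := Nat.find hex with hj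
    have hpos : 0 < j := by
      rw [Nat.pos_iff_ne_zero]
      intro h0
      have h1 := Nat.find_spec hex
      rw [← hj, h0] at h1
      have h2 := hk ⟨m, by omega⟩ le_rfl
      rw [coefVec_apply] at h2
      simp at h1 h2
      exact h1 h2
    -- After d_{k-j} come j - 1 zeros by minimality of j and m + 1 zeros from the past of the
    -- vector: a gap of length m + j > m.
    have hmem : (m + j) ∈ {m : ℕ | 1 ≤ m ∧ ∃ k : ℤ,
        (∀ j : ℕ, 1 ≤ j → j ≤ m → d (k + (j : ℤ)) = 0) ∧ d k ≠ 0} := by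
      refine ⟨by omega, k - j, fun l hl1 hl2 => ?_, Nat.find_spec hex⟩
      by_cases hlj : l < j
      · have := Nat.find_min hex (m := j - l) (by omega)
        rw [not_not, show k - ((j - l : ℕ) : ℤ) = k - j + l by omega] at this
        exact this
      · have := hk ⟨m + j - l, by omega⟩ (by simp; omega)
        rw [coefVec_apply] at this
        rw [← this]
        congr 1
        simp only
        omega
    have := (le_iSup₂ (f := fun (m : ℕ) (_ : m ∈ {m : ℕ | 1 ≤ m ∧ ∃ k : ℤ,
        (∀ j : ℕ, 1 ≤ j → j ≤ m → d (k + (j : ℤ)) = 0) ∧ d k ≠ 0}) => (m : ℕ∞)) _ hmem).trans hgap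
    rw [Nat.cast_le] at this
    omega

lemma ae_coefMeasure_iff (hβ : β ∈ Set.Icc (-1 : ℝ) 1) (hσ : 0 < σ) (hp : IsPastSeminorm m h p)
    (hh : 1 ≤ h) :
    (∀ᵐ s ∂(coefMeasure α β σ d m h), p s = 0 → s = 0) ↔ maxGap d ≤ m := by
  obtain ⟨-, -, w3⟩ := weight_nonneg (α := α) hβ hσ
  rw [← forall_coefVec_iff hp hh, coefMeasure, ae_atomMeasure_iff w3]
  · have : {s | p s = 0 → s = 0} = {s | p s ≠ 0} ∪ {0} := by
      ext s; simp [imp_iff_not_or, or_comm]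
    rw [this]
    exact (measurableSet_ne_zero p).union (measurableSet_singleton 0)
  · simp [map_neg_eq_map]

end Coefficients

/-! ### Admissible seminorms -/

section Admissible

variable {m h : ℕ}

/-- The projection to the coordinates `x_{-m}, …, x_0`. -/
def pastProj (m h : ℕ) :
    EuclideanSpace ℝ (Fin (m + h + 1)) →ₗ[ℝ] EuclideanSpace ℝ (Fin (m + h + 1)) where
  toFun x := WithLp.toLp 2 fun i => if (i : ℕ) ≤ m then x i else 0
  map_add' x y := by ext i; simp; split_ifs <;> simp
  map_smul' c x := by ext i; simp

lemma pastProj_apply (x : EuclideanSpace ℝ (Fin (m + h + 1))) (i : Fin (m + h + 1)) :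
    pastProj m h x i = if (i : ℕ) ≤ m then x i else 0 := rfl

lemma pastProj_eq_zero (x : EuclideanSpace ℝ (Fin (m + h + 1))) :
    pastProj m h x = 0 ↔ ∀ i : Fin (m + h + 1), (i : ℕ) ≤ m → x i = 0 := by
  constructor
  · intro hx i hi
    have := congrArg (fun v => v.ofLp i) hx
    simpa [pastProj_apply, hi] using this
  · intro hx
    ext i
    rw [pastProj_apply]
    split_ifs with hi
    · exact hx i hi
    · rfl

/-- The Euclidean seminorm of the past coordinates. -/
def pastSeminorm (m h : ℕ) : Seminorm ℝ (EuclideanSpace ℝ (Fin (m + h + 1))) :=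
  (normSeminorm ℝ _).comp (pastProj m h)

lemma pastSeminorm_apply (x : EuclideanSpace ℝ (Fin (m + h + 1))) :
    pastSeminorm m h x = ‖pastProj m h x‖ := rfl

lemma isPastSeminorm_pastSeminorm : IsPastSeminorm m h (pastSeminorm m h) := fun x => by
  rw [pastSeminorm_apply, norm_eq_zero, pastProj_eq_zero]

/-- An admissible seminorm depends only on the past projection of x. On the compact unit sphere of
the past subspace it is continuous and positive, hence bounded below. -/
lemma IsPastSeminorm.exists_bounds {p : Seminorm ℝ (EuclideanSpace ℝ (Fin (m + h + 1)))}
    (hp : IsPastSeminorm m h p) : ∃ c C : ℝ, 0 < c ∧ 0 < C ∧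
      ∀ x, c * pastSeminorm m h x ≤ p x ∧ p x ≤ C * pastSeminorm m h x := by
  have hproj : ∀ x, p (pastProj m h x) = p x := fun x => by
    have h0 : p (x - pastProj m h x) = 0 := (hp _).2 fun i hi => by
      simp [pastProj_apply, hi]
    refine le_antisymm ?_ ?_
    · have := map_sub_le_add p x (x - pastProj m h x)
      rw [sub_sub_cancel, h0, add_zero] at this
      exact this
    · have := map_add_le_add p (x - pastProj m h x) (pastProj m h x)
      rw [sub_add_cancel, h0, zero_add] at this
      exact this
  obtain ⟨C, hC, hle⟩ := p.exists_le_mul_norm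
  have hlin : ∀ x, pastProj m h (pastProj m h x) = pastProj m h x := fun x => by
    ext i; simp only [pastProj_apply]; split_ifs <;> rfl
  set K : Set (EuclideanSpace ℝ (Fin (m + h + 1))) :=
    {x | pastProj m h x = x} ∩ Metric.sphere 0 1
  have hK : IsCompact K := (isCompact_sphere _ _).inter_left
    (isClosed_eq (pastProj m h).continuous_of_finiteDimensional continuous_id)
  obtain ⟨c, hc, hcK⟩ : ∃ c, 0 < c ∧ ∀ x ∈ K, c ≤ p x := by
    rcases K.eq_empty_or_nonempty with he | hne
    · exact ⟨1, one_pos, by simp [he]⟩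
    obtain ⟨x, hx, hmin⟩ := hK.exists_isMinOn hne p.continuous_of_finiteDimensional.continuousOn
    refine ⟨p x, lt_of_le_of_ne (apply_nonneg p x) fun h0 => ?_, fun y hy => hmin hy⟩
    have h1 := (pastProj_eq_zero x).2 ((hp x).1 h0.symm)
    have h2 : pastProj m h x = x := hx.1
    have h3 := mem_sphere_zero_iff_norm.1 hx.2
    rw [← h2, h1, norm_zero] at h3
    exact zero_ne_one h3
  refine ⟨c, C + 1, hc, by linarith, fun x => ⟨?_, ?_⟩⟩
  · rw [pastSeminorm_apply, ← hproj x]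
    set y := pastProj m h x with hy
    rcases eq_or_ne y 0 with h0 | h0
    · simp [h0]
    have hn := norm_pos_iff.2 h0
    have := hcK (‖y‖⁻¹ • y) ⟨by
      change pastProj m h _ = _
      rw [map_smul, hy, hlin], by simp [norm_smul, hn.ne']⟩
    rw [map_smul_eq_mul, norm_inv, norm_norm, le_inv_mul_iff₀ hn] at this
    linarith
  · rw [pastSeminorm_apply, ← hproj x]
    exact (hle _).trans (by gcongr; linarith)

/-- The summability condition does not depend on the choice of the admissible seminorm. -/
lemma LogSummable.congr_seminorm {d : ℤ → ℝ}
    {p q : Seminorm ℝ (EuclideanSpace ℝ (Fin (m + h + 1)))}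
    (hp : IsPastSeminorm m h p) (hq : IsPastSeminorm m h q)
    (hd : Summable fun k => ‖coefVec d m h k‖)
    (hN : ∀ k, p (coefVec d m h k) = 0 → coefVec d m h k = 0) (hs : LogSummable d m h p) :
    LogSummable d m h q := by
  obtain ⟨c, C, hc, hC, hb⟩ := hp.exists_bounds
  obtain ⟨c', C', hc', hC', hb'⟩ := hq.exists_bounds
  -- The ratio q/p lies between c'/C and C'/c, so changing the seminorm changes each term by at most
  -- L ‖d_k‖.
  set L := |Real.log (c' / C)| + |Real.log (C' / c)|
  refine Summable.of_nonneg_of_le (fun k => by positivity) (fun k => ?_)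
    (hs.add (hd.mul_right L))
  rcases eq_or_ne (coefVec d m h k) 0 with h0 | h0
  · simp [h0]
  set x := coefVec d m h k
  have hpx : 0 < p x := lt_of_le_of_ne (apply_nonneg p x) fun e => h0 (hN k e.symm)
  have hr : 0 < pastSeminorm m h x := by
    by_contra! hle
    nlinarith [(hb x).2]
  have hqx : 0 < q x := lt_of_lt_of_le (by positivity) (hb' x).1
  have hn := norm_pos_iff.2 h0
  have e : Real.log (q x / ‖x‖) = Real.log (p x / ‖x‖) + Real.log (q x / p x) := by
    rw [← Real.log_mul (by positivity) (by positivity)]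
    congr 1; field_simp
  have hlow : c' / C ≤ q x / p x := by
    rw [div_le_div_iff₀ hC hpx]
    nlinarith [(hb x).2, (hb' x).1]
  have hup : q x / p x ≤ C' / c := by
    rw [div_le_div_iff₀ hpx hc]
    nlinarith [(hb x).1, (hb' x).2]
  have hL : |Real.log (q x / p x)| ≤ L := by
    have h1 := Real.log_le_log (by positivity) hlow
    have h2 := Real.log_le_log (by positivity) hup
    rw [abs_le]
    constructor
    · linarith [neg_abs_le (Real.log (c' / C)), abs_nonneg (Real.log (C' / c))]
    · linarith [le_abs_self (Real.log (C' / c)), abs_nonneg (Real.log (c' / C))]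
  rw [e, ← mul_add]
  gcongr
  exact (abs_add_le _ _).trans (by gcongr)

end Admissible

/-! ### Tails of stable laws -/

section Tail

variable {α β σ : ℝ} {ν : Measure ℝ}

lemma IsStableLaw.charFun_eq (h : IsStableLaw α β σ 0 ν) (u : ℝ) : charFun ν u =
    Complex.exp (((-(σ ^ α * |u| ^ α) : ℝ) : ℂ) +
      ((σ ^ α * β * oddKernel α u : ℝ) : ℂ) * Complex.I) := by
  rw [h u, oddKernel]
  congr 1
  push_cast
  ring

lemma one_sub_exp_mul_cos_le {x θ : ℝ} (hx : 0 ≤ x) :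
    1 - Real.exp (-x) * Real.cos θ ≤ x + θ ^ 2 / 2 := by
  have h1 := Real.one_sub_sq_div_two_le_cos (x := θ)
  have h2 := Real.add_one_le_exp (-x)
  have h3 : Real.exp (-x) ≤ 1 := Real.exp_le_one_iff.2 (by linarith)
  nlinarith [Real.exp_pos (-x), Real.cos_le_one θ]

/-- In 1 - Re φ the phase enters through 1 - cos θ ≤ θ²/2. The odd kernel may exceed |u|^α by a
logarithm, but its square is still O(|u|^α) near 0, so the tail bound has no logarithmic loss. -/
lemma exists_oddKernel_sq_le (h0 : 0 < α) :
    ∃ C, 0 ≤ C ∧ ∀ u : ℝ, |u| ≤ 2 → oddKernel α u ^ 2 ≤ C * |u| ^ α := by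
  by_cases hα : α = 1
  · subst hα
    refine ⟨(2 / Real.pi) ^ 2 * 4, by positivity, fun u hu => ?_⟩
    rw [oddKernel_one, Real.rpow_one, mul_pow, neg_sq, mul_assoc]
    gcongr
    rcases eq_or_ne u 0 with rfl | h
    · simp
    have hu' := abs_pos.2 h
    rw [← sq_abs, abs_mul_log, ← abs_of_pos hu', ← sq_abs, abs_abs, abs_mul, abs_abs, abs_abs]
    set t := |u|
    -- One factor t of t² ln² t is spent on the logarithm: |ln t| √t ≤ 2 on (0, 2].
    have hb : (|Real.log t| * t ^ (1 / 2 : ℝ)) ^ 2 ≤ 4 := by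
      have h4 : |Real.log t| * t ^ (1 / 2 : ℝ) ≤ 2 := by
        rcases le_total t 1 with h1 | h1
        · have := Real.abs_log_mul_self_rpow_lt t (1 / 2) hu' h1 (by norm_num)
          rw [abs_mul, abs_of_nonneg (by positivity : 0 ≤ t ^ (1 / 2 : ℝ))] at this
          norm_num at this ⊢
          exact this.le
        · have h5 : |Real.log t| ≤ 1 := by
            rw [abs_of_nonneg (Real.log_nonneg h1)]
            linarith [Real.log_le_sub_one_of_pos hu']
          have h6 : t ^ (1 / 2 : ℝ) ≤ 2 := by
            calc t ^ (1 / 2 : ℝ) ≤ t ^ (1 : ℝ) :=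
                  Real.rpow_le_rpow_of_exponent_le h1 (by norm_num)
              _ ≤ 2 := by rwa [Real.rpow_one]
          nlinarith [abs_nonneg (Real.log t), Real.rpow_nonneg hu'.le (1 / 2)]
      have := pow_le_pow_left₀ (by positivity) h4 2
      linarith
    have hsq : (t ^ (1 / 2 : ℝ)) ^ 2 = t := by
      rw [← Real.rpow_natCast, ← Real.rpow_mul hu'.le]; norm_num
    rw [mul_pow, hsq] at hb
    rw [mul_pow]
    nlinarith
  · refine ⟨Real.tan (Real.pi * α / 2) ^ 2 * 2 ^ α, by positivity, fun u hu => ?_⟩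
    have h1 : posRpow α u - posRpow α (-u) = Real.sign u * |u| ^ α :=
      (sign_mul_abs_rpow_eq_posRpow h0 u).symm
    have h2 : Real.sign u ^ 2 ≤ 1 := by
      rcases lt_trichotomy 0 u with h | rfl | h
      · simp [Real.sign_of_pos h]
      · simp
      · simp [Real.sign_of_neg h]
    have h3 : |u| ^ α ≤ 2 ^ α := Real.rpow_le_rpow (abs_nonneg u) hu h0.le
    have h4 : 0 ≤ |u| ^ α := by positivity
    rw [oddKernel_of_ne_one h0 hα, h1, mul_pow, mul_pow, mul_assoc]
    refine mul_le_mul_of_nonneg_left ?_ (sq_nonneg _)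
    calc Real.sign u ^ 2 * (|u| ^ α) ^ 2 ≤ 1 * (|u| ^ α) ^ 2 := by gcongr
      _ ≤ 2 ^ α * |u| ^ α := by rw [one_mul, sq]; gcongr

/-- The tail bound `P(|X| > r) = O(r^{-α})` of stable laws. -/
lemma IsStableLaw.exists_tail_le (h : IsStableLaw α β σ 0 ν) [IsProbabilityMeasure ν]
    (h0 : 0 < α) (hσ : 0 < σ) :
    ∃ C, 0 ≤ C ∧ ∀ r : ℝ, 1 ≤ r → ν.real {x | r < |x|} ≤ C * r ^ (-α) := by
  obtain ⟨C, hC, hk⟩ := exists_oddKernel_sq_le h0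
  set K : ℝ := σ ^ α + (σ ^ α * β) ^ 2 * C / 2
  have hK : 0 ≤ K := by positivity
  refine ⟨2 * K * 2 ^ α, by positivity, fun r hr => ?_⟩
  have hr0 : 0 < r := by linarith
  set a := 2 * r⁻¹ with ha
  have ha0 : 0 < a := by positivity
  have ha2 : a ≤ 2 := by
    have := inv_le_one_of_one_le₀ hr
    linarith
  -- Pairing t with -t cancels the imaginary parts, which are not small enough for the estimate.
  have hre : ∀ t : ℝ, (1 - charFun ν t) + (1 - charFun ν (-t)) =
      ((2 * (1 - Real.exp (-(σ ^ α * |t| ^ α)) * Real.cos (σ ^ α * β * oddKernel α t)) : ℝ) : ℂ) :=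
    fun t => by
      rw [charFun_neg]
      have : (charFun ν t).re =
          Real.exp (-(σ ^ α * |t| ^ α)) * Real.cos (σ ^ α * β * oddKernel α t) := by
        rw [h.charFun_eq, Complex.exp_add, ← Complex.ofReal_exp, Complex.re_ofReal_mul,
          Complex.exp_ofReal_mul_I_re]
      rw [← this]
      have := Complex.add_conj (charFun ν t)
      push_cast at this ⊢
      linear_combination -this
  have hi : ∀ b c, IntervalIntegrable (fun t => 1 - charFun ν t) volume b c := fun b c =>
    intervalIntegrable_const.sub intervalIntegrable_charFun
  have hi' : IntervalIntegrable (fun t => 1 - charFun ν (-t)) volume (-a) a :=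
    (continuous_const.sub (continuous_charFun.comp continuous_neg)).intervalIntegrable _ _
  have hsum : ∫ t in (-a)..a, ((1 - charFun ν t) + (1 - charFun ν (-t))) =
      2 * ∫ t in (-a)..a, (1 - charFun ν t) := by
    rw [intervalIntegral.integral_add (hi _ _) hi',
      intervalIntegral.integral_comp_neg (fun t => 1 - charFun ν t), neg_neg, two_mul]
  have hbound : ‖∫ t in (-a)..a, ((1 - charFun ν t) + (1 - charFun ν (-t)))‖ ≤
      2 * K * a ^ α * |a - -a| := by
    refine intervalIntegral.norm_integral_le_of_norm_le_const fun t ht => ?_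
    rw [Set.uIoc_of_le (by linarith)] at ht
    have hta : |t| ≤ a := abs_le.2 ⟨ht.1.le, ht.2⟩
    rw [hre, Complex.norm_real, Real.norm_eq_abs]
    have h1 := one_sub_exp_mul_cos_le (x := σ ^ α * |t| ^ α) (θ := σ ^ α * β * oddKernel α t)
      (by positivity)
    have h2 := hk t (hta.trans ha2)
    have h3 : |t| ^ α ≤ a ^ α := Real.rpow_le_rpow (abs_nonneg t) hta h0.le
    have h4 : σ ^ α * |t| ^ α + (σ ^ α * β * oddKernel α t) ^ 2 / 2 ≤ K * a ^ α := by
      calc σ ^ α * |t| ^ α + (σ ^ α * β * oddKernel α t) ^ 2 / 2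
          = σ ^ α * |t| ^ α + (σ ^ α * β) ^ 2 * oddKernel α t ^ 2 / 2 := by ring
        _ ≤ σ ^ α * |t| ^ α + (σ ^ α * β) ^ 2 * (C * |t| ^ α) / 2 := by gcongr
        _ = K * |t| ^ α := by ring
        _ ≤ K * a ^ α := by gcongr
    have h5 : 0 ≤ 1 - Real.exp (-(σ ^ α * |t| ^ α)) * Real.cos (σ ^ α * β * oddKernel α t) := by
      have h6 : Real.exp (-(σ ^ α * |t| ^ α)) ≤ 1 :=
        Real.exp_le_one_iff.2 (neg_nonpos.2 (by positivity))
      nlinarith [Real.cos_le_one (σ ^ α * β * oddKernel α t),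
        Real.exp_pos (-(σ ^ α * |t| ^ α))]
    rw [abs_of_nonneg (by linarith)]
    linarith
  rw [hsum, norm_mul, Complex.norm_two, abs_of_pos (by linarith)] at hbound
  -- The truncation inequality integrates 1 - φ over [-2/r, 2/r]; r ≥ 1 keeps this inside the range
  -- |t| ≤ 2 where the kernel bound holds.
  have hm := measureReal_abs_gt_le_integral_charFun (μ := ν) hr0
  rw [neg_mul, ← ha] at hm
  refine hm.trans ?_
  have hra : r * a = 2 := by rw [ha]; field_simp
  calc 2⁻¹ * r * ‖∫ t in (-a)..a, (1 - charFun ν t)‖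
      ≤ 2⁻¹ * r * (2 * K * a ^ α * a) := by
        gcongr; linarith
    _ = K * a ^ α * (r * a) := by ring
    _ = 2 * K * a ^ α := by rw [hra]; ring
    _ = 2 * K * 2 ^ α * r ^ (-α) := by
        rw [ha, Real.mul_rpow zero_le_two (by positivity), Real.inv_rpow hr0.le, Real.rpow_neg hr0.le]
        ring

lemma IsStableLaw.exists_measure_tail_le (h : IsStableLaw α β σ 0 ν) [IsProbabilityMeasure ν]
    (h0 : 0 < α) (hσ : 0 < σ) :
    ∃ C, 0 ≤ C ∧ ∀ r : ℝ, 1 ≤ r → ν {x | r < |x|} ≤ ENNReal.ofReal (C * r ^ (-α)) := by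
  obtain ⟨C, hC, hb⟩ := h.exists_tail_le h0 hσ
  refine ⟨C, hC, fun r hr => ?_⟩
  rw [← ofReal_measureReal]
  exact ENNReal.ofReal_le_ofReal (hb r hr)

/-- Stable laws have finite absolute moments of order less than `α`. -/
lemma IsStableLaw.lintegral_rpow_lt_top (h : IsStableLaw α β σ 0 ν) [IsProbabilityMeasure ν]
    (h0 : 0 < α) (hσ : 0 < σ) {s : ℝ} (hs : 0 < s) (hsα : s < α) :
    ∫⁻ x, ENNReal.ofReal (|x| ^ s) ∂ν < ⊤ := by
  obtain ⟨C, hC, hb⟩ := h.exists_measure_tail_le h0 hσ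
  rw [lintegral_rpow_eq_lintegral_meas_lt_mul ν (ae_of_all _ fun x => abs_nonneg x) (by fun_prop) hs]
  refine ENNReal.mul_lt_top (by simp) ?_
  -- Below 1 the probability is bounded by 1 and t^(s-1) is integrable since s > 0; above 1 the tail
  -- bound leaves t^(s-α-1), integrable since s < α.
  rw [← Set.Ioc_union_Ioi_eq_Ioi zero_le_one,
    lintegral_union measurableSet_Ioi (Set.Ioc_disjoint_Ioi le_rfl)]
  refine ENNReal.add_lt_top.2 ⟨?_, ?_⟩
  · have i : IntegrableOn (fun t : ℝ => t ^ (s - 1)) (Set.Ioc 0 1) :=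
      (intervalIntegrable_iff_integrableOn_Ioc_of_le zero_le_one).1
        (intervalIntegral.intervalIntegrable_rpow' (by linarith))
    refine lt_of_le_of_lt (lintegral_mono fun t => ?_) i.lintegral_lt_top
    exact (mul_le_mul_left prob_le_one _).trans (one_mul _).le
  · have i : IntegrableOn (fun t : ℝ => C * t ^ (s - α - 1)) (Set.Ioi 1) :=
      (integrableOn_Ioi_rpow_of_lt (by linarith) one_pos).const_mul C
    refine lt_of_le_of_lt (setLIntegral_mono' measurableSet_Ioi fun t ht => ?_)
      i.lintegral_lt_top
    have ht1 : 1 < t := ht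
    have ht0 : 0 < t := by linarith
    refine (mul_le_mul_left (hb t ht1.le) _).trans ?_
    rw [← ENNReal.ofReal_mul (by positivity), mul_assoc, ← Real.rpow_add ht0]
    refine (congrArg ENNReal.ofReal ?_).le
    congr 2; ring

/-- Truncated first moments of `1`-stable laws. -/
lemma IsStableLaw.exists_lintegral_min_le (h : IsStableLaw 1 β σ 0 ν) [IsProbabilityMeasure ν]
    (hσ : 0 < σ) : ∃ C, 0 ≤ C ∧ ∀ c : ℝ, |c| ≤ 1 →
      ∫⁻ x, ENNReal.ofReal (min |c * x| 1) ∂ν ≤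
        ENNReal.ofReal (|c| + C * (|c| * |Real.log (|c|)|)) := by
  obtain ⟨C, hC, hb⟩ := h.exists_measure_tail_le one_pos hσ
  refine ⟨C, hC, fun c hc1 => ?_⟩
  rcases eq_or_ne c 0 with rfl | hc
  · simp
  have hc0 : 0 < |c| := abs_pos.2 hc
  -- Layer cake, cut at |c| and 1: the first piece is at most |c|, the middle one is bounded by ∫
  -- C|c|/t dt over (|c|, 1], which yields the logarithm, and beyond 1 nothing is left.
  rw [lintegral_eq_lintegral_meas_lt ν (ae_of_all _ fun x => le_min (abs_nonneg _) zero_le_one)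
    (by fun_prop), ← Set.Ioc_union_Ioi_eq_Ioi hc0.le, ← Set.Ioc_union_Ioi_eq_Ioi hc1,
    lintegral_union (measurableSet_Ioc.union measurableSet_Ioi) (by
      rw [Set.Ioc_union_Ioi_eq_Ioi hc1]; exact Set.Ioc_disjoint_Ioi le_rfl),
    lintegral_union measurableSet_Ioi (Set.Ioc_disjoint_Ioi le_rfl),
    ENNReal.ofReal_add hc0.le (by positivity)]
  refine add_le_add ?_ ?_
  · refine (setLIntegral_mono' measurableSet_Ioc fun t _ => prob_le_one).trans ?_
    simp
  · have hz : ∫⁻ t in Set.Ioi (1 : ℝ), ν {a | t < min |c * a| 1} = 0 := by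
      refine (setLIntegral_congr_fun measurableSet_Ioi fun t ht => ?_).trans lintegral_zero
      have : {a : ℝ | t < min |c * a| 1} = ∅ := by
        ext a
        have ht : 1 < t := ht
        simp only [Set.mem_ofPred_eq, Set.mem_empty_iff_false, iff_false, not_lt]
        exact (min_le_right _ _).trans ht.le
      simp only [this, measure_empty]
    rw [hz, add_zero]
    have hlog : ∫ t in |c|..1, C * (|c| * t⁻¹) = C * (|c| * |Real.log (|c|)|) := by
      rw [intervalIntegral.integral_const_mul, intervalIntegral.integral_const_mul,
        integral_inv_of_pos hc0 one_pos, one_div, Real.log_inv,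
        abs_of_nonpos (Real.log_nonpos hc0.le hc1)]
    have hi : IntegrableOn (fun t : ℝ => C * (|c| * t⁻¹)) (Set.Ioc |c| 1) := by
      rw [← intervalIntegrable_iff_integrableOn_Ioc_of_le hc1]
      refine ((intervalIntegral.intervalIntegrable_inv (fun t ht => ?_)
        continuousOn_id).const_mul _).const_mul _
      rw [Set.uIcc_of_le hc1] at ht
      exact (hc0.trans_le ht.1).ne'
    rw [← hlog, intervalIntegral.integral_of_le hc1, ofReal_integral_eq_lintegral_ofReal hi]
    · refine setLIntegral_mono' measurableSet_Ioc fun t ht => ?_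
      have ht0 : 0 < t := hc0.trans ht.1
      have := hb (t / |c|) ((one_le_div hc0).2 ht.1.le)
      refine (measure_mono fun a ha => ?_).trans (this.trans (congrArg ENNReal.ofReal ?_).le)
      · have h1 : t < |c * a| := lt_of_lt_of_le ha (min_le_left _ _)
        rw [abs_mul] at h1
        exact (div_lt_iff₀' hc0).2 h1
      · rw [Real.rpow_neg_one]; field_simp
    · refine (ae_restrict_iff' measurableSet_Ioc).2 (ae_of_all _ fun t ht => ?_)
      have ht0 : 0 < t := hc0.trans ht.1
      simp only [Pi.zero_apply]
      positivity

end Tail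

/-! ### Stable moving averages -/

section Summability

variable {d : ℤ → ℝ} {α s : ℝ}

lemma eventually_abs_le_one_of_summable_rpow (hs : 0 < s) (hd : Summable fun k => |d k| ^ s) :
    ∀ᶠ k in Filter.cofinite, |d k| ≤ 1 := by
  filter_upwards [hd.tendsto_cofinite_zero.eventually (gt_mem_nhds zero_lt_one)] with k hk
  by_contra! h
  exact absurd hk (not_lt.2 (Real.one_le_rpow h.le hs.le))

lemma summable_rpow_of_le (hs : 0 < s) (hsα : s ≤ α) (hd : Summable fun k => |d k| ^ s) :
    Summable fun k => |d k| ^ α := by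
  refine Summable.of_norm_bounded_eventually hd ?_
  filter_upwards [eventually_abs_le_one_of_summable_rpow hs hd] with k hk
  rw [Real.norm_of_nonneg (by positivity)]
  rcases (abs_nonneg (d k)).eq_or_lt with h | h
  · rw [← h, Real.zero_rpow hs.ne', Real.zero_rpow (by linarith)]
  · exact Real.rpow_le_rpow_of_exponent_ge h hk hsα

/-- The strict inequality s < 1 leaves a factor |d_k|^(1-s), which makes the logarithm bounded for
|d_k| ≤ 1. -/
lemma summable_mul_log_of_rpow (hs : 0 < s) (hs1 : s < 1) (hd : Summable fun k => |d k| ^ s) :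
    Summable fun k => |d k| * |Real.log (|d k|)| := by
  refine Summable.of_norm_bounded_eventually (hd.mul_right (1 / (1 - s))) ?_
  filter_upwards [eventually_abs_le_one_of_summable_rpow hs hd] with k hk
  rw [Real.norm_of_nonneg (by positivity)]
  rcases (abs_nonneg (d k)).eq_or_lt with h | h
  · rw [← h]; simp [Real.zero_rpow hs.ne']
  · have := (Real.abs_log_mul_self_rpow_lt |d k| (1 - s) h hk (by linarith)).le
    rw [abs_mul, abs_of_nonneg (Real.rpow_nonneg h.le (1 - s))] at this
    have hsplit : |d k| ^ s * |d k| ^ (1 - s) = |d k| := by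
      rw [← Real.rpow_add h, add_sub_cancel, Real.rpow_one]
    calc |d k| * |Real.log (|d k|)|
        = |d k| ^ s * |d k| ^ (1 - s) * |Real.log (|d k|)| := by rw [hsplit]
      _ = |d k| ^ s * (|Real.log (|d k|)| * |d k| ^ (1 - s)) := by ring
      _ ≤ _ := by gcongr

lemma min_abs_one_le_rpow (hs : 0 < s) (hs1 : s ≤ 1) (x : ℝ) : min |x| 1 ≤ |x| ^ s := by
  rcases le_total |x| 1 with h | h
  · refine (min_le_left _ _).trans ?_
    rcases (abs_nonneg x).eq_or_lt with h' | h'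
    · rw [← h', Real.zero_rpow hs.ne']
    · simpa using Real.rpow_le_rpow_of_exponent_ge h' h hs1
  · exact (min_le_right _ _).trans (Real.one_le_rpow h hs.le)

lemma summable_of_summable_min {f : ℤ → ℝ} (hf : Summable fun k => min |f k| 1) : Summable f := by
  refine Summable.of_norm_bounded_eventually hf ?_
  filter_upwards [hf.tendsto_cofinite_zero.eventually (gt_mem_nhds zero_lt_one)] with k hk
  rw [Real.norm_eq_abs, le_min_iff]
  refine ⟨le_rfl, ?_⟩
  by_contra! h
  rw [min_eq_right h.le] at hk
  exact hk.false

end Summability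

lemma IsStableExponent.integrable_stableKernel {n : ℕ} {M : Measure (EuclideanSpace ℝ (Fin n))}
    {α : ℝ} (he : IsStableExponent α M) (h0 : 0 < α) (h2 : α < 2) (u : EuclideanSpace ℝ (Fin n)) :
    Integrable (fun s => stableKernel α (inner ℝ u s)) M := by
  simp_rw [stableKernel_eq]
  exact (he.integrable_abs_rpow h0 u).ofReal.sub
    ((he.integrable_oddKernel h0 h2 u).ofReal.const_mul _)

section MovingAverage

variable {Ω : Type*} [MeasurableSpace Ω] {P : Measure Ω}
  {α β σ : ℝ} {ε : ℤ → Ω → ℝ} {d : ℤ → ℝ}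

/-- A finite expectation of ∑ min(|f_k|, 1) makes this sum finite almost surely, and then the
truncation is inactive for all but finitely many k. Neither independence nor centring plays a role.
-/
lemma ae_summable_of_tsum_lintegral_min {f : ℤ → Ω → ℝ} (hf : ∀ k, Measurable (f k))
    (h : ∑' k, ∫⁻ ω, ENNReal.ofReal (min |f k ω| 1) ∂P ≠ ⊤) :
    ∀ᵐ ω ∂P, Summable fun k => f k ω := by
  have hm : ∀ k, Measurable fun ω => ENNReal.ofReal (min |f k ω| 1) := fun k =>
    ((hf k).abs.min measurable_const).ennreal_ofReal
  rw [← lintegral_tsum fun k => (hm k).aemeasurable] at h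
  filter_upwards [ae_lt_top (Measurable.tsum hm) h] with ω hω
  refine summable_of_summable_min ?_
  have := ENNReal.summable_toReal hω.ne
  refine this.congr fun k => ?_
  rw [ENNReal.toReal_ofReal (le_min (abs_nonneg _) zero_le_one)]

lemma tsum_ofReal_ne_top_of_le_eventually {f : ℤ → ENNReal} {g : ℤ → ℝ} (hg : Summable g)
    (hf : ∀ k, f k ≤ 1) (h : ∀ᶠ k in Filter.cofinite, f k ≤ ENNReal.ofReal (g k)) :
    ∑' k, f k ≠ ⊤ := by
  have hs : Summable fun k => (f k).toReal := by
    refine Summable.of_norm_bounded_eventually hg.abs ?_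
    filter_upwards [h] with k hk
    rw [Real.norm_of_nonneg ENNReal.toReal_nonneg]
    exact ENNReal.toReal_le_of_le_ofReal (abs_nonneg _)
      (hk.trans (ENNReal.ofReal_le_ofReal (le_abs_self _)))
  have e : ∀ k, f k = ENNReal.ofReal (f k).toReal := fun k =>
    (ENNReal.ofReal_toReal (ne_top_of_le_ne_top ENNReal.one_ne_top (hf k))).symm
  rw [tsum_congr e]
  exact hs.tsum_ofReal_ne_top

lemma lintegral_min_law {ν : Measure ℝ} {X : Ω → ℝ} (hX : Measurable X) (hν : P.map X = ν) (c : ℝ) :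
    ∫⁻ ω, ENNReal.ofReal (min |c * X ω| 1) ∂P = ∫⁻ x, ENNReal.ofReal (min |c * x| 1) ∂ν := by
  rw [← hν, lintegral_map (by fun_prop) hX]

/-- Almost sure absolute convergence if `∑ |dₖ|^s < ∞` for some `s < α`, `s ≤ 1`. -/
lemma ae_summable_of_summable_rpow [IsProbabilityMeasure P] (h0 : 0 < α) (hσ : 0 < σ) (hm : ∀ t, Measurable (ε t))
    (hl : ∀ t, IsStableLaw α β σ 0 (P.map (ε t))) {s : ℝ} (hs : 0 < s) (hsα : s < α) (hs1 : s ≤ 1)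
    (hd : Summable fun k => |d k| ^ s) (t : ℤ) :
    ∀ᵐ ω ∂P, Summable fun k : ℤ => d k * ε (t + k) ω := by
  have hprob : ∀ t, IsProbabilityMeasure (P.map (ε t)) := fun t =>
    Measure.isProbabilityMeasure_map (hm t).aemeasurable
  have hlaw : ∀ k, P.map (ε k) = P.map (ε 0) := fun k =>
    Measure.ext_of_charFun (funext fun u => by rw [hl k u, hl 0 u])
  refine ae_summable_of_tsum_lintegral_min (fun k => (hm _).const_mul _) ?_
  set I := ∫⁻ x, ENNReal.ofReal (|x| ^ s) ∂(P.map (ε 0)) with hI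
  have hIt : I < ⊤ := (hl 0).lintegral_rpow_lt_top h0 hσ hs hsα
  refine ne_top_of_le_ne_top (ENNReal.mul_ne_top hd.tsum_ofReal_ne_top hIt.ne)
    (le_trans (ENNReal.tsum_le_tsum fun k => ?_) ENNReal.tsum_mul_right.le)
  rw [lintegral_min_law (hm _) (hlaw _), hI, ← lintegral_const_mul' _ _ ENNReal.ofReal_ne_top]
  refine lintegral_mono fun x => ?_
  rw [← ENNReal.ofReal_mul (by positivity), ← Real.mul_rpow (abs_nonneg _) (abs_nonneg _), ← abs_mul]
  exact ENNReal.ofReal_le_ofReal (min_abs_one_le_rpow hs hs1 _)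

/-- Almost sure absolute convergence if `α = 1` and `∑ |dₖ| (1 + |ln |dₖ||) < ∞`. -/
lemma ae_summable_of_summable_log [IsProbabilityMeasure P] (hσ : 0 < σ) (hm : ∀ t, Measurable (ε t))
    (hl : ∀ t, IsStableLaw 1 β σ 0 (P.map (ε t))) (hd : Summable fun k => |d k|)
    (hd1 : Summable fun k => |d k| * |Real.log (|d k|)|) (t : ℤ) :
    ∀ᵐ ω ∂P, Summable fun k : ℤ => d k * ε (t + k) ω := by
  have hprob : ∀ t, IsProbabilityMeasure (P.map (ε t)) := fun t =>
    Measure.isProbabilityMeasure_map (hm t).aemeasurable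
  have hlaw : ∀ k, P.map (ε k) = P.map (ε 0) := fun k =>
    Measure.ext_of_charFun (funext fun u => by rw [hl k u, hl 0 u])
  obtain ⟨C, hC, hb⟩ := (hl 0).exists_lintegral_min_le hσ
  refine ae_summable_of_tsum_lintegral_min (fun k => (hm _).const_mul _) ?_
  refine tsum_ofReal_ne_top_of_le_eventually (hd.add (hd1.mul_left C)) (fun k => ?_) ?_
  · refine (lintegral_mono fun ω => ENNReal.ofReal_le_one.2 (min_le_right _ _)).trans ?_
    simp
  · filter_upwards [hd.tendsto_cofinite_zero.eventually (gt_mem_nhds zero_lt_one)] with k hk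
    rw [lintegral_min_law (hm _) (hlaw _)]
    exact hb _ hk.le

variable {m h : ℕ} {t : ℤ}

lemma aemeasurable_movingAverage (hm : ∀ t, Measurable (ε t))
    (hs : ∀ t : ℤ, ∀ᵐ ω ∂P, Summable fun k : ℤ => d k * ε (t + k) ω) (t : ℤ) :
    AEMeasurable (movingAverage d ε t) P := by
  refine aemeasurable_of_tendsto_metrizable_ae Filter.atTop
    (f := fun (s : Finset ℤ) ω => ∑ k ∈ s, d k * ε (t + k) ω) (fun s => ?_) ?_
  · exact (Finset.measurable_fun_sum s fun k _ => (hm _).const_mul _).aemeasurable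
  · filter_upwards [hs t] with ω hω
    exact hω.hasSum

lemma aemeasurable_pathVec (hm : ∀ t, Measurable (ε t))
    (hs : ∀ t : ℤ, ∀ᵐ ω ∂P, Summable fun k : ℤ => d k * ε (t + k) ω) :
    AEMeasurable (pathVec (movingAverage d ε) t m h) P := by
  refine (WithLp.measurable_toLp 2 _).comp_aemeasurable ?_
  exact aemeasurable_pi_lambda _ fun i => aemeasurable_movingAverage hm hs _

lemma hasSum_inner_pathVec (hs : ∀ t : ℤ, ∀ᵐ ω ∂P, Summable fun k : ℤ => d k * ε (t + k) ω)
    (u : EuclideanSpace ℝ (Fin (m + h + 1))) :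
    ∀ᵐ ω ∂P, HasSum (fun k : ℤ => inner ℝ u (coefVec d m h k) * ε (t + k) ω)
      (inner ℝ u (pathVec (movingAverage d ε) t m h ω)) := by
  filter_upwards [ae_all_iff.2 hs] with ω hω
  have h1 : ∀ i : Fin (m + h + 1), HasSum (fun k : ℤ =>
      u i * (d (k + (m : ℤ) - ((i : ℕ) : ℤ)) * ε (t + k) ω))
      (u i * movingAverage d ε (t - (m : ℤ) + ((i : ℕ) : ℤ)) ω) := fun i => by
    refine HasSum.mul_left _ ?_
    -- Shifting the summation index by m - i attaches every coordinate to the same noise ε_{t+k};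
    -- the coefficient becomes d_{k+m-i}, the i-th entry of `coefVec`.
    have := (Equiv.addRight ((m : ℤ) - ((i : ℕ) : ℤ))).hasSum_iff.2
      (hω (t - (m : ℤ) + ((i : ℕ) : ℤ))).hasSum
    convert! this using 2 with k
    simp only [Function.comp, Equiv.coe_addRight]
    rw [show t - (m : ℤ) + ((i : ℕ) : ℤ) + (k + ((m : ℤ) - ((i : ℕ) : ℤ))) = t + k by ring,
      ← add_sub_assoc]
  have h2 := hasSum_sum (s := Finset.univ) fun i _ => h1 i
  convert! h2 using 1
  · ext k
    simp only [PiLp.inner_apply, coefVec, RCLike.inner_apply, conj_trivial, Finset.sum_mul]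
    exact Finset.sum_congr rfl fun i _ => by ring
  · simp only [PiLp.inner_apply, pathVec, RCLike.inner_apply, conj_trivial]
    exact Finset.sum_congr rfl fun i _ => by ring

/-- The characteristic function of the paths of a stable moving average. -/
lemma charFun_pathLaw [IsProbabilityMeasure P] (h0 : 0 < α) (h2 : α < 2) (hβ : β ∈ Set.Icc (-1 : ℝ) 1) (hσ : 0 < σ)
    (hm : ∀ t, Measurable (ε t)) (hi : iIndepFun ε P)
    (hl : ∀ t, IsStableLaw α β σ 0 (P.map (ε t)))
    (hs : ∀ t : ℤ, ∀ᵐ ω ∂P, Summable fun k : ℤ => d k * ε (t + k) ω)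
    (he : IsStableExponent α (coefMeasure α β σ d m h))
    (u : EuclideanSpace ℝ (Fin (m + h + 1))) :
    charFun (pathLaw P (movingAverage d ε) t m h) u =
      Complex.exp (-(∫ s, stableKernel α (inner ℝ u s) ∂(coefMeasure α β σ d m h))) := by
  set x : ℤ → ℝ := fun k => inner ℝ u (coefVec d m h k) with hx
  have hprod : ∀ s : Finset ℤ, ∫ ω, Complex.exp (((∑ k ∈ s, x k * ε (t + k) ω : ℝ) : ℂ) *
      Complex.I) ∂P = ∏ k ∈ s, charFun (P.map (ε (t + k))) (x k) := fun s => by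
    have hind : iIndepFun (fun k : ℤ => fun ω => x k * ε (t + k) ω) P := by
      have h1 := hi.precomp (g := fun k : ℤ => t + k) (add_right_injective t)
      exact h1.comp (fun k y => x k * y) fun k => measurable_const_mul _
    have hind' := iIndepFun.precomp (g := fun k : s => (k : ℤ)) Subtype.val_injective hind
    have h3 := iIndepFun.charFun_map_fun_finsetSum_eq_prod (s := s)
      (X := fun k : ℤ => fun ω => x k * ε (t + k) ω)
      (fun k _ => ((hm _).const_mul _).aemeasurable) hind'
    have h4 := congrFun h3 1
    rw [charFun_apply_real, integral_map
      (Finset.measurable_fun_sum s fun k _ => (hm _).const_mul _).aemeasurable (by fun_prop),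
      Finset.prod_apply] at h4
    simp only [Complex.ofReal_one, one_mul] at h4
    rw [h4]
    refine Finset.prod_congr rfl fun k _ => ?_
    rw [charFun_map_mul_comp (hm _).aemeasurable, mul_one]
  -- The integrands have modulus one, so almost sure convergence of the finite sums passes to the
  -- characteristic functions by dominated convergence.
  have hlim1 : Filter.Tendsto (fun s : Finset ℤ => ∫ ω, Complex.exp
      (((∑ k ∈ s, x k * ε (t + k) ω : ℝ) : ℂ) * Complex.I) ∂P) Filter.atTop
      (nhds (charFun (pathLaw P (movingAverage d ε) t m h) u)) := by
    rw [charFun_apply, pathLaw, integral_map (aemeasurable_pathVec hm hs) (by fun_prop)]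
    refine tendsto_integral_filter_of_dominated_convergence (fun _ => 1)
      (Filter.Eventually.of_forall fun s => ?_) (Filter.Eventually.of_forall fun s =>
        ae_of_all _ fun ω => by rw [Complex.norm_exp_ofReal_mul_I]) (integrable_const _) ?_
    · have : Measurable fun ω => ∑ k ∈ s, x k * ε (t + k) ω :=
        Finset.measurable_fun_sum s fun k _ => (hm _).const_mul _
      fun_prop
    · filter_upwards [hasSum_inner_pathVec (t := t) hs u] with ω hω
      rw [real_inner_comm]
      have hc : Continuous fun y : ℝ => Complex.exp ((y : ℂ) * Complex.I) := by fun_prop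
      exact (hc.tendsto _).comp hω
  obtain ⟨w1, w2, -⟩ := weight_nonneg (α := α) hβ hσ
  have hsum := hasSum_integral_atomMeasure w1 w2 (he.integrable_stableKernel h0 h2 u)
  -- The atoms ± d_k with weights σ^α (1 ± β)/2 recombine: the even part of the kernel receives σ^α
  -- and the odd part βσ^α.
  have hterm : ∀ k, charFun (P.map (ε (t + k))) (x k) = Complex.exp (-(
      (σ ^ α * ((1 + β) / 2)) • stableKernel α (inner ℝ u (coefVec d m h k)) +
      (σ ^ α * ((1 - β) / 2)) • stableKernel α (inner ℝ u (-coefVec d m h k)))) := fun k => by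
    rw [(hl _).charFun_eq, inner_neg_right, stableKernel_eq, stableKernel_eq, oddKernel_neg, abs_neg]
    congr 1
    simp only [Complex.real_smul, hx]
    push_cast
    ring
  have hlim2 : Filter.Tendsto (fun s : Finset ℤ => ∏ k ∈ s, charFun (P.map (ε (t + k))) (x k))
      Filter.atTop (nhds (Complex.exp
        (-(∫ s, stableKernel α (inner ℝ u s) ∂(coefMeasure α β σ d m h))))) := by
    simp_rw [hterm, ← Complex.exp_sum]
    exact (Complex.continuous_exp.tendsto _).comp hsum.neg
  simp_rw [hprod] at hlim1
  exact tendsto_nhds_unique hlim1 hlim2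

end MovingAverage

/-! ### Criteria for representability of the paths -/

section Representability

variable {α β σ : ℝ} {d : ℤ → ℝ} {m h : ℕ} {ν : Measure (EuclideanSpace ℝ (Fin (m + h + 1)))}
  {p : Seminorm ℝ (EuclideanSpace ℝ (Fin (m + h + 1)))}

lemma summable_norm_coefVec_of_isStableExponent (hβ : β ∈ Set.Icc (-1 : ℝ) 1) (hσ : 0 < σ)
    (he : IsStableExponent 1 (coefMeasure 1 β σ d m h)) :
    (Summable fun k => ‖coefVec d m h k‖) ∧
      Summable fun k => ‖coefVec d m h k‖ * |Real.log ‖coefVec d m h k‖| := by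
  obtain ⟨w1, w2, w3⟩ := weight_nonneg (α := 1) hβ hσ
  constructor
  · have := (integrable_atomMeasure_of_even w1 w2 w3 (by simp)).1 he.rpow
    simpa using this
  · have := (integrable_atomMeasure_of_even w1 w2 w3 (by simp)).1 (he.log rfl)
    simpa using this

lemma HasStableExponent.isRepresentable_iff (hν : HasStableExponent α ν (coefMeasure α β σ d m h))
    (hβ : β ∈ Set.Icc (-1 : ℝ) 1) (hσ : 0 < σ) (hp : IsPastSeminorm m h p) (hh : 1 ≤ h) :
    IsRepresentable α ν p ↔
      maxGap d ≤ m ∧ (α = 1 → Summable (maShiftTerm d m h p) ∨ IsSymmMeasure ν) := by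
  rw [← ae_coefMeasure_iff (α := α) hβ hσ hp hh, ← integrable_log_coefMeasure_iff (α := α) hβ hσ]
  constructor
  · rintro ⟨Γ, μ, hr⟩
    by_cases hs : IsSymmMeasure ν
    · exact ⟨(hν.of_isSpectralRepr_symm hs hr).2.2, fun _ => Or.inr hs⟩
    · obtain ⟨-, hN, hl, -⟩ := hν.of_isSpectralRepr_not_symm hs hr
      exact ⟨hN, fun hα => Or.inl (hl hα)⟩
  · rintro ⟨hN, hl⟩
    by_cases hs : IsSymmMeasure ν
    · exact ⟨_, _, hν.isSpectralRepr_of_symm hs hN⟩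
    · exact ⟨_, _, hν.isSpectralRepr_of_not_symm hs hN fun hα => (hl hα).resolve_right hs⟩

lemma HasStableExponent.summable_maShiftTerm_iff
    (hν : HasStableExponent α ν (coefMeasure α β σ d m h))
    (hβ : β ∈ Set.Icc (-1 : ℝ) 1) (hσ : 0 < σ) (hp : IsPastSeminorm m h p) (hh : 1 ≤ h)
    (hg : maxGap d ≤ m) (hα : α = 1) : Summable (maShiftTerm d m h p) ↔ LogSummable d m h p := by
  subst hα
  exact (logSummable_iff (summable_norm_coefVec_of_isStableExponent hβ hσ hν.exponent).2
    ((forall_coefVec_iff hp hh).2 hg)).symm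

lemma HasStableExponent.logSummable_congr (hν : HasStableExponent α ν (coefMeasure α β σ d m h))
    {q : Seminorm ℝ (EuclideanSpace ℝ (Fin (m + h + 1)))}
    (hβ : β ∈ Set.Icc (-1 : ℝ) 1) (hσ : 0 < σ) (hp : IsPastSeminorm m h p)
    (hq : IsPastSeminorm m h q) (hh : 1 ≤ h) (hg : maxGap d ≤ m) (hα : α = 1) :
    LogSummable d m h p ↔ LogSummable d m h q := by
  subst hα
  have hs := (summable_norm_coefVec_of_isStableExponent hβ hσ hν.exponent).1
  exact ⟨.congr_seminorm hp hq hs ((forall_coefVec_iff hp hh).2 hg),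
    .congr_seminorm hq hp hs ((forall_coefVec_iff hq hh).2 hg)⟩

/-- Used for stationarity: the coefficient measure does not involve t, so neither does the law of
the path. -/
lemma HasStableExponent.eq {n : ℕ} {ν ν' M : Measure (EuclideanSpace ℝ (Fin n))}
    [IsFiniteMeasure ν] [IsFiniteMeasure ν']
    (hν : HasStableExponent α ν M) (hν' : HasStableExponent α ν' M) : ν = ν' :=
  Measure.ext_of_charFun (funext fun u => by rw [hν.charFun_eq, hν'.charFun_eq])

/-- A moving average of symmetric noise has symmetric paths. -/
lemma HasStableExponent.isSymmMeasure_of_beta_eq_zero [IsFiniteMeasure ν]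
    (hν : HasStableExponent α ν (coefMeasure α 0 σ d m h)) (hσ : 0 < σ) : IsSymmMeasure ν := by
  obtain ⟨w1, w2, -⟩ := weight_nonneg (α := α) (β := 0) (by simp) hσ
  have hsum := fun u => hasSum_integral_atomMeasure w1 w2
    (hν.exponent.integrable_stableKernel hν.pos hν.lt_two u)
  refine Measure.ext_of_charFun (funext fun u => ?_)
  have e : charFun (ν.map fun x => -x) u = charFun ν (-u) := by
    rw [charFun_apply, charFun_apply, integral_map (by fun_prop) (by fun_prop)]
    simp
  rw [e, hν.charFun_eq, hν.charFun_eq]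
  congr 2
  refine (hsum (-u)).unique ?_
  convert! hsum u using 2 with k
  simp only [inner_neg_left, inner_neg_right, neg_neg, add_zero, sub_zero]
  exact add_comm _ _

end Representability

section PastRepresentability

variable {Ω : Type*} [MeasurableSpace Ω] {P : Measure Ω} {α β σ : ℝ} {d : ℤ → ℝ} {m h : ℕ}
  {X : ℤ → Ω → ℝ} {q : Seminorm ℝ (EuclideanSpace ℝ (Fin (m + h + 1)))}

/-- Neither the gap condition nor, once it holds, the summability condition depends on the
admissible seminorm, so existence of a suitable one can be tested on the given q. -/
lemma isPastRepresentableAt_iff (hβ : β ∈ Set.Icc (-1 : ℝ) 1) (hσ : 0 < σ)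
    (hX : ∀ t, IsFiniteMeasure (pathLaw P X t m h))
    (hν : ∀ t, HasStableExponent α (pathLaw P X t m h) (coefMeasure α β σ d m h))
    (hq : IsPastSeminorm m h q) (hh : 1 ≤ h) :
    IsPastRepresentableAt α P X m h ↔
      maxGap d ≤ m ∧ (α = 1 → LogSummable d m h q ∨ HasSymmPaths P X m h) := by
  have hsymm : ∀ t, HasSymmPaths P X m h ↔ IsSymmMeasure (pathLaw P X t m h) := fun t =>
    ⟨fun hs => hs t, fun hs t' => by rwa [(hν t').eq (hν t)]⟩
  constructor
  · rintro ⟨p, hp, hr⟩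
    obtain ⟨hg, hl⟩ := ((hν 0).isRepresentable_iff hβ hσ hp hh).1 (hr 0)
    refine ⟨hg, fun hα => ?_⟩
    rw [(hν 0).summable_maShiftTerm_iff hβ hσ hp hh hg hα,
      (hν 0).logSummable_congr hβ hσ hp hq hh hg hα, ← hsymm 0] at hl
    exact hl hα
  · rintro ⟨hg, hl⟩
    refine ⟨q, hq, fun t => ((hν t).isRepresentable_iff hβ hσ hq hh).2 ⟨hg, fun hα => ?_⟩⟩
    rw [(hν t).summable_maShiftTerm_iff hβ hσ hq hh hg hα, ← hsymm t]
    exact hl hα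

end PastRepresentability

end

/-! ### The characterization of past-representability -/

theorem proposition3 {Ω : Type*} [MeasurableSpace Ω] (P : Measure Ω) [IsProbabilityMeasure P]
    (α β σ : ℝ) (hα0 : 0 < α) (hα2 : α < 2) (hβ : β ∈ Set.Icc (-1 : ℝ) 1) (hσ : 0 < σ)
    (ε : ℤ → Ω → ℝ) (hε_meas : ∀ t, Measurable (ε t)) (hε_indep : iIndepFun ε P)
    (hε_law : ∀ t, IsStableLaw α β σ 0 (P.map (ε t)))
    (d : ℤ → ℝ) (hd0 : ∃ k, d k ≠ 0)
    (hd : (α ≠ 1 ∨ (α = 1 ∧ β = 0)) →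
      ∃ s : ℝ, 0 < s ∧ s < α ∧ s ≤ 1 ∧ Summable fun k => |d k| ^ s)
    (hd1 : α = 1 → β ≠ 0 →
      (Summable fun k => |d k|) ∧ Summable fun k => |d k| * |Real.log (|d k|)|) :
    -- the series defining the moving average converges almost surely
    (∀ t : ℤ, ∀ᵐ ω ∂P, Summable fun k : ℤ => d k * ε (t + k) ω) ∧
    -- (i)(a)
    ((α ≠ 1 ∨ (α = 1 ∧ β = 0)) →
      (IsPastRepresentable α P (movingAverage d ε) ↔ maxGap d < ⊤) ∧
      ∀ m h : ℕ, 1 ≤ h →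
        (IsPastRepresentableAt α P (movingAverage d ε) m h ↔
          maxGap d < ⊤ ∧ maxGap d ≤ (m : ℕ∞))) ∧
    -- (i)(b)
    (α = 1 → β ≠ 0 →
      ∀ p : ∀ m h : ℕ, Seminorm ℝ (EuclideanSpace ℝ (Fin (m + h + 1))),
        (∀ m h, IsPastSeminorm m h (p m h)) →
        (IsPastRepresentable α P (movingAverage d ε) ↔
          maxGap d < ⊤ ∧ ∃ m h : ℕ, maxGap d ≤ (m : ℕ∞) ∧ 1 ≤ h ∧
            (LogSummable d m h (p m h) ∨ HasSymmPaths P (movingAverage d ε) m h)) ∧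
        ∀ m h : ℕ, 1 ≤ h →
          (IsPastRepresentableAt α P (movingAverage d ε) m h ↔
            maxGap d ≤ (m : ℕ∞) ∧
              (LogSummable d m h (p m h) ∨ HasSymmPaths P (movingAverage d ε) m h))) ∧
    -- (ii)
    (∀ m h : ℕ, 1 ≤ h → ∀ p : Seminorm ℝ (EuclideanSpace ℝ (Fin (m + h + 1))),
      IsPastSeminorm m h p → IsPastRepresentableAt α P (movingAverage d ε) m h → ∀ t : ℤ,
        -- the series of the shift vector converges, unless the path is symmetric
        (α = 1 → β ≠ 0 → ¬ IsSymmMeasure (pathLaw P (movingAverage d ε) t m h) →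
          Summable (maShiftTerm d m h p)) ∧
        -- the representation is unique and given by the formulas
        ((α = 1 → β ≠ 0 → Summable (maShiftTerm d m h p)) →
          ∀ Γ μ, IsSpectralRepr α (pathLaw P (movingAverage d ε) t m h) p Γ μ ↔
            Γ = maSpectralMeasure α β σ d m h p ∧ μ = maShift α β σ d m h p) ∧
        -- a symmetric path has no shift vector
        (IsSymmMeasure (pathLaw P (movingAverage d ε) t m h) →
          ∀ Γ μ, IsSpectralRepr α (pathLaw P (movingAverage d ε) t m h) p Γ μ ↔
            Γ = maSpectralMeasure α β σ d m h p ∧ μ = 0)) := by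
  have hA : Summable fun k => |d k| ^ α := by
    by_cases hc : α ≠ 1 ∨ (α = 1 ∧ β = 0)
    · obtain ⟨s, hs, hsα, -, hsum⟩ := hd hc
      exact summable_rpow_of_le hs hsα.le hsum
    · push Not at hc
      have hα := hc.1
      simpa [hα] using (hd1 hα (hc.2 hα)).1
  have hB : α = 1 → Summable fun k => |d k| * |Real.log (|d k|)| := fun hα => by
    by_cases hb : β = 0
    · obtain ⟨s, hs, hsα, -, hsum⟩ := hd (Or.inr ⟨hα, hb⟩)
      exact summable_mul_log_of_rpow hs (hα ▸ hsα) hsum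
    · exact (hd1 hα hb).2
  have hconv : ∀ t : ℤ, ∀ᵐ ω ∂P, Summable fun k : ℤ => d k * ε (t + k) ω := fun t => by
    by_cases hc : α ≠ 1 ∨ (α = 1 ∧ β = 0)
    · obtain ⟨s, hs, hsα, hs1, hsum⟩ := hd hc
      exact ae_summable_of_summable_rpow hα0 hσ hε_meas hε_law hs hsα hs1 hsum t
    · push Not at hc
      obtain ⟨rfl, hb⟩ := hc
      obtain ⟨h1, h2⟩ := hd1 rfl (hb rfl)
      exact ae_summable_of_summable_log hσ hε_meas hε_law h1 h2 t
  have hX : ∀ t m h, IsProbabilityMeasure (pathLaw P (movingAverage d ε) t m h) := fun t m h =>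
    Measure.isProbabilityMeasure_map (aemeasurable_pathVec hε_meas hconv)
  have hν : ∀ t m h, HasStableExponent α (pathLaw P (movingAverage d ε) t m h)
      (coefMeasure α β σ d m h) := fun t m h => by
    have he := isStableExponent_coefMeasure (m := m) (h := h) hα0 hβ hσ hA hB
    exact ⟨hα0, hα2, he,
      charFun_pathLaw hα0 hα2 hβ hσ hε_meas hε_indep hε_law hconv he⟩
  have hat : ∀ m h : ℕ, 1 ≤ h → ∀ q : Seminorm ℝ (EuclideanSpace ℝ (Fin (m + h + 1))),
      IsPastSeminorm m h q → (IsPastRepresentableAt α P (movingAverage d ε) m h ↔ maxGap d ≤ m ∧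
        (α = 1 → LogSummable d m h q ∨ HasSymmPaths P (movingAverage d ε) m h)) :=
    fun m h hh q hq => isPastRepresentableAt_iff hβ hσ (fun t => inferInstance)
      (fun t => hν t m h) hq hh
  have hsymm : α = 1 → β = 0 → ∀ t m h,
      IsSymmMeasure (pathLaw P (movingAverage d ε) t m h) := fun _ hb t m h => by
    subst hb
    exact (hν t m h).isSymmMeasure_of_beta_eq_zero hσ
  have hlt : ∀ {m : ℕ}, maxGap d ≤ m → maxGap d < ⊤ := fun hm =>
    hm.trans_lt (ENat.natCast_lt_top _)
  refine ⟨hconv, fun hc => ?_, fun hα hb p hp => ?_, fun m h hh p hp hr t => ?_⟩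
  · have hiff : ∀ m h : ℕ, 1 ≤ h → (IsPastRepresentableAt α P (movingAverage d ε) m h ↔
        maxGap d ≤ m) := fun m h hh => by
      rw [hat m h hh _ isPastSeminorm_pastSeminorm, and_iff_left_iff_imp]
      refine fun _ hα => Or.inr fun t => hsymm hα ?_ t m h
      exact (hc.resolve_left (not_not.2 hα)).2
    refine ⟨⟨?_, fun hg => ?_⟩, fun m h hh => ?_⟩
    · rintro ⟨m, h, hh, hr⟩
      exact hlt ((hiff m h hh).1 hr)
    -- A finite maximal gap is itself an admissible m, and any horizon then works, in particular h =
    -- 1.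
    · exact ⟨(maxGap d).toNat, 1, le_rfl,
        (hiff _ 1 le_rfl).2 (ENat.natCast_toNat hg.ne).ge⟩
    · rw [hiff m h hh]
      exact ⟨fun hg => ⟨hlt hg, hg⟩, fun hg => hg.2⟩
  · have hiff : ∀ m h : ℕ, 1 ≤ h → (IsPastRepresentableAt α P (movingAverage d ε) m h ↔
        maxGap d ≤ m ∧ (LogSummable d m h (p m h) ∨ HasSymmPaths P (movingAverage d ε) m h)) :=
      fun m h hh => by rw [hat m h hh _ (hp m h), imp_iff_right hα]
    refine ⟨⟨?_, ?_⟩, hiff⟩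
    · rintro ⟨m, h, hh, hr⟩
      obtain ⟨hg, hl⟩ := (hiff m h hh).1 hr
      exact ⟨hlt hg, m, h, hg, hh, hl⟩
    · rintro ⟨-, m, h, hg, hh, hl⟩
      exact ⟨m, h, hh, (hiff m h hh).2 ⟨hg, hl⟩⟩
  · obtain ⟨hg, hl⟩ := (hat m h hh p hp).1 hr
    have hN := (ae_coefMeasure_iff (α := α) hβ hσ hp hh).2 hg
    have hsymmRepr : IsSymmMeasure (pathLaw P (movingAverage d ε) t m h) → ∀ Γ μ,
        IsSpectralRepr α (pathLaw P (movingAverage d ε) t m h) p Γ μ ↔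
          Γ = maSpectralMeasure α β σ d m h p ∧ μ = 0 := fun hs Γ μ => by
      rw [← cylinderMeasure_coefMeasure hβ hσ]
      refine ⟨fun hr => ?_, ?_⟩
      · obtain ⟨h1, h2, -⟩ := (hν t m h).of_isSpectralRepr_symm hs hr
        exact ⟨h1, h2⟩
      · rintro ⟨rfl, rfl⟩
        exact (hν t m h).isSpectralRepr_of_symm hs hN
    refine ⟨fun hα hb hs => ?_, fun hsum Γ μ => ?_, hsymmRepr⟩
    · rw [(hν t m h).summable_maShiftTerm_iff hβ hσ hp hh hg hα]
      exact (hl hα).resolve_right fun h' => hs (h' t)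
    · by_cases hs : IsSymmMeasure (pathLaw P (movingAverage d ε) t m h)
      · rw [hsymmRepr hs]
        -- For a symmetric path whose shift series converges, the general formula must agree with
        -- the zero shift: for β = 0 by its prefactor, for β ≠ 0 because the law is invariant under
        -- reflection.
        have : maShift α β σ d m h p = 0 := by
          by_cases hα : α = 1
          · by_cases hb : β = 0
            · simp [maShift, hb]
            · have hsum' : α = 1 → Summable (maShiftTerm d m h p) := fun hα => hsum hα hb
              rw [← cylinderShift_coefMeasure hβ hσ hsum']
              exact (hν t m h).shift_eq_zero_of_symm hs hN fun hα =>
                (integrable_log_coefMeasure_iff (α := α) hβ hσ).2 (hsum' hα)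
          · rw [maShift, if_neg hα]
        rw [this]
      · have hsum' : α = 1 → Summable (maShiftTerm d m h p) := fun hα =>
          hsum hα fun hb => hs (hsymm hα hb t m h)
        rw [← cylinderMeasure_coefMeasure hβ hσ, ← cylinderShift_coefMeasure hβ hσ hsum']
        refine ⟨fun hr => ?_, ?_⟩
        · obtain ⟨h1, -, -, h2⟩ := (hν t m h).of_isSpectralRepr_not_symm hs hr
          exact ⟨h1, h2⟩
        · rintro ⟨rfl, rfl⟩
          exact (hν t m h).isSpectralRepr_of_not_symm hs hN fun hα =>
            (integrable_log_coefMeasure_iff (α := α) hβ hσ).2 (hsum' hα)
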